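/- **Conventions.** Languages and functions are over $\{0,1\}^*$; tuples of strings are coded as strings in a fixed standard way; $\mathbb{I}_S$ is the characteristic function of a language $S$. *Oracle classes.* For $f:\{0,1\}^*\to\{0,1\}^*$, $\mathbf{P}^f$ is the class of languages decided by a deterministic polynomial-time machine with oracle $f$. For a class $\mathcal{C}$ of functions, $\mathbf{PP}^{\mathcal{C}}$ is the class of languages $A$ for which there are $f\in\mathcal{C}$, $B\in\mathbf{P}^f$ and a polynomial $q$ such that for all $x$ $$x\in A\iff 2^{-q(|x|)}\,\bigl|\{y\in\{0,1\}^{q(|x|)}:(x,y)\in B\}\bigr|\ \ge\ \tfrac12 .$$ *Rational protocols.* A $k$-round rational interactive protocol consists of polynomial-time computable functions $V,\varphi:\{0,1\}^*\to\{0,1\}^*$ and $R:\{0,1\}^*\to[0,1]$ (values of $R$ being finite binary fractions) and of polynomials $p,l$. On input $x$, in round $i+1\le k$ Merlin sends a message $m_{i+1}$ of length at most $p(|x|)$ and Arthur answers $a_{i+1}=V(x;m_1,a_1,\dots,m_i,a_i,m_{i+1};r_1,\dots,r_{i+1})$, where $r_1,\dots,r_k$ are Arthur's private independent random strings, uniform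 on $\{0,1\}^{l(|x|)}$. The reward is $R(x;m_1,r_1,\dots,m_k,r_k)$ and the computed value is $\varphi(x;m_1,a_1,\dots,m_k)$. Merlin is rational if for all $i=0,\dots,k-1$ $$m_{i+1}\in\operatorname*{Argmax}_{m}\ \mathbb{E}_{a_{i+1}}\max_{m_{i+2}}\mathbb{E}_{a_{i+2}}\cdots\max_{m_k}\mathbb{E}_{r_1,\dots,r_k} R,$$ each expectation being conditional on the transcript of messages exchanged so far. The protocol computes $f$ if for every $x$, every rational behavior of Merlin and every outcome of Arthur's random strings, the computed value is $f(x)$. $\mathbf{FRMA}[k]$ is the class of functions computed by some $k$-round protocol, and $\mathbf{DRMA}[k]$ is the class of languages $S$ with $\mathbb{I}_S\in\mathbf{FRMA}[k]$. **Theorem.** For all integers $k\ge 0$, $$\mathbf{PP}^{\mathbf{FRMA}[k]}\subseteq\mathbf{DRMA}[k+1].$$ -/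

import Mathlib

open scoped BigOperators

namespace RationalProofs

/-! ### Strings, tuples of strings, binary fractions -/

/-- Binary strings; the fixed alphabet is `{0, 1}`. -/
abbrev Str : Type := List Bool

/-- Self-delimiting code of one component of a tuple: each bit `b` becomes `1 b`, and the
component is closed by `0`. -/
def encodeItem (w : Str) : Str :=
  (w.flatMap fun b => [true, b]) ++ [false]

/-- Injective code of a tuple of strings `(w₁, …, wₙ)` as one string. -/
def encodeTuple (ws : List Str) : Str :=
  ws.flatMap encodeItem

/-- The finite binary fraction written `b₀.b₁b₂…`, that is `∑ bᵢ 2⁻ⁱ`. -/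
def binFrac : Str → ℚ
  | [] => 0
  | b :: w => (if b then 1 else 0) + binFrac w / 2

open scoped Classical in
/-- The characteristic function of a language, with the one-letter values `1` and `0`. -/
noncomputable def charFn (S : Set Str) : Str → Str :=
  fun x => if x ∈ S then [true] else [false]

/-! ### Oracle machines with a step count

A machine has finitely many work tapes (the registers mentioned in its program), each used as
a stack of bits.  Its finite control is a structured program.  Every elementary
step reads or changes one cell at the top of one stack and costs one unit of time. -/

/-- Programs of oracle machines. -/
inductive Prog : Type
  /-- do nothing -/
  | skip : Prog
  /-- write the bit `b` on top of stack `r` -/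
  | push (r : ℕ) (b : Bool) : Prog
  /-- erase the top of stack `r` (nothing happens if it is empty) -/
  | pop (r : ℕ) : Prog
  /-- sequential composition -/
  | seq (c d : Prog) : Prog
  /-- branch on the top of stack `r`: it is `1`, it is `0`, or the stack is empty -/
  | branch (r : ℕ) (cOne cZero cEmpty : Prog) : Prog
  /-- repeat `c` as long as stack `r` is nonempty -/
  | loop (r : ℕ) (c : Prog) : Prog
  /-- ask the oracle for its value at the contents of stack `q`; the answer becomes the
  contents of stack `a` -/
  | query (q a : ℕ) : Prog

/-- The contents of all stacks; the head of the list is the top of the stack. -/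
abbrev Store : Type := ℕ → Str

/-- `Runs f c s s' t`: with oracle `f`, program `c` started in `s` halts in `s'` after exactly `t`
units of time.  A query `w` costs `|w| + 1`: as on a machine with a separate query tape, a query
has to be written symbol by symbol, also if it is the answer to an earlier query. -/
inductive Runs (f : Str → Str) : Prog → Store → Store → ℕ → Prop
  | skip (s : Store) : Runs f .skip s s 1
  | push (r : ℕ) (b : Bool) (s : Store) :
      Runs f (.push r b) s (Function.update s r (b :: s r)) 1
  | pop (r : ℕ) (s : Store) :
      Runs f (.pop r) s (Function.update s r (s r).tail) 1
  | seq {c d : Prog} {s s₁ s₂ : Store} {t₁ t₂ : ℕ} :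
      Runs f c s s₁ t₁ → Runs f d s₁ s₂ t₂ → Runs f (.seq c d) s s₂ (t₁ + t₂)
  | branchOne {r : ℕ} {cOne cZero cEmpty : Prog} {s s₁ : Store} {t : ℕ} :
      (s r).head? = some true → Runs f cOne s s₁ t →
      Runs f (.branch r cOne cZero cEmpty) s s₁ (t + 1)
  | branchZero {r : ℕ} {cOne cZero cEmpty : Prog} {s s₁ : Store} {t : ℕ} :
      (s r).head? = some false → Runs f cZero s s₁ t →
      Runs f (.branch r cOne cZero cEmpty) s s₁ (t + 1)
  | branchEmpty {r : ℕ} {cOne cZero cEmpty : Prog} {s s₁ : Store} {t : ℕ} :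
      s r = [] → Runs f cEmpty s s₁ t →
      Runs f (.branch r cOne cZero cEmpty) s s₁ (t + 1)
  | loopDone {r : ℕ} {c : Prog} {s : Store} :
      s r = [] → Runs f (.loop r c) s s 1
  | loopStep {r : ℕ} {c : Prog} {s s₁ s₂ : Store} {t₁ t₂ : ℕ} :
      s r ≠ [] → Runs f c s s₁ t₁ → Runs f (.loop r c) s₁ s₂ t₂ →
      Runs f (.loop r c) s s₂ (t₁ + t₂ + 1)
  | query (q a : ℕ) (s : Store) :
      Runs f (.query q a) s (Function.update s a (f (s q))) ((s q).length + 1)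

/-- The input is on stack `0`, all other stacks are empty. -/
def initStore (x : Str) : Store :=
  Function.update (fun _ => []) 0 x

/-- `g` is computed by a machine with oracle `f` in time polynomial in the length of the input;
the output is on stack `0`. -/
def PolyTimeIn (f g : Str → Str) : Prop :=
  ∃ (c : Prog) (T : Polynomial ℕ), ∀ x : Str, ∃ (s : Store) (t : ℕ),
    Runs f c (initStore x) s t ∧ s 0 = g x ∧ t ≤ T.eval x.length

/-- Polynomial-time computable functions: the oracle is the constant empty answer, so that a query
only erases a stack. -/
def PolyTime (g : Str → Str) : Prop :=
  PolyTimeIn (fun _ => []) g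

/-! ### The relativized classes -/

/-- The class `P^f` for a function oracle `f`. -/
def POracle (f : Str → Str) : Set (Set Str) :=
  {B | PolyTimeIn f (charFn B)}

/-- The class `PP^𝒞` for a class `𝒞` of functions: `x ∈ A` iff at least half of the
`y ∈ {0,1}^{q(|x|)}` satisfy `(x, y) ∈ B`, where `B ∈ P^f` for some `f ∈ 𝒞`. -/
def PPOracle (𝒞 : Set (Str → Str)) : Set (Set Str) :=
  {A | ∃ f ∈ 𝒞, ∃ B ∈ POracle f, ∃ q : Polynomial ℕ, ∀ x : Str,
    x ∈ A ↔
      (1 / 2 : ℚ) ≤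
        (Nat.card {y : Fin (q.eval x.length) → Bool // encodeTuple [x, List.ofFn y] ∈ B} : ℚ) /
          2 ^ (q.eval x.length)}

/-! ### Rational interactive protocols -/

/-- A `k`-round rational interactive protocol.  In each round Merlin sends one message and Arthur
answers.  Merlin's messages have length at most `msgLen(|x|)`; Arthur's random string in each
round is uniform on `{0,1}^{coinLen(|x|)}`.  Arthur's messages have polynomial
length because `V` is polynomial-time computable and the number of rounds is fixed. -/
structure Protocol (k : ℕ) where
  /-- Arthur's next message -/
  V : Str → Str
  /-- the reward function -/
  R : Str → ℚ
  /-- the value function -/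
  φ : Str → Str
  /-- bound on the length of Merlin's messages -/
  msgLen : Polynomial ℕ
  /-- length of Arthur's random string of one round -/
  coinLen : Polynomial ℕ
  V_polyTime : PolyTime V
  φ_polyTime : PolyTime φ
  /-- the reward is computed in polynomial time, as a finite binary fraction -/
  R_polyTime : ∃ ρ : Str → Str, PolyTime ρ ∧ ∀ w, R w = binFrac (ρ w)
  /-- the reward is in `[0, 1]` -/
  R_mem : ∀ w, R w ∈ Set.Icc (0 : ℚ) 1

/-- A transcript `m₁, a₁, …, mᵢ, aᵢ` of full rounds. -/
abbrev Transcript : Type := List (Str × Str)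

namespace Protocol

variable {k : ℕ} (P : Protocol k)

/-- Arthur's random strings `r₁, …, r_k` on input `x`. -/
abbrev Coins (x : Str) : Type :=
  Fin k → Fin (P.coinLen.eval x.length) → Bool

/-- The random strings as a list `[r₁, …, r_k]`. -/
def coinStrings (x : Str) (r : P.Coins x) : List Str :=
  List.ofFn fun i => List.ofFn (r i)

/-- Arthur's message `V(x; m₁, a₁, …, mᵢ, aᵢ, m; r₁, …, r_{i+1})` after the transcript `T` of
`i` rounds and Merlin's message `m`. -/
def arthur (x : Str) (r : P.Coins x) (T : Transcript) (m : Str) : Str :=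
  P.V (encodeTuple
    (x :: ((T.flatMap fun p => [p.1, p.2]) ++ m :: (P.coinStrings x r).take (T.length + 1))))

/-- The reward `R(x; m₁, r₁, …, m_k, r_k)`. -/
def reward (x : Str) (r : P.Coins x) (T : Transcript) : ℚ :=
  P.R (encodeTuple
    (x :: ((T.map Prod.fst).zip (P.coinStrings x r)).flatMap fun p => [p.1, p.2]))

/-- The value `φ(x; m₁, a₁, …, m_k)`; the last message of Arthur is dropped. -/
def value (x : Str) (T : Transcript) : Str :=
  P.φ (encodeTuple (x :: (T.flatMap fun p => [p.1, p.2]).dropLast))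

open scoped Classical in
/-- The random strings with which Arthur sends exactly his messages in `T`. -/
noncomputable def consistent (x : Str) (T : Transcript) : Finset (P.Coins x) :=
  Finset.univ.filter fun r =>
    ∀ (i : ℕ) (hi : i < T.length), T[i].2 = P.arthur x r (T.take i) T[i].1

/-- The messages that Merlin may send on input `x`. -/
noncomputable def messages (x : Str) : Finset Str :=
  (List.finite_length_le Bool (P.msgLen.eval x.length)).toFinset

theorem messages_nonempty (x : Str) : (P.messages x).Nonempty :=
  ⟨[], by simp [messages]⟩

/-- The conditional expected reward given the transcript `T` if `n` more rounds are to be played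
and Merlin chooses optimally in each of them:
`max_{m} 𝔼_{a} max_{m} 𝔼_{a} … R`, where every expectation is over Arthur's random strings,
conditional on the transcript so far. -/
noncomputable def optReward (x : Str) : ℕ → Transcript → ℚ
  | 0, T => 𝔼 r ∈ P.consistent x T, P.reward x r T
  | n + 1, T =>
    (P.messages x).sup' (P.messages_nonempty x) fun m =>
      𝔼 r ∈ P.consistent x T, optReward x n (T ++ [(m, P.arthur x r T m)])

/-- The conditional expected reward given the transcript `T` if Merlin sends `m` now and
chooses optimally in the rounds after that. -/
noncomputable def msgReward (x : Str) (T : Transcript) (m : Str) : ℚ :=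
  𝔼 r ∈ P.consistent x T,
    P.optReward x (k - (T.length + 1)) (T ++ [(m, P.arthur x r T m)])

/-- `m` is a rational message after the transcript `T`: it is in the argmax. -/
def IsRational (x : Str) (T : Transcript) (m : Str) : Prop :=
  m ∈ P.messages x ∧ ∀ m' ∈ P.messages x, P.msgReward x T m' ≤ P.msgReward x T m

/-- The transcript if Merlin sends `ms` and Arthur's random strings are `r`. -/
def transcript (x : Str) (r : P.Coins x) (ms : List Str) : Transcript :=
  ms.foldl (fun T m => T ++ [(m, P.arthur x r T m)]) []

/-- Merlin's messages `ms` in all `k` rounds are rational, if Arthur's random strings are `r`. -/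
def RationalPlay (x : Str) (r : P.Coins x) (ms : List Str) : Prop :=
  ms.length = k ∧
    ∀ (i : ℕ) (hi : i < ms.length), P.IsRational x (P.transcript x r (ms.take i)) ms[i]

/-- The function `f` is computed in the protocol: whatever the random strings are, every rational
behavior of Merlin leads to the value `f x`. -/
def Computes (f : Str → Str) : Prop :=
  ∀ (x : Str) (r : P.Coins x) (ms : List Str),
    P.RationalPlay x r ms → P.value x (P.transcript x r ms) = f x

end Protocol

/-- The class `FRMA[k]`. -/
def FRMA (k : ℕ) : Set (Str → Str) :=
  {f | ∃ Q : Protocol k, Q.Computes f}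

/-- The class `DRMA[k]`. -/
def DRMA (k : ℕ) : Set (Set Str) :=
  {S | charFn S ∈ FRMA k}

end RationalProofs

namespace RationalProofs

/-! ### Polynomials as bounds -/

/-! Let `f` be computed by the `k`-round protocol `Q`, let a machine with oracle `f` decide `B`, and
let `α` be the fraction of those `y` with `(x, y) ∈ B`. In the new protocol Merlin claims a bit `b`,
Arthur answers with a random `y`, and Merlin then lists, for all queries of the machine on `(x, y)`
in their order, the claimed answer together with his first message in `Q` for that query. As this
first message travels with the answers, `Q` needs only `k` rounds beyond the first. Secret random
bits, read in blocks of length `H`, select the first query whose block is not all ones, and `Q` is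
played for it; Merlin earns `1/2 + R/4` if the value of `Q` is the claimed answer, and `0`
otherwise. If no query is selected and all remaining secret bits are ones too, the claim is scored:
`b = 1` earns `1` if the machine accepts and `δ` if not, `b = 0` earns `0` and `1` respectively.

Lies about queries do not pay. Expected rewards of strategies in `Q` are dyadic with polynomially
many digits, so a suboptimal strategy loses some `g = 2⁻ʰ`, while an optimal one leads to the value
`f z` and earns nothing under a wrong claim (`Computes.exists_checkedReward`). A wrong answer thus
costs at least `g` with probability `1 - 2⁻ᴴ ≥ 1/2`, and everything after that query has weight only
`2⁻ᴴ ≤ g/2` (`avg_le_queryReward`). Hence the best reward after the claim `b` is `C + 2⁻ⁿ` times the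
average score of `b`, with `C` independent of `b` (`exists_stratReward_composite`). The average
scores are `α + δ(1 - α)` and `1 - α`: the term with `δ` decides for `b = 1` at `α = 1/2`, and it is
harmless for `α < 1/2`, where `1 - 2α ≥ 2^(-q) > δ`.

For `k = 0` there is no second message, but then `f` is polynomial-time and the oracle can be
dispensed with (`exists_oracle`).

Arthur has to run the machine on answers that may be wrong, so running time and storage must be
bounded without trust in them. Every loop is iterated as often as a clock says, and all growth is
additive in a polynomial of the clock (`tame_sim`). By `follows_of_runs` the simulation agrees with
the true run until a query is selected or wrongly answered. -/

theorem eval_mono (p : Polynomial ℕ) {m n : ℕ} (h : m ≤ n) : p.eval m ≤ p.eval n := by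
  rw [Polynomial.eval_eq_sum, Polynomial.eval_eq_sum]
  exact Finset.sum_le_sum fun i _ => Nat.mul_le_mul_left _ (Nat.pow_le_pow_left h i)

/-! ### Running programs without an oracle -/

/-- Program `c` takes `s` to `s'` within `B` units of time, without an oracle. -/
def RunsIn (c : Prog) (s s' : Store) (B : ℕ) : Prop :=
  ∃ t ≤ B, Runs (fun _ => []) c s s' t

namespace RunsIn

variable {c d e : Prog} {s s₁ s₂ : Store} {B B₁ B₂ : ℕ} {r : ℕ}

theorem mono (h : RunsIn c s s₁ B₁) (hB : B₁ ≤ B₂) : RunsIn c s s₁ B₂ :=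
  let ⟨t, ht, hr⟩ := h
  ⟨t, ht.trans hB, hr⟩

theorem congr (h : RunsIn c s s₁ B₁) (hs : s₁ = s₂) (hB : B₁ ≤ B₂) : RunsIn c s s₂ B₂ :=
  hs ▸ h.mono hB

theorem skip : RunsIn .skip s s 1 := ⟨1, le_rfl, .skip s⟩

theorem push (r : ℕ) (b : Bool) (s : Store) :
    RunsIn (.push r b) s (Function.update s r (b :: s r)) 1 := ⟨1, le_rfl, .push r b s⟩

theorem pop (r : ℕ) (s : Store) :
    RunsIn (.pop r) s (Function.update s r (s r).tail) 1 := ⟨1, le_rfl, .pop r s⟩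

theorem seq (h₁ : RunsIn c s s₁ B₁) (h₂ : RunsIn d s₁ s₂ B₂) :
    RunsIn (.seq c d) s s₂ (B₁ + B₂) :=
  let ⟨t₁, ht₁, hr₁⟩ := h₁
  let ⟨t₂, ht₂, hr₂⟩ := h₂
  ⟨t₁ + t₂, by omega, .seq hr₁ hr₂⟩

theorem branchOne (hs : (s r).head? = some true) (h : RunsIn c s s₁ B) :
    RunsIn (.branch r c d e) s s₁ (B + 1) :=
  let ⟨t, ht, hr⟩ := h
  ⟨t + 1, by omega, .branchOne hs hr⟩

theorem branchZero (hs : (s r).head? = some false) (h : RunsIn d s s₁ B) :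
    RunsIn (.branch r c d e) s s₁ (B + 1) :=
  let ⟨t, ht, hr⟩ := h
  ⟨t + 1, by omega, .branchZero hs hr⟩

theorem branchEmpty (hs : s r = []) (h : RunsIn e s s₁ B) :
    RunsIn (.branch r c d e) s s₁ (B + 1) :=
  let ⟨t, ht, hr⟩ := h
  ⟨t + 1, by omega, .branchEmpty hs hr⟩

theorem loopDone (hs : s r = []) : RunsIn (.loop r c) s s 1 := ⟨1, le_rfl, .loopDone hs⟩

theorem loopStep (hs : s r ≠ []) (h₁ : RunsIn c s s₁ B₁) (h₂ : RunsIn (.loop r c) s₁ s₂ B₂) :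
    RunsIn (.loop r c) s s₂ (B₁ + B₂ + 1) :=
  let ⟨t₁, ht₁, hr₁⟩ := h₁
  let ⟨t₂, ht₂, hr₂⟩ := h₂
  ⟨t₁ + t₂ + 1, by omega, .loopStep hs hr₁ hr₂⟩

end RunsIn

/-! ### Stores given by lists -/

/-- The store with the given contents of the first stacks. -/
def ofList (l : List Str) : Store := fun r => l.getD r []

theorem update_ofList (l : List Str) (r : ℕ) (h : r < l.length) (v : Str) :
    Function.update (ofList l) r v = ofList (l.set r v) := by
  funext i
  by_cases hi : i = r
  · subst hi; simp [ofList, h]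
  · rw [Function.update_of_ne hi]
    simp [ofList, Ne.symm hi]

theorem initStore_eq (x : Str) : initStore x = ofList [x] := by
  funext r
  cases r <;> simp [initStore, ofList]

theorem ofList_append_nil (l : List Str) : ofList (l ++ [[]]) = ofList l := by
  funext r
  simp only [ofList, List.getD_eq_getElem?_getD, List.getElem?_append]
  split_ifs with h
  · rfl
  · rw [List.getElem?_eq_none (l := l) (by omega)]
    rcases Nat.eq_zero_or_pos (r - l.length) with h' | h'
    · simp [h']
    · rw [List.getElem?_eq_none (by simp; omega)]

theorem ofList_two (a : Str) : ofList [a] = ofList [a, []] := (ofList_append_nil [a]).symm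

theorem ofList_three (a b : Str) : ofList [a, b] = ofList [a, b, []] :=
  (ofList_append_nil [a, b]).symm

theorem ofList_four (a b c : Str) : ofList [a, b, c] = ofList [a, b, c, []] :=
  (ofList_append_nil [a, b, c]).symm

/-- Move stack `a` to stack `b`, bit by bit. -/
def mv (a b : ℕ) : Prog :=
  .loop a (.branch a (.seq (.pop a) (.push b true)) (.seq (.pop a) (.push b false)) .skip)

/-- Moving a stack reverses it. Copies that keep the order are therefore made of two moves. -/
theorem runsIn_mv {a b : ℕ} (hab : a ≠ b) (s : Store) :
    RunsIn (mv a b) s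
      (Function.update (Function.update s b ((s a).reverse ++ s b)) a []) (4 * (s a).length + 1) := by
  generalize hu : s a = u
  induction u generalizing s with
  | nil =>
    have : Function.update (Function.update s b (([] : Str).reverse ++ s b)) a [] = s := by
      funext r
      by_cases h1 : r = a
      · subst h1; simp [hu]
      · by_cases h2 : r = b
        · subst h2; simp [h1]
        · simp [h1]
    rw [this]
    exact RunsIn.loopDone hu
  | cons x u ih =>
    have step : RunsIn (.branch a (.seq (.pop a) (.push b true)) (.seq (.pop a) (.push b false)) .skip)
        s (Function.update (Function.update s a u) b (x :: s b)) 3 := by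
      have hp := RunsIn.pop a s
      have hq := RunsIn.push b x (Function.update s a (s a).tail)
      rw [Function.update_of_ne (Ne.symm hab), hu] at hq
      rw [hu] at hp
      cases x
      · exact RunsIn.branchZero (by simp [hu]) (hp.seq hq)
      · exact RunsIn.branchOne (by simp [hu]) (hp.seq hq)
    have h2 := ih (Function.update (Function.update s a u) b (x :: s b))
      (by rw [Function.update_of_ne hab]; simp)
    have h3 := RunsIn.loopStep (by simp [hu]) step h2
    have : Function.update (Function.update (Function.update (Function.update s a u) b (x :: s b)) b
        (u.reverse ++ Function.update (Function.update s a u) b (x :: s b) b)) a [] =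
        Function.update (Function.update s b ((x :: u).reverse ++ s b)) a [] := by
      funext r
      by_cases h1 : r = a
      · subst h1; simp
      · by_cases h2 : r = b
        · subst h2; simp [h1]
        · simp [h1, h2]
    rw [this] at h3
    exact h3.mono (by simp; omega)

/-- Move stack `a` to the stacks `b` and `d`, bit by bit. -/
def mvTwo (a b d : ℕ) : Prog :=
  .loop a (.branch a (.seq (.pop a) (.seq (.push b true) (.push d true)))
    (.seq (.pop a) (.seq (.push b false) (.push d false))) .skip)

theorem runsIn_mvTwo {a b d : ℕ} (hab : a ≠ b) (had : a ≠ d) (hbd : b ≠ d) (s : Store) :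
    RunsIn (mvTwo a b d) s
      (Function.update (Function.update (Function.update s b ((s a).reverse ++ s b)) d
        ((s a).reverse ++ s d)) a []) (5 * (s a).length + 1) := by
  generalize hu : s a = u
  induction u generalizing s with
  | nil =>
    have : Function.update (Function.update (Function.update s b (([] : Str).reverse ++ s b)) d
        (([] : Str).reverse ++ s d)) a [] = s := by
      funext r
      by_cases h1 : r = a
      · subst h1; simp [hu]
      · by_cases h2 : r = d
        · subst h2; simp [h1]
        · by_cases h3 : r = b
          · subst h3; simp [h1]
          · simp [h1]
    rw [this]
    exact RunsIn.loopDone hu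
  | cons x u ih =>
    have step : RunsIn (.branch a (.seq (.pop a) (.seq (.push b true) (.push d true)))
        (.seq (.pop a) (.seq (.push b false) (.push d false))) .skip)
        s (Function.update (Function.update (Function.update s a u) b (x :: s b)) d (x :: s d)) 4 := by
      have hp := RunsIn.pop a s
      have hq := RunsIn.push b x (Function.update s a (s a).tail)
      have hr := RunsIn.push d x (Function.update (Function.update s a u) b (x :: s b))
      rw [Function.update_of_ne (Ne.symm hab), hu] at hq
      rw [Function.update_of_ne (Ne.symm hbd), Function.update_of_ne (Ne.symm had)] at hr
      rw [hu] at hp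
      cases x
      · exact RunsIn.branchZero (by simp [hu]) (hp.seq (hq.seq hr))
      · exact RunsIn.branchOne (by simp [hu]) (hp.seq (hq.seq hr))
    have h2 := ih (Function.update (Function.update (Function.update s a u) b (x :: s b)) d (x :: s d))
      (by rw [Function.update_of_ne had, Function.update_of_ne hab]; simp)
    have h3 := RunsIn.loopStep (by simp [hu]) step h2
    refine h3.congr ?_ (by simp; omega)
    funext r
    by_cases k1 : r = a
    · subst k1; simp
    · by_cases k2 : r = d
      · subst k2; simp [k1]
      · by_cases k3 : r = b
        · subst k3; simp [k1, k2]
        · simp [k1, k2, k3]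

/-- Empty stack `a`. -/
def clear (a : ℕ) : Prog := .loop a (.pop a)

theorem runsIn_clear (a : ℕ) (s : Store) :
    RunsIn (clear a) s (Function.update s a []) (2 * (s a).length + 1) := by
  generalize hu : s a = u
  induction u generalizing s with
  | nil =>
    refine (RunsIn.loopDone hu).congr ?_ (by simp)
    rw [← hu, Function.update_eq_self]
  | cons x u ih =>
    have h1 := RunsIn.pop a s
    rw [hu] at h1
    have h2 := ih (Function.update s a u) (by simp)
    rw [Function.update_idem] at h2
    exact (RunsIn.loopStep (by simp [hu]) h1 h2).mono (by simp; omega)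

/-! ### The stacks used by a program -/

/-- A bound on the stacks that occur in a program. -/
def width : Prog → ℕ
  | .skip => 0
  | .push r _ => r + 1
  | .pop r => r + 1
  | .seq c d => max (width c) (width d)
  | .branch r c d e => max (r + 1) (max (width c) (max (width d) (width e)))
  | .loop r c => max (r + 1) (width c)
  | .query q a => max (q + 1) (a + 1)

theorem Runs.eq_of_width_le {f : Str → Str} {c : Prog} {s s' : Store} {t : ℕ}
    (h : Runs f c s s' t) {r : ℕ} (hr : width c ≤ r) : s' r = s r := by
  induction h with
  | skip => rfl
  | push q b s => exact Function.update_of_ne (by simp only [width] at hr; omega) _ _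
  | pop q s => exact Function.update_of_ne (by simp only [width] at hr; omega) _ _
  | query q a s => exact Function.update_of_ne (by simp only [width] at hr; omega) _ _
  | seq _ _ ih₁ ih₂ =>
    simp only [width] at hr
    rw [ih₂ (by omega), ih₁ (by omega)]
  | branchOne _ _ ih => simp only [width] at hr; exact ih (by omega)
  | branchZero _ _ ih => simp only [width] at hr; exact ih (by omega)
  | branchEmpty _ _ ih => simp only [width] at hr; exact ih (by omega)
  | loopDone => rfl
  | loopStep _ _ _ ih₁ ih₂ =>
    rw [ih₂ hr]
    simp only [width] at hr
    exact ih₁ (by omega)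

/-- One unit of time pushes at most one bit, and the empty oracle answer cannot lengthen a stack.
For a general oracle this fails, since a long answer arrives in a single query. -/
theorem Runs.length_le {c : Prog} {s s' : Store} {t : ℕ}
    (h : Runs (fun _ => []) c s s' t) (r : ℕ) : (s' r).length ≤ (s r).length + t := by
  induction h with
  | skip => omega
  | push q b s =>
    by_cases h : r = q
    · subst h; simp
    · simp [h]
  | pop q s =>
    by_cases h : r = q
    · subst h; simp; omega
    · simp [h]
  | query q a s =>
    by_cases h : r = a
    · subst h; simp
    · simp [h]
  | seq _ _ ih₁ ih₂ => omega
  | branchOne _ _ ih => omega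
  | branchZero _ _ ih => omega
  | branchEmpty _ _ ih => omega
  | loopDone => omega
  | loopStep _ _ _ ih₁ ih₂ => omega

/-- Two stores put together: `p` below `d`, and `s` from `d` on. -/
def joinAt (d : ℕ) (p s : Store) : Store := fun r => if r < d then p r else s (r - d)

theorem update_joinAt (d : ℕ) (p s : Store) (r : ℕ) (v : Str) :
    Function.update (joinAt d p s) (r + d) v = joinAt d p (Function.update s r v) := by
  funext i
  by_cases hi : i = r + d
  · subst hi; simp [joinAt]
  · rw [Function.update_of_ne hi]
    unfold joinAt
    split_ifs with h
    · rfl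
    · rw [Function.update_of_ne (by omega)]

theorem joinAt_add (d : ℕ) (p s : Store) (r : ℕ) : joinAt d p s (r + d) = s r := by
  simp [joinAt]

/-- The program `c` with all stacks renumbered, from `d` on. -/
def shift (d : ℕ) : Prog → Prog
  | .skip => .skip
  | .push r b => .push (r + d) b
  | .pop r => .pop (r + d)
  | .seq c e => .seq (shift d c) (shift d e)
  | .branch r c₁ c₂ c₃ => .branch (r + d) (shift d c₁) (shift d c₂) (shift d c₃)
  | .loop r c => .loop (r + d) (shift d c)
  | .query q a => .query (q + d) (a + d)

/-- Renumbering protects the stacks below `d`; a program can thus be called as a subroutine while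
other data are kept. -/
theorem Runs.shift {f : Str → Str} {c : Prog} {s s' : Store} {t : ℕ}
    (h : Runs f c s s' t) (d : ℕ) (p : Store) :
    Runs f (shift d c) (joinAt d p s) (joinAt d p s') t := by
  induction h with
  | skip => exact .skip _
  | push r b s =>
    rw [← update_joinAt]
    conv => arg 4; rw [← joinAt_add d p s r]
    exact .push _ _ _
  | pop r s =>
    rw [← update_joinAt]
    conv => arg 4; rw [← joinAt_add d p s r]
    exact .pop _ _
  | query q a s =>
    rw [← update_joinAt, ← joinAt_add d p s q]
    exact .query _ _ _
  | seq _ _ ih₁ ih₂ => exact .seq ih₁ ih₂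
  | branchOne h _ ih => exact .branchOne (by rwa [joinAt_add]) ih
  | branchZero h _ ih => exact .branchZero (by rwa [joinAt_add]) ih
  | branchEmpty h _ ih => exact .branchEmpty (by rwa [joinAt_add]) ih
  | loopDone h => exact .loopDone (by rwa [joinAt_add])
  | loopStep h _ _ ih₁ ih₂ => exact .loopStep (by rwa [joinAt_add]) ih₁ ih₂

theorem ofList_append (l m : List Str) :
    ofList (l ++ m) = joinAt l.length (ofList l) (ofList m) := by
  funext r
  simp only [ofList, joinAt, List.getD_eq_getElem?_getD, List.getElem?_append]
  split_ifs <;> rfl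

/-- Empty the stacks `1, …, n`. -/
def clearUpTo : ℕ → Prog
  | 0 => .skip
  | n + 1 => .seq (clearUpTo n) (clear (n + 1))

theorem runsIn_clearUpTo (n : ℕ) (s : Store) (M : ℕ) (hM : ∀ r, (s r).length ≤ M) :
    RunsIn (clearUpTo n) s (fun r => if 1 ≤ r ∧ r ≤ n then [] else s r) (n * (2 * M + 1) + 1) := by
  induction n with
  | zero =>
    have : (fun r => if 1 ≤ r ∧ r ≤ 0 then [] else s r) = s := by
      funext r; rw [if_neg (by omega)]
    rw [this]
    exact RunsIn.skip.mono (by omega)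
  | succ n ih =>
    have h := runsIn_clear (n + 1) (fun r => if 1 ≤ r ∧ r ≤ n then [] else s r)
    have e : Function.update (fun r => if 1 ≤ r ∧ r ≤ n then [] else s r) (n + 1) [] =
        fun r => if 1 ≤ r ∧ r ≤ n + 1 then [] else s r := by
      funext r
      by_cases hr : r = n + 1
      · subst hr; simp
      · rw [Function.update_of_ne hr]
        by_cases h1 : 1 ≤ r ∧ r ≤ n
        · rw [if_pos h1, if_pos (by omega)]
        · rw [if_neg h1, if_neg (by omega)]
    rw [e] at h
    refine (ih.seq h).mono ?_
    have : ((if 1 ≤ n + 1 ∧ n + 1 ≤ n then [] else s (n + 1) : Str)).length ≤ M := by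
      rw [if_neg (by omega)]; exact hM _
    rw [add_one_mul n]
    omega

/-! ### Computations that leave no garbage -/

/-- A program that computes `g` in time `T` and leaves no garbage. -/
def ComputesIn (c : Prog) (T : Polynomial ℕ) (g : Str → Str) : Prop :=
  ∀ x, RunsIn c (ofList [x]) (ofList [g x]) (T.eval x.length)

theorem ComputesIn.length_le {c : Prog} {T : Polynomial ℕ} {g : Str → Str}
    (h : ComputesIn c T g) (x : Str) : (g x).length ≤ x.length + T.eval x.length := by
  obtain ⟨t, ht, hr⟩ := h x
  have := hr.length_le 0
  simp [ofList] at this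
  omega

theorem ComputesIn.call {c : Prog} {T : Polynomial ℕ} {g : Str → Str} (h : ComputesIn c T g)
    (l : List Str) (x : Str) :
    RunsIn (shift l.length c) (ofList (l ++ [x])) (ofList (l ++ [g x])) (T.eval x.length) := by
  obtain ⟨t, ht, hr⟩ := h x
  refine ⟨t, ht, ?_⟩
  rw [ofList_append, ofList_append]
  exact hr.shift _ _

theorem ComputesIn.polyTime {c : Prog} {T : Polynomial ℕ} {g : Str → Str}
    (h : ComputesIn c T g) : PolyTime g := by
  refine ⟨c, T, fun x => ?_⟩
  obtain ⟨t, ht, hr⟩ := h x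
  exact ⟨_, t, by rwa [initStore_eq], rfl, ht⟩

/-- The garbage can be erased in polynomial time: it lies on the stacks below the width of the
program, and the running time bounds the height of each of them. Clean programs can then be
composed. -/
theorem PolyTime.exists_computesIn {g : Str → Str} (h : PolyTime g) :
    ∃ c T, ComputesIn c T g := by
  obtain ⟨c, T, h⟩ := h
  refine ⟨.seq c (clearUpTo (width c)),
    T + (Polynomial.C (width c) * (2 * (Polynomial.X + T) + 1) + 1), fun x => ?_⟩
  obtain ⟨s, t, hr, hs, ht⟩ := h x
  rw [initStore_eq] at hr
  have hM : ∀ r, (s r).length ≤ x.length + T.eval x.length := by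
    intro r
    have h1 := hr.length_le r
    have h2 : (ofList [x] r).length ≤ x.length := by cases r <;> simp [ofList]
    omega
  have h2 := runsIn_clearUpTo (width c) s _ hM
  have e : (fun r => if 1 ≤ r ∧ r ≤ width c then [] else s r) = ofList [g x] := by
    funext r
    rcases Nat.eq_zero_or_pos r with rfl | hpos
    · simp [ofList, hs]
    · by_cases hw : r ≤ width c
      · rw [if_pos ⟨hpos, hw⟩]
        obtain ⟨r, rfl⟩ := Nat.exists_eq_succ_of_ne_zero hpos.ne'
        simp [ofList]
      · rw [if_neg (by omega), hr.eq_of_width_le (by omega)]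
        obtain ⟨r, rfl⟩ := Nat.exists_eq_succ_of_ne_zero hpos.ne'
        simp [ofList]
  rw [e] at h2
  have h1 : RunsIn c (ofList [x]) s (T.eval x.length) := ⟨t, ht, hr⟩
  refine (h1.seq h2).mono ?_
  simp [Polynomial.eval_add, Polynomial.eval_mul]

/-- Polynomial-time functions have polynomially bounded values. -/
theorem PolyTime.exists_length_le {g : Str → Str} (h : PolyTime g) :
    ∃ p : Polynomial ℕ, ∀ x, (g x).length ≤ p.eval x.length := by
  obtain ⟨c, T, h⟩ := h.exists_computesIn
  exact ⟨Polynomial.X + T, fun x => by simpa using h.length_le x⟩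

/-! ### Small programs on lists of stacks -/

theorem runsIn_mv_ofList {a b : ℕ} (hab : a ≠ b) (l : List Str) (ha : a < l.length)
    (hb : b < l.length) :
    RunsIn (mv a b) (ofList l)
      (ofList ((l.set b ((l.getD a []).reverse ++ l.getD b [])).set a []))
      (4 * (l.getD a []).length + 1) := by
  have h := runsIn_mv hab (ofList l)
  rwa [update_ofList _ _ hb, update_ofList _ _ (by simpa using ha)] at h

theorem runsIn_mvTwo_ofList {a b d : ℕ} (hab : a ≠ b) (had : a ≠ d) (hbd : b ≠ d)
    (l : List Str) (ha : a < l.length) (hb : b < l.length) (hd : d < l.length) :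
    RunsIn (mvTwo a b d) (ofList l)
      (ofList (((l.set b ((l.getD a []).reverse ++ l.getD b [])).set d
        ((l.getD a []).reverse ++ l.getD d [])).set a []))
      (5 * (l.getD a []).length + 1) := by
  have h := runsIn_mvTwo hab had hbd (ofList l)
  rwa [update_ofList _ _ hb, update_ofList _ _ (by simpa using hd),
    update_ofList _ _ (by simpa using ha)] at h

theorem runsIn_clear_ofList {a : ℕ} (l : List Str) (ha : a < l.length) :
    RunsIn (clear a) (ofList l) (ofList (l.set a [])) (2 * (l.getD a []).length + 1) := by
  have h := runsIn_clear a (ofList l)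
  rwa [update_ofList _ _ ha] at h

theorem runsIn_push_ofList {a : ℕ} (b : Bool) (l : List Str) (ha : a < l.length) :
    RunsIn (.push a b) (ofList l) (ofList (l.set a (b :: l.getD a []))) 1 := by
  have h := RunsIn.push a b (ofList l)
  rwa [update_ofList _ _ ha] at h

theorem runsIn_pop_ofList {a : ℕ} (l : List Str) (ha : a < l.length) :
    RunsIn (.pop a) (ofList l) (ofList (l.set a (l.getD a []).tail)) 1 := by
  have h := RunsIn.pop a (ofList l)
  rwa [update_ofList _ _ ha] at h

/-- Copy stack `0` to stack `1`. -/
def copy : Prog := .seq (mvTwo 0 1 2) (.seq (mv 1 0) (mv 2 1))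

theorem runsIn_copy (x : Str) : RunsIn copy (ofList [x]) (ofList [x, x]) (13 * x.length + 3) := by
  rw [ofList_two, ofList_three, ofList_three]
  have h1 := runsIn_mvTwo_ofList (a := 0) (b := 1) (d := 2) (by omega) (by omega) (by omega)
    [x, [], []] (by simp) (by simp) (by simp)
  have h2 := runsIn_mv_ofList (a := 1) (b := 0) (by omega) [[], x.reverse, x.reverse]
    (by simp) (by simp)
  have h3 := runsIn_mv_ofList (a := 2) (b := 1) (by omega) [x, [], x.reverse]
    (by simp) (by simp)
  simp at h1 h2 h3
  exact (h1.seq (h2.seq h3)).mono (by omega)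

/-- Exchange the stacks `0` and `1`. -/
def swap : Prog := .seq (mv 1 2) (.seq (mv 0 3) (.seq (mv 2 0) (mv 3 1)))

theorem runsIn_swap (x y : Str) :
    RunsIn swap (ofList [x, y]) (ofList [y, x]) (8 * x.length + 8 * y.length + 4) := by
  rw [ofList_three, ofList_four, ofList_three y, ofList_four]
  have h1 := runsIn_mv_ofList (a := 1) (b := 2) (by omega) [x, y, [], []] (by simp) (by simp)
  have h2 := runsIn_mv_ofList (a := 0) (b := 3) (by omega) [x, [], y.reverse, []]
    (by simp) (by simp)
  have h3 := runsIn_mv_ofList (a := 2) (b := 0) (by omega) [[], [], y.reverse, x.reverse]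
    (by simp) (by simp)
  have h4 := runsIn_mv_ofList (a := 3) (b := 1) (by omega) [y, [], [], x.reverse]
    (by simp) (by simp)
  simp at h1 h2 h3 h4
  exact (h1.seq (h2.seq (h3.seq h4))).mono (by omega)

/-- Put stack `1` on top of stack `0`. -/
def stackUp : Prog := .seq (mv 1 2) (mv 2 0)

theorem runsIn_stackUp (x y : Str) :
    RunsIn stackUp (ofList [x, y]) (ofList [y ++ x]) (8 * y.length + 2) := by
  rw [ofList_three, ofList_two (y ++ x), ofList_three]
  have h1 := runsIn_mv_ofList (a := 1) (b := 2) (by omega) [x, y, []] (by simp) (by simp)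
  have h2 := runsIn_mv_ofList (a := 2) (b := 0) (by omega) [x, [], y.reverse] (by simp) (by simp)
  simp at h1 h2
  exact (h1.seq h2).mono (by omega)

/-! ### Closure properties of the polynomial-time functions -/

namespace PolyTime

variable {g g₁ g₂ e : Str → Str}

theorem id : PolyTime (fun x => x) :=
  ComputesIn.polyTime (c := .skip) (T := 1) fun x => by simpa using RunsIn.skip

theorem comp (h₂ : PolyTime g₂) (h₁ : PolyTime g₁) : PolyTime (fun x => g₂ (g₁ x)) := by
  obtain ⟨c₁, T₁, h₁⟩ := h₁.exists_computesIn
  obtain ⟨c₂, T₂, h₂⟩ := h₂.exists_computesIn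
  refine ComputesIn.polyTime (c := .seq c₁ c₂) (T := T₁ + T₂.comp (Polynomial.X + T₁)) fun x => ?_
  refine ((h₁ x).seq (h₂ (g₁ x))).mono ?_
  have := eval_mono T₂ (h₁.length_le x)
  simp only [Polynomial.eval_add, Polynomial.eval_comp, Polynomial.eval_X]
  omega

theorem append (h₁ : PolyTime g₁) (h₂ : PolyTime g₂) : PolyTime (fun x => g₁ x ++ g₂ x) := by
  obtain ⟨c₁, T₁, h₁⟩ := h₁.exists_computesIn
  obtain ⟨c₂, T₂, h₂⟩ := h₂.exists_computesIn
  refine ComputesIn.polyTime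
    (c := .seq copy (.seq (shift 1 c₂) (.seq swap (.seq (shift 1 c₁) stackUp))))
    -- The factor 40 is generous: each step takes at most a small multiple of the lengths of `x`,
    -- `g₁ x`, `g₂ x`, and these are bounded by input length plus running time.
    (T := 40 * (Polynomial.X + T₁ + T₂ + 1)) fun x => ?_
  have k1 := h₁.length_le x
  have k2 := h₂.length_le x
  refine ((runsIn_copy x).seq ((h₂.call [x] x).seq ((runsIn_swap _ _).seq
    ((h₁.call [g₂ x] x).seq (runsIn_stackUp _ _))))).mono ?_
  simp
  omega

theorem ite_head (h : PolyTime g) (h₁ : PolyTime g₁) (h₂ : PolyTime g₂) :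
    PolyTime (fun x => if (g x).head? = some true then g₁ x else g₂ x) := by
  obtain ⟨c, T, h⟩ := h.exists_computesIn
  obtain ⟨c₁, T₁, h₁⟩ := h₁.exists_computesIn
  obtain ⟨c₂, T₂, h₂⟩ := h₂.exists_computesIn
  refine ComputesIn.polyTime
    (c := .seq copy (.seq (shift 1 c) (.branch 1 (.seq (clear 1) c₁) (.seq (clear 1) c₂)
      (.seq (clear 1) c₂))))
    (T := 40 * (Polynomial.X + T + T₁ + T₂ + 1)) fun x => ?_
  have k := h.length_le x
  have hc : RunsIn (clear 1) (ofList [x, g x]) (ofList [x]) (2 * (g x).length + 1) := by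
    have := runsIn_clear_ofList (a := 1) [x, g x] (by simp)
    rw [ofList_two x]
    simpa using this
  have key : RunsIn (.branch 1 (.seq (clear 1) c₁) (.seq (clear 1) c₂) (.seq (clear 1) c₂))
      (ofList [x, g x]) (ofList [if (g x).head? = some true then g₁ x else g₂ x])
      (2 * (g x).length + 1 + T₁.eval x.length + T₂.eval x.length + 1) := by
    rcases hg : g x with _ | ⟨_ | _, u⟩
    · rw [hg] at hc
      exact (RunsIn.branchEmpty rfl (hc.seq (h₂ x))).congr (by simp) (by simp)
    · rw [hg] at hc
      exact (RunsIn.branchZero rfl (hc.seq (h₂ x))).congr (by simp) (by simp)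
    · rw [hg] at hc
      exact (RunsIn.branchOne rfl (hc.seq (h₁ x))).congr (by simp) (by simp)
  refine ((runsIn_copy x).seq ((h.call [x] x).seq key)).mono ?_
  simp
  omega

theorem cons (b : Bool) (h : PolyTime g) : PolyTime (fun x => b :: g x) := by
  refine comp (g₂ := fun x => b :: x) ?_ h
  exact ComputesIn.polyTime (c := .push 0 b) (T := 1) fun x => by
    simpa using runsIn_push_ofList (a := 0) b [x] (by simp)

theorem tail (h : PolyTime g) : PolyTime (fun x => (g x).tail) := by
  refine comp (g₂ := fun x => x.tail) ?_ h
  exact ComputesIn.polyTime (c := .pop 0) (T := 1) fun x => by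
    simpa using runsIn_pop_ofList (a := 0) [x] (by simp)

theorem const (w : Str) : PolyTime (fun _ => w) := by
  induction w with
  | nil =>
    exact ComputesIn.polyTime (c := clear 0) (T := 2 * Polynomial.X + 1) fun x => by
      simpa [ofList_two] using runsIn_clear_ofList (a := 0) [x] (by simp)
  | cons b w ih => exact ih.cons b

theorem reverse (h : PolyTime g) : PolyTime (fun x => (g x).reverse) := by
  refine comp (g₂ := fun x => x.reverse) ?_ h
  refine ComputesIn.polyTime (c := .seq (mv 0 1) (.seq (mv 1 2) (mv 2 0)))
    (T := 12 * Polynomial.X + 3) fun x => ?_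
  rw [ofList_two, ofList_three, ofList_two x.reverse, ofList_three]
  have h1 := runsIn_mv_ofList (a := 0) (b := 1) (by omega) [x, [], []] (by simp) (by simp)
  have h2 := runsIn_mv_ofList (a := 1) (b := 2) (by omega) [[], x.reverse, []] (by simp) (by simp)
  have h3 := runsIn_mv_ofList (a := 2) (b := 0) (by omega) [[], [], x] (by simp) (by simp)
  simp at h1 h2 h3
  exact (h1.seq (h2.seq h3)).mono (by simp; omega)

/-- Polynomially many applications of a polynomial-time function need not stay polynomial, since
lengths may grow exponentially. The bound `S` on all intermediate results excludes this. The loop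
counter is the string `e w`, kept below the current value. -/
theorem iterate (h : PolyTime g) (he : PolyTime e) (S : Polynomial ℕ)
    (hS : ∀ w, ∀ i ≤ (e w).length, (g^[i] w).length ≤ S.eval w.length) :
    PolyTime (fun w => g^[(e w).length] w) := by
  obtain ⟨c, T, h⟩ := h.exists_computesIn
  obtain ⟨c', T', he⟩ := he.exists_computesIn
  have loop : ∀ (w u : Str) (M : ℕ), (∀ i ≤ u.length, (g^[i] w).length ≤ M) →
      RunsIn (.loop 0 (.seq (.pop 0) (shift 1 c))) (ofList [u, w])
        (ofList [[], g^[u.length] w]) (u.length * (T.eval M + 2) + 1) := by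
    intro w u M hM
    induction u generalizing w with
    | nil => exact (RunsIn.loopDone rfl).mono (by simp)
    | cons b u ih =>
      have h1 : RunsIn (.pop 0) (ofList [b :: u, w]) (ofList [u, w]) 1 := by
        simpa using runsIn_pop_ofList (a := 0) [b :: u, w] (by simp)
      have h2 := h.call [u] w
      have h3 := ih (g w) fun i hi => by
        have := hM (i + 1) (by simp; omega)
        rwa [Function.iterate_succ_apply] at this
      have h4 := eval_mono T (hM 0 (by simp))
      refine (RunsIn.loopStep (by simp [ofList]) (h1.seq h2) h3).congr rfl ?_
      simp only [List.length_cons, add_one_mul, Function.iterate_zero, _root_.id] at h4 ⊢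
      omega
  refine ComputesIn.polyTime
    (c := .seq copy (.seq (shift 1 c') (.seq swap
      (.seq (.loop 0 (.seq (.pop 0) (shift 1 c))) stackUp))))
    (T := 40 * (Polynomial.X + T' + (Polynomial.X + T') * (T.comp S + 2) + S + 1)) fun w => ?_
  have k := he.length_le w
  have k2 := hS w _ le_rfl
  refine ((runsIn_copy w).seq ((he.call [w] w).seq ((runsIn_swap _ _).seq
    ((loop w (e w) _ (hS w)).seq (runsIn_stackUp _ _))))).congr (by simp) ?_
  have k3 := Nat.mul_le_mul_right (T.eval (S.eval w.length) + 2) k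
  simp [Polynomial.eval_comp]
  omega

end PolyTime

/-! ### Polynomial-time decisions -/

/-- A property that can be decided in polynomial time. -/
def PolyDec (p : Str → Prop) : Prop := PolyTime (charFn {x | p x})

theorem PolyTime.ite {p : Str → Prop} [DecidablePred p] (hp : PolyDec p) {g₁ g₂ : Str → Str}
    (h₁ : PolyTime g₁) (h₂ : PolyTime g₂) : PolyTime (fun x => if p x then g₁ x else g₂ x) := by
  convert hp.ite_head h₁ h₂ using 3 with x
  by_cases h : p x <;> simp [charFn, h]

/-- Compare the stacks `0` and `1`; differences are marked on stack `2`. -/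
def compareLoop : Prog :=
  .loop 0 (.seq (.branch 0
    (.branch 1 (.pop 1) (.push 2 true) (.push 2 true))
    (.branch 1 (.push 2 true) (.pop 1) (.push 2 true)) .skip) (.pop 0))

/-- The equivalence is the loop invariant: a mark on stack `2` records a difference for good, and a
remainder on stack `1` shows that the second string is longer. -/
theorem runsIn_compareLoop (u v m : Str) : ∃ v' m' : Str, (m' = [] ∧ v' = [] ↔ m = [] ∧ u = v) ∧
    RunsIn compareLoop (ofList [u, v, m]) (ofList [[], v', m']) (5 * u.length + 1) := by
  induction u generalizing v m with
  | nil =>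
    exact ⟨v, m, by rw [@eq_comm _ [] v], (RunsIn.loopDone rfl).mono (by simp)⟩
  | cons b u ih =>
    have pop0 : ∀ v m : Str, RunsIn (.pop 0) (ofList [b :: u, v, m]) (ofList [u, v, m]) 1 := by
      intro v m
      simpa using runsIn_pop_ofList (a := 0) [b :: u, v, m] (by simp)
    have mark : RunsIn (.push 2 true) (ofList [b :: u, v, m]) (ofList [b :: u, v, true :: m]) 1 := by
      simpa using runsIn_push_ofList (a := 2) true [b :: u, v, m] (by simp)
    have pop1 : RunsIn (.pop 1) (ofList [b :: u, v, m]) (ofList [b :: u, v.tail, m]) 1 := by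
      simpa using runsIn_pop_ofList (a := 1) [b :: u, v, m] (by simp)
    have fin : ∀ (v₁ m₁ : Str), (m₁ = [] ∧ u = v₁ ↔ m = [] ∧ b :: u = v) →
        RunsIn (.branch 0
          (.branch 1 (.pop 1) (.push 2 true) (.push 2 true))
          (.branch 1 (.push 2 true) (.pop 1) (.push 2 true)) .skip)
          (ofList [b :: u, v, m]) (ofList [b :: u, v₁, m₁]) 3 →
        ∃ v' m' : Str, (m' = [] ∧ v' = [] ↔ m = [] ∧ b :: u = v) ∧
          RunsIn compareLoop (ofList [b :: u, v, m]) (ofList [[], v', m'])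
            (5 * (b :: u).length + 1) := by
      intro v₁ m₁ hiff hrun
      obtain ⟨v', m', h1, h2⟩ := ih v₁ m₁
      refine ⟨v', m', h1.trans hiff, ?_⟩
      exact (RunsIn.loopStep (by simp [ofList]) (hrun.seq (pop0 v₁ m₁)) h2).mono (by simp; omega)
    cases b
    · rcases v with _ | ⟨_ | _, v⟩
      · exact fin [] (true :: m) (by simp)
          (RunsIn.branchZero rfl (RunsIn.branchEmpty rfl mark))
      · exact fin v m (by simp)
          (RunsIn.branchZero rfl (RunsIn.branchZero rfl pop1))
      · exact fin (true :: v) (true :: m) (by simp)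
          (RunsIn.branchZero rfl (RunsIn.branchOne rfl mark))
    · rcases v with _ | ⟨_ | _, v⟩
      · exact fin [] (true :: m) (by simp)
          (RunsIn.branchOne rfl (RunsIn.branchEmpty rfl mark))
      · exact fin (false :: v) (true :: m) (by simp)
          (RunsIn.branchOne rfl (RunsIn.branchZero rfl mark))
      · exact fin v m (by simp)
          (RunsIn.branchOne rfl (RunsIn.branchOne rfl pop1))

theorem PolyDec.eq {g₁ g₂ : Str → Str} (h₁ : PolyTime g₁) (h₂ : PolyTime g₂) :
    PolyDec (fun x => g₁ x = g₂ x) := by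
  obtain ⟨c₁, T₁, h₁⟩ := h₁.exists_computesIn
  obtain ⟨c₂, T₂, h₂⟩ := h₂.exists_computesIn
  refine ⟨.seq copy (.seq (shift 1 c₁) (.seq swap (.seq (shift 1 c₂) (.seq compareLoop
    (.branch 2 (.push 0 false) (.push 0 false)
      (.branch 1 (.push 0 false) (.push 0 false) (.push 0 true))))))),
    40 * (Polynomial.X + T₁ + T₂ + 1), fun x => ?_⟩
  obtain ⟨v, m, hvm, hrun⟩ := runsIn_compareLoop (g₁ x) (g₂ x) []
  have k1 := h₁.length_le x
  have k2 := h₂.length_le x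
  have push : ∀ b, RunsIn (.push 0 b) (ofList [[], v, m]) (ofList [[b], v, m]) 1 := by
    intro b
    simpa using runsIn_push_ofList (a := 0) b [[], v, m] (by simp)
  have key : RunsIn (.branch 2 (.push 0 false) (.push 0 false)
      (.branch 1 (.push 0 false) (.push 0 false) (.push 0 true))) (ofList [[], v, m])
      (ofList [charFn {x | g₁ x = g₂ x} x, v, m]) 3 := by
    rcases m with _ | ⟨_ | _, m⟩
    · rcases v with _ | ⟨_ | _, v⟩
      · have : charFn {x | g₁ x = g₂ x} x = [true] := by simpa [charFn] using hvm
        rw [this]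
        exact RunsIn.branchEmpty rfl (RunsIn.branchEmpty rfl (push _))
      · have : charFn {x | g₁ x = g₂ x} x = [false] := by simpa [charFn] using hvm
        rw [this]
        exact RunsIn.branchEmpty rfl (RunsIn.branchZero rfl (push _))
      · have : charFn {x | g₁ x = g₂ x} x = [false] := by simpa [charFn] using hvm
        rw [this]
        exact RunsIn.branchEmpty rfl (RunsIn.branchOne rfl (push _))
    · have : charFn {x | g₁ x = g₂ x} x = [false] := by simpa [charFn] using hvm
      rw [this]
      exact (RunsIn.branchZero rfl (push _)).mono (by omega)
    · have : charFn {x | g₁ x = g₂ x} x = [false] := by simpa [charFn] using hvm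
      rw [this]
      exact (RunsIn.branchOne rfl (push _)).mono (by omega)
  rw [← ofList_three] at hrun
  obtain ⟨t, ht, hr⟩ := (runsIn_copy x).seq ((h₁.call [x] x).seq ((runsIn_swap _ _).seq
    ((h₂.call [g₁ x] x).seq (hrun.seq key))))
  refine ⟨_, t, by rwa [initStore_eq], rfl, ht.trans ?_⟩
  simp
  omega

/-! ### Coding and decoding of tuples -/

@[simp] theorem encodeItem_nil : encodeItem [] = [false] := rfl

@[simp] theorem encodeItem_cons (b : Bool) (w : Str) :
    encodeItem (b :: w) = true :: b :: encodeItem w := rfl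

@[simp] theorem encodeTuple_nil : encodeTuple [] = [] := rfl

@[simp] theorem encodeTuple_cons (w : Str) (l : List Str) :
    encodeTuple (w :: l) = encodeItem w ++ encodeTuple l := rfl

@[simp] theorem encodeTuple_append (l m : List Str) :
    encodeTuple (l ++ m) = encodeTuple l ++ encodeTuple m := by
  simp [encodeTuple]

@[simp] theorem length_encodeItem (w : Str) : (encodeItem w).length = 2 * w.length + 1 := by
  induction w with
  | nil => rfl
  | cons b w ih => simp [ih]; omega

theorem encodeItem_ne_nil (w : Str) : encodeItem w ≠ [] := by
  cases w <;> simp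

/-- The first component of a tuple. -/
def hd : Str → Str
  | true :: b :: w => b :: hd w
  | _ => []

/-- The tuple without its first component. -/
def tl : Str → Str
  | true :: _ :: w => tl w
  | false :: w => w
  | _ => []

@[simp] theorem hd_nil : hd [] = [] := by simp [hd]

@[simp] theorem tl_nil : tl [] = [] := by simp [tl]

@[simp] theorem hd_encodeItem_append (u v : Str) : hd (encodeItem u ++ v) = u := by
  induction u with
  | nil => simp [hd]
  | cons b u ih => simp [hd, ih]

@[simp] theorem tl_encodeItem_append (u v : Str) : tl (encodeItem u ++ v) = v := by
  induction u with
  | nil => simp [tl]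
  | cons b u ih => simp [tl, ih]

@[simp] theorem hd_encodeItem (u : Str) : hd (encodeItem u) = u := by
  simpa using hd_encodeItem_append u []

/-- This holds for malformed codes too, which matters because Merlin may send any string. It makes
the consumption of claimed answers non-increasing in total length. -/
theorem length_hd_add_tl (w : Str) : (hd w).length + (tl w).length ≤ w.length := by
  fun_induction hd w with
  | case1 b w ih => simp [tl]; omega
  | case2 w h =>
    rcases w with _ | ⟨_ | _, _ | ⟨b, w⟩⟩
    · simp
    · simp [tl]
    · simp [tl]
    · simp [tl]
    · exact absurd rfl (h b w)

/-- The component number `i` of a tuple. -/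
def item (i : ℕ) (w : Str) : Str := hd (tl^[i] w)

theorem iterate_tl_nil (i : ℕ) : tl^[i] [] = [] := by
  induction i with
  | zero => rfl
  | succ i ih => rw [Function.iterate_succ_apply, tl_nil, ih]

theorem iterate_tl_encodeTuple (i : ℕ) (l : List Str) :
    tl^[i] (encodeTuple l) = encodeTuple (l.drop i) := by
  induction i generalizing l with
  | zero => rfl
  | succ i ih =>
    cases l with
    | nil => simp [iterate_tl_nil]
    | cons w l => rw [Function.iterate_succ_apply, encodeTuple_cons, tl_encodeItem_append, ih]; rfl

theorem item_encodeTuple (i : ℕ) (l : List Str) : item i (encodeTuple l) = l.getD i [] := by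
  rw [item, iterate_tl_encodeTuple]
  induction l generalizing i with
  | nil => simp
  | cons w l ih =>
    cases i with
    | zero => simp
    | succ i => simpa using ih i

theorem encodeTuple_eq_nil {l : List Str} : encodeTuple l = [] ↔ l = [] := by
  cases l <;> simp [encodeItem_ne_nil]

/-- Split the tuple on stack `0`: its first component goes to stack `1`, reversed; stack `2` is
used as a flag. -/
def splitLoop : Prog :=
  .loop 2 (.branch 0
    (.seq (.pop 0) (.branch 0 (.seq (.pop 0) (.push 1 true)) (.seq (.pop 0) (.push 1 false)) .skip))
    (.seq (.pop 0) (.pop 2))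
    (.pop 2))

/-- The last case of the proof contains the malformed code `1`: there the loop runs once more on the
empty stack before the flag is erased. -/
theorem runsIn_splitLoop (w acc : Str) :
    RunsIn splitLoop (ofList [w, acc, [true]]) (ofList [tl w, (hd w).reverse ++ acc, []])
      (8 * w.length + 8) := by
  fun_induction hd w generalizing acc with
  | case1 b w ih =>
    have p1 : RunsIn (.pop 0) (ofList [true :: b :: w, acc, [true]])
        (ofList [b :: w, acc, [true]]) 1 := by
      simpa using runsIn_pop_ofList (a := 0) [true :: b :: w, acc, [true]] (by simp)
    have p2 : RunsIn (.pop 0) (ofList [b :: w, acc, [true]]) (ofList [w, acc, [true]]) 1 := by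
      simpa using runsIn_pop_ofList (a := 0) [b :: w, acc, [true]] (by simp)
    have p3 : RunsIn (.push 1 b) (ofList [w, acc, [true]]) (ofList [w, b :: acc, [true]]) 1 := by
      simpa using runsIn_push_ofList (a := 1) b [w, acc, [true]] (by simp)
    have step : RunsIn (.branch 0 (.seq (.pop 0)
        (.branch 0 (.seq (.pop 0) (.push 1 true)) (.seq (.pop 0) (.push 1 false)) .skip))
        (.seq (.pop 0) (.pop 2)) (.pop 2)) (ofList [true :: b :: w, acc, [true]])
        (ofList [w, b :: acc, [true]]) 5 := by
      refine RunsIn.branchOne rfl (B := 4) (RunsIn.seq (B₂ := 3) p1 ?_)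
      cases b
      · exact RunsIn.branchZero rfl (p2.seq p3)
      · exact RunsIn.branchOne rfl (p2.seq p3)
    refine (RunsIn.loopStep (by simp [ofList]) step (ih (b :: acc))).congr (by simp [tl]) ?_
    simp; omega
  | case2 w h =>
    have fin : ∀ u : Str, RunsIn (.pop 2) (ofList [u, acc, [true]]) (ofList [u, acc, []]) 1 := by
      intro u
      simpa using runsIn_pop_ofList (a := 2) [u, acc, [true]] (by simp)
    have done : ∀ u : Str, RunsIn splitLoop (ofList [u, acc, []]) (ofList [u, acc, []]) 1 :=
      fun u => RunsIn.loopDone rfl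
    rcases w with _ | ⟨_ | _, w⟩
    · exact (RunsIn.loopStep (by simp [ofList]) (RunsIn.branchEmpty rfl (fin [])) (done [])).congr
        (by simp) (by simp)
    · have p : RunsIn (.pop 0) (ofList [false :: w, acc, [true]]) (ofList [w, acc, [true]]) 1 := by
        simpa using runsIn_pop_ofList (a := 0) [false :: w, acc, [true]] (by simp)
      exact (RunsIn.loopStep (by simp [ofList]) (RunsIn.branchZero rfl (p.seq (fin w)))
        (done w)).congr (by simp [tl]) (by simp)
    · rcases w with _ | ⟨b, w⟩
      · have p : RunsIn (.pop 0) (ofList [[true], acc, [true]]) (ofList [[], acc, [true]]) 1 := by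
          simpa using runsIn_pop_ofList (a := 0) [[true], acc, [true]] (by simp)
        have l1 := RunsIn.loopStep (by simp [ofList]) (RunsIn.branchEmpty (r := 0)
          (c := (.seq (.pop 0) (.branch 0 (.seq (.pop 0) (.push 1 true))
            (.seq (.pop 0) (.push 1 false)) .skip)))
          (d := (.seq (.pop 0) (.pop 2))) rfl (fin [])) (done [])
        exact (RunsIn.loopStep (by simp [ofList]) (RunsIn.branchOne rfl
          (p.seq (RunsIn.branchEmpty rfl RunsIn.skip))) l1).congr (by simp [tl]) (by simp)
      · exact absurd rfl (h b w)

theorem runsIn_split (w : Str) :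
    RunsIn (.seq (.push 2 true) splitLoop) (ofList [w]) (ofList [tl w, (hd w).reverse, []])
      (8 * w.length + 9) := by
  have h : RunsIn (.push 2 true) (ofList [w]) (ofList [w, [], [true]]) 1 := by
    rw [ofList_two, ofList_three]
    simpa using runsIn_push_ofList (a := 2) true [w, [], []] (by simp)
  exact (h.seq (runsIn_splitLoop w [])).congr (by simp) (by omega)

/-- Put the string `w` on top of stack `r`. -/
def pushStr (r : ℕ) : Str → Prog
  | [] => .skip
  | b :: w => .seq (pushStr r w) (.push r b)

theorem runsIn_pushStr {r : ℕ} (w : Str) (l : List Str) (hr : r < l.length) :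
    RunsIn (pushStr r w) (ofList l) (ofList (l.set r (w ++ l.getD r []))) (w.length + 1) := by
  induction w with
  | nil => exact RunsIn.skip.congr (by simp [hr]) (by simp)
  | cons b w ih =>
    have h := runsIn_push_ofList (a := r) b (l.set r (w ++ l.getD r [])) (by simpa using hr)
    exact (ih.seq h).congr (by simp [hr]) (by simp)

namespace PolyTime

variable {g g₁ g₂ e : Str → Str}

theorem tl (h : PolyTime g) : PolyTime (fun x => tl (g x)) := by
  refine comp (g₂ := fun x => RationalProofs.tl x) ?_ h
  refine ⟨.seq (.push 2 true) splitLoop, 8 * Polynomial.X + 9, fun x => ?_⟩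
  obtain ⟨t, ht, hr⟩ := runsIn_split x
  exact ⟨_, t, by rwa [initStore_eq], rfl, by simpa using ht⟩

theorem hd (h : PolyTime g) : PolyTime (fun x => hd (g x)) := by
  refine comp (g₂ := fun x => RationalProofs.hd x) ?_ h
  refine ⟨.seq (.seq (.push 2 true) splitLoop) (.seq (clear 0) (mv 1 0)),
    20 * Polynomial.X + 20, fun x => ?_⟩
  have h1 : RunsIn (clear 0) (ofList [RationalProofs.tl x, (RationalProofs.hd x).reverse, []])
      (ofList [[], (RationalProofs.hd x).reverse, []]) _ :=
    runsIn_clear_ofList (a := 0) _ (by simp)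
  have h2 := runsIn_mv_ofList (a := 1) (b := 0) (by omega)
    [[], (RationalProofs.hd x).reverse, []] (by simp) (by simp)
  have k := length_hd_add_tl x
  obtain ⟨t, ht, hr⟩ := (runsIn_split x).seq (h1.seq h2)
  refine ⟨_, t, by rwa [initStore_eq], by simp [ofList], ht.trans ?_⟩
  simp
  omega

theorem iterate_tl (i : ℕ) (h : PolyTime g) :
    PolyTime (fun x => RationalProofs.tl^[i] (g x)) := by
  induction i with
  | zero => exact h
  | succ i ih =>
    simp only [Function.iterate_succ_apply']
    exact ih.tl

theorem item (i : ℕ) (h : PolyTime g) : PolyTime (fun x => item i (g x)) :=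
  (h.iterate_tl i).hd

theorem flatMap (F : Bool → Str) (h : PolyTime g) : PolyTime (fun x => (g x).flatMap F) := by
  refine comp (g₂ := fun x => x.flatMap F) ?_ h
  let lp : Prog := .loop 1 (.branch 1 (.seq (.pop 1) (pushStr 0 (F true)))
    (.seq (.pop 1) (pushStr 0 (F false))) .skip)
  let C : ℕ := (F true).length + (F false).length + 4
  have loop : ∀ u acc : Str, RunsIn lp (ofList [acc, u])
      (ofList [(u.reverse).flatMap F ++ acc, []]) (C * u.length + 1) := by
    intro u
    induction u with
    | nil => intro acc; exact (RunsIn.loopDone rfl).mono (by simp)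
    | cons b u ih =>
      intro acc
      have p1 : RunsIn (.pop 1) (ofList [acc, b :: u]) (ofList [acc, u]) 1 := by
        simpa using runsIn_pop_ofList (a := 1) [acc, b :: u] (by simp)
      have p2 : RunsIn (pushStr 0 (F b)) (ofList [acc, u]) (ofList [F b ++ acc, u])
          ((F b).length + 1) := by
        simpa using runsIn_pushStr (r := 0) (F b) [acc, u] (by simp)
      have step : RunsIn (.branch 1 (.seq (.pop 1) (pushStr 0 (F true)))
          (.seq (.pop 1) (pushStr 0 (F false))) .skip) (ofList [acc, b :: u])
          (ofList [F b ++ acc, u]) (C - 1) := by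
        cases b
        · exact (RunsIn.branchZero rfl (p1.seq p2)).mono (by simp only [C]; omega)
        · exact (RunsIn.branchOne rfl (p1.seq p2)).mono (by simp only [C]; omega)
      refine (RunsIn.loopStep (by simp [ofList]) step (ih _)).congr (by simp) ?_
      simp only [List.length_cons, mul_add, mul_one, C]
      omega
  refine ComputesIn.polyTime (c := .seq (mv 0 1) lp)
    (T := (4 + Polynomial.C C) * Polynomial.X + 2) fun x => ?_
  have h1 := runsIn_mv_ofList (a := 0) (b := 1) (by omega) [x, []] (by simp) (by simp)
  simp at h1
  rw [ofList_two, ofList_two (x.flatMap F)]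
  refine (h1.seq (loop _ _)).congr (by simp) ?_
  simp [add_mul]
  omega

theorem encodeItem (h : PolyTime g) : PolyTime (fun x => encodeItem (g x)) :=
  (h.flatMap _).append (const _)

theorem encodeTuple (l : List (Str → Str)) (h : ∀ g ∈ l, PolyTime g) :
    PolyTime (fun x => encodeTuple (l.map fun g => g x)) := by
  induction l with
  | nil => exact const []
  | cons g l ih =>
    simp only [List.map_cons, encodeTuple_cons]
    exact (h g (by simp)).encodeItem.append (ih fun g hg => h g (by simp [hg]))

/-- The string of ones of the same length. -/
theorem ones (h : PolyTime g) : PolyTime (fun x => List.replicate (g x).length true) := by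
  convert h.flatMap (fun _ => [true]) using 2 with x
  induction g x with
  | nil => rfl
  | cons b w ih => simp [List.replicate_succ, ih]

/-- Iteration of a function of a parameter and a string. -/
theorem iterate_param {r p s : Str → Str} (hr : PolyTime r) (hp : PolyTime p) (hs : PolyTime s)
    (hg : PolyTime g) (S : Polynomial ℕ)
    (hS : ∀ r p s : Str, ∀ i ≤ r.length,
      ((fun s => g (RationalProofs.encodeItem p ++ s))^[i] s).length ≤
        S.eval (r.length + p.length + s.length)) :
    PolyTime (fun x => (fun s => g (RationalProofs.encodeItem (p x) ++ s))^[(r x).length] (s x)) := by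
  let G : Str → Str := fun w => RationalProofs.encodeItem (RationalProofs.hd w) ++
    (RationalProofs.encodeItem (RationalProofs.hd (RationalProofs.tl w)) ++
      g (RationalProofs.encodeItem (RationalProofs.hd (RationalProofs.tl w)) ++
        RationalProofs.tl (RationalProofs.tl w)))
  have hG : PolyTime G := id.hd.encodeItem.append (id.tl.hd.encodeItem.append
    (hg.comp (id.tl.hd.encodeItem.append id.tl.tl)))
  -- `G` re-encodes its argument, which changes a malformed string; the formula is therefore claimed
  -- only from the first iteration on.
  have key : ∀ (i : ℕ) (w : Str), 0 < i → G^[i] w =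
      RationalProofs.encodeItem (RationalProofs.hd w) ++
      (RationalProofs.encodeItem (RationalProofs.hd (RationalProofs.tl w)) ++
        (fun s => g (RationalProofs.encodeItem (RationalProofs.hd (RationalProofs.tl w)) ++ s))^[i]
          (RationalProofs.tl (RationalProofs.tl w))) := by
    intro i w hi
    induction i with
    | zero => omega
    | succ i ih =>
      rw [Function.iterate_succ_apply']
      rcases Nat.eq_zero_or_pos i with rfl | hi
      · rfl
      · rw [ih hi, Function.iterate_succ_apply']
        simp [G]
  have hb : ∀ w, ∀ i ≤ (RationalProofs.hd w).length,
      (G^[i] w).length ≤ (2 * Polynomial.X + 2 + S).eval w.length := by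
    intro w i hi
    have l1 := length_hd_add_tl w
    have l2 := length_hd_add_tl (RationalProofs.tl w)
    rcases Nat.eq_zero_or_pos i with rfl | hpos
    · simp; omega
    · rw [key i w hpos]
      have h1 := hS _ (RationalProofs.hd (RationalProofs.tl w))
        (RationalProofs.tl (RationalProofs.tl w)) i hi
      have h2 := eval_mono S (show (RationalProofs.hd w).length +
        (RationalProofs.hd (RationalProofs.tl w)).length +
        (RationalProofs.tl (RationalProofs.tl w)).length ≤ w.length by omega)
      simp
      omega
  have h1 := ((hG.iterate id.hd _ hb).comp
    (hr.encodeItem.append (hp.encodeItem.append hs))).tl.tl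
  convert h1 using 2 with x
  rcases Nat.eq_zero_or_pos (r x).length with h0 | hpos
  · simp [h0]
  · simp [key _ _ hpos]

theorem drop (h : PolyTime g) (he : PolyTime e) : PolyTime (fun x => (g x).drop (e x).length) := by
  have tail_iterate : ∀ (i : ℕ) (s : Str), (fun s : Str => s.tail)^[i] s = s.drop i := by
    intro i s
    induction i with
    | zero => rfl
    | succ i ih => rw [Function.iterate_succ_apply', ih, List.tail_drop]
  have h1 := iterate_param he (const []) h id.tl.tail Polynomial.X (by
    intro r p s i _
    simp only [tl_encodeItem_append, tail_iterate, List.length_drop, Polynomial.eval_X]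
    omega)
  simpa only [tl_encodeItem_append, tail_iterate] using h1

theorem take (h : PolyTime g) (he : PolyTime e) : PolyTime (fun x => (g x).take (e x).length) := by
  -- A prefix is what remains after as many symbols as `drop` leaves over are removed from the other
  -- end.
  convert (h.reverse.drop (h.drop he)).reverse using 2 with x
  rw [List.length_drop, List.drop_reverse, List.reverse_reverse]
  rcases le_total (e x).length (g x).length with h | h
  · rw [Nat.sub_sub_self h]
  · rw [Nat.sub_eq_zero_of_le h, List.take_of_length_le h, Nat.sub_zero, List.take_length]

theorem replicate_mul (h₁ : PolyTime g₁) (h₂ : PolyTime g₂) :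
    PolyTime (fun x => List.replicate ((g₁ x).length * (g₂ x).length) true) := by
  have append_iterate : ∀ (i : ℕ) (p s : Str),
      ((fun s : Str => p ++ s)^[i] s).length = p.length * i + s.length := by
    intro i p s
    induction i with
    | zero => simp
    | succ i ih => rw [Function.iterate_succ_apply', List.length_append, ih]; ring
  have h := (iterate_param h₂ h₁ (const []) (id.hd.append id.tl)
    (Polynomial.X * Polynomial.X + Polynomial.X) (by
      intro r p s i hi
      simp only [hd_encodeItem_append, tl_encodeItem_append, append_iterate]
      simp only [Polynomial.eval_add, Polynomial.eval_mul, Polynomial.eval_X]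
      have : p.length * i ≤ (r.length + p.length + s.length) * (r.length + p.length + s.length) :=
        Nat.mul_le_mul (by omega) (by omega)
      omega)).ones
  simpa [append_iterate] using h

/-- Polynomial bounds become strings of ones that serve as clocks and rulers; sums are
concatenations, and powers are built by iterated multiplication of lengths. -/
theorem replicate_eval (p : Polynomial ℕ) (h : PolyTime g) :
    PolyTime (fun x => List.replicate (p.eval (g x).length) true) := by
  induction p using Polynomial.induction_on' with
  | add p q hp hq =>
    simp only [Polynomial.eval_add, List.replicate_add]
    exact hp.append hq
  | monomial n a =>
    induction n with
    | zero => simpa using const (List.replicate a true)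
    | succ n ih =>
      convert ih.replicate_mul h using 3 with x
      simp [pow_succ, mul_assoc]

theorem drop_eval (p : Polynomial ℕ) (h : PolyTime g) (he : PolyTime e) :
    PolyTime (fun x => (g x).drop (p.eval (e x).length)) := by
  simpa using h.drop (he.replicate_eval p)

theorem take_eval (p : Polynomial ℕ) (h : PolyTime g) (he : PolyTime e) :
    PolyTime (fun x => (g x).take (p.eval (e x).length)) := by
  simpa using h.take (he.replicate_eval p)

end PolyTime

theorem PolyDec.head {g : Str → Str} (h : PolyTime g) :
    PolyDec (fun x => (g x).head? = some true) := by
  have e : charFn {x | (g x).head? = some true} =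
      fun x => if (g x).head? = some true then [true] else [false] := by
    funext x
    by_cases h : (g x).head? = some true <;> simp [charFn, h]
  unfold PolyDec
  rw [e]
  exact h.ite_head (PolyTime.const [true]) (PolyTime.const [false])

/-! ### Functions on stores -/

/-- Only the first `K` stacks are in use. -/
def Supp (K : ℕ) (s : Store) : Prop := ∀ r, K ≤ r → s r = []

/-- The code of the first `K` stacks as a string. -/
def encStore (K : ℕ) (s : Store) : Str := encodeTuple ((List.range K).map s)

/-- The store coded by a string. -/
def decStore (K : ℕ) (w : Str) : Store := fun r => if r < K then item r w else []

/-- The total length of the first `K` stacks. -/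
def size (K : ℕ) (s : Store) : ℕ := ∑ r ∈ Finset.range K, (s r).length

theorem supp_decStore (K : ℕ) (w : Str) : Supp K (decStore K w) := fun r hr => by
  rw [decStore, if_neg (by omega)]

theorem decStore_encStore {K : ℕ} {s : Store} (hs : Supp K s) : decStore K (encStore K s) = s := by
  funext r
  unfold decStore
  split_ifs with h
  · simp [encStore, item_encodeTuple, h]
  · exact (hs r (by omega)).symm

theorem length_encStore (K : ℕ) (s : Store) : (encStore K s).length = 2 * size K s + K := by
  induction K with
  | zero => rfl
  | succ K ih =>
    have : encStore (K + 1) s = encStore K s ++ encodeItem (s K) := by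
      simp [encStore, List.range_succ]
    rw [this, List.length_append, ih, length_encodeItem, size, size, Finset.sum_range_succ]
    ring

theorem size_decStore_le (K : ℕ) (w : Str) : size K (decStore K w) ≤ w.length := by
  have h : ∀ n, ∑ r ∈ Finset.range n, (item r w).length + (tl^[n] w).length ≤ w.length := by
    intro n
    induction n with
    | zero => simp
    | succ n ih =>
      rw [Finset.sum_range_succ, Function.iterate_succ_apply']
      have := length_hd_add_tl (tl^[n] w)
      rw [item]
      omega
  refine le_trans (le_of_eq ?_) (le_trans (Nat.le_add_right _ _) (h K))
  refine Finset.sum_congr rfl fun r hr => ?_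
  rw [decStore, if_pos (Finset.mem_range.1 hr)]

theorem length_le_size {K r : ℕ} (hr : r < K) (s : Store) : (s r).length ≤ size K s :=
  Finset.single_le_sum (f := fun r => (s r).length) (fun _ _ => Nat.zero_le _)
    (Finset.mem_range.2 hr)

theorem size_update {K r : ℕ} (hr : r < K) (s : Store) (v : Str) :
    size K (Function.update s r v) + (s r).length = size K s + v.length := by
  have hr' := Finset.mem_range.2 hr
  rw [size, size, ← Finset.add_sum_erase _ _ hr', ← Finset.add_sum_erase _ (fun i => (s i).length) hr']
  have : ∑ i ∈ (Finset.range K).erase r, (Function.update s r v i).length =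
      ∑ i ∈ (Finset.range K).erase r, (s i).length :=
    Finset.sum_congr rfl fun i hi => by rw [Function.update_of_ne (Finset.ne_of_mem_erase hi)]
  rw [this, Function.update_self]
  omega

theorem Supp.update {K r : ℕ} {s : Store} (hs : Supp K s) (hr : r < K) (v : Str) :
    Supp K (Function.update s r v) := fun i hi => by
  rw [Function.update_of_ne (by omega), hs i hi]

/-- A string-valued function of a store that is computable in polynomial time. -/
def PolyExp (K : ℕ) (e : Store → Str) : Prop := PolyTime (fun w => e (decStore K w))

theorem PolyExp.reg (K r : ℕ) : PolyExp K (fun s => s r) := by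
  by_cases h : r < K
  · simpa [PolyExp, decStore, h] using PolyTime.id.item r
  · simpa [PolyExp, decStore, h] using PolyTime.const []

/-- A function on stores that is computable in polynomial time. -/
structure PolyStore (K : ℕ) (F : Store → Store) : Prop where
  supp : ∀ s, Supp K s → Supp K (F s)
  poly : PolyTime (fun w => encStore K (F (decStore K w)))

namespace PolyStore

variable {K : ℕ} {F F₁ F₂ : Store → Store}

theorem of_components (hs : ∀ s, Supp K s → Supp K (F s))
    (h : ∀ r < K, PolyExp K (fun s => F s r)) : PolyStore K F := by
  refine ⟨hs, ?_⟩
  have := PolyTime.encodeTuple ((List.range K).map fun r w => F (decStore K w) r) (by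
    intro g hg
    obtain ⟨r, hr, rfl⟩ := List.mem_map.1 hg
    exact h r (List.mem_range.1 hr))
  simpa [encStore, Function.comp_def] using this

/-- The passage from functions on stores to functions on strings: each initial stack is computed
from the input and one final stack is read off. -/
theorem apply (hF : PolyStore K F) {G : Str → Store} (hs : ∀ w, Supp K (G w))
    (hG : ∀ r, PolyTime (fun w => G w r)) (r : ℕ) : PolyTime (fun w => F (G w) r) := by
  have h1 : PolyTime (fun w => encStore K (G w)) := by
    have := PolyTime.encodeTuple ((List.range K).map fun r w => G w r) (by
      intro g hg
      obtain ⟨r, hr, rfl⟩ := List.mem_map.1 hg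
      exact hG r)
    simpa [encStore, Function.comp_def] using this
  by_cases hr : r < K
  · have h2 := (hF.poly.comp h1).item r
    convert h2 using 2 with w
    rw [decStore_encStore (hs w), encStore, item_encodeTuple]
    simp [hr]
  · have : (fun w => F (G w) r) = fun _ => [] := by
      funext w; exact hF.supp _ (hs w) r (by omega)
    rw [this]
    exact PolyTime.const []

theorem id : PolyStore K (fun s => s) :=
  of_components (fun _ h => h) fun r _ => PolyExp.reg K r

theorem comp (h₂ : PolyStore K F₂) (h₁ : PolyStore K F₁) : PolyStore K (fun s => F₂ (F₁ s)) := by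
  refine ⟨fun s hs => h₂.supp _ (h₁.supp _ hs), ?_⟩
  have := h₂.poly.comp h₁.poly
  simpa only [decStore_encStore (h₁.supp _ (supp_decStore _ _))] using this

theorem update {r : ℕ} (hr : r < K) {e : Store → Str} (he : PolyExp K e) :
    PolyStore K (fun s => Function.update s r (e s)) := by
  refine of_components (fun s hs => hs.update hr _) fun i _ => ?_
  by_cases hi : i = r
  · subst hi; simpa using he
  · simpa [Function.update_of_ne hi] using PolyExp.reg K i

theorem ite {p : Store → Prop} [DecidablePred p] (hp : PolyDec (fun w => p (decStore K w)))
    (h₁ : PolyStore K F₁) (h₂ : PolyStore K F₂) :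
    PolyStore K (fun s => if p s then F₁ s else F₂ s) := by
  refine ⟨fun s hs => ?_, ?_⟩
  · split_ifs
    · exact h₁.supp s hs
    · exact h₂.supp s hs
  · convert PolyTime.ite hp h₁.poly h₂.poly using 2 with w
    split_ifs <;> rfl

theorem iterate (h : PolyStore K F) {e : Store → Str} (he : PolyExp K e) (S : Polynomial ℕ)
    (hS : ∀ s, ∀ i ≤ (e s).length, size K (F^[i] s) ≤ S.eval (size K s)) :
    PolyStore K (fun s => F^[(e s).length] s) := by
  have hsupp : ∀ i s, Supp K s → Supp K (F^[i] s) := by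
    intro i s hs
    induction i with
    | zero => exact hs
    | succ i ih => rw [Function.iterate_succ_apply']; exact h.supp _ ih
  refine ⟨fun s hs => hsupp _ s hs, ?_⟩
  -- Only positive iterates are described, because decoding and re-encoding changes a string that is
  -- not a code.
  have key : ∀ i w, (fun w => encStore K (F (decStore K w)))^[i + 1] w =
      encStore K (F^[i + 1] (decStore K w)) := by
    intro i w
    induction i with
    | zero => rfl
    | succ i ih =>
      rw [Function.iterate_succ_apply', ih, Function.iterate_succ_apply' F (i + 1),
        decStore_encStore (hsupp _ _ (supp_decStore K w))]
  have hb : ∀ w, ∀ i ≤ (e (decStore K w)).length,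
      ((fun w => encStore K (F (decStore K w)))^[i] w).length ≤
        (2 * S + Polynomial.C K + Polynomial.X).eval w.length := by
    intro w i hi
    cases i with
    | zero => simp
    | succ i =>
      rw [key, length_encStore]
      have h1 := hS _ _ hi
      have h2 := eval_mono S (size_decStore_le K w)
      simp only [Polynomial.eval_add, Polynomial.eval_mul, Polynomial.eval_ofNat,
        Polynomial.eval_C, Polynomial.eval_X]
      omega
  have h1 := (h.poly.iterate he _ hb).comp (id (K := K)).poly
  have hd : ∀ w, decStore K (encStore K (decStore K w)) = decStore K w :=
    fun w => decStore_encStore (supp_decStore K w)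
  convert h1 using 2 with w
  rw [hd]
  rcases (e (decStore K w)).length with _ | i
  · rfl
  · rw [key, hd]

end PolyStore

/-! ### Functions on stores of bounded growth -/

/-- A polynomial-time function on stores that increases the total length of the stacks at most by
a polynomial in the length of the clock (stack `k`), which it does not change. -/
structure Tame (K k : ℕ) (F : Store → Store) : Prop extends PolyStore K F where
  clock : ∀ s, F s k = s k
  growth : ∃ p : Polynomial ℕ, ∀ s, size K (F s) ≤ size K s + p.eval (s k).length

namespace Tame

variable {K k : ℕ} {F F₁ F₂ : Store → Store}

theorem id : Tame K k (fun s => s) :=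
  ⟨PolyStore.id, fun _ => rfl, 0, fun s => by simp⟩

theorem comp (h₂ : Tame K k F₂) (h₁ : Tame K k F₁) : Tame K k (fun s => F₂ (F₁ s)) := by
  obtain ⟨p₁, hp₁⟩ := h₁.growth
  obtain ⟨p₂, hp₂⟩ := h₂.growth
  refine ⟨h₂.toPolyStore.comp h₁.toPolyStore, fun s => by rw [h₂.clock, h₁.clock], p₁ + p₂,
    fun s => ?_⟩
  have a := hp₁ s
  have b := hp₂ (F₁ s)
  rw [h₁.clock] at b
  simp
  omega

theorem update {r : ℕ} (hr : r < K) (hrk : r ≠ k) {e : Store → Str} (he : PolyExp K e)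
    (p : Polynomial ℕ) (hp : ∀ s, (e s).length ≤ (s r).length + p.eval (s k).length) :
    Tame K k (fun s => Function.update s r (e s)) := by
  refine ⟨PolyStore.update hr he, fun s => Function.update_of_ne hrk.symm _ _, p, fun s => ?_⟩
  have := size_update hr s (e s)
  have := hp s
  omega

theorem ite {p : Store → Prop} [DecidablePred p] (hp : PolyDec (fun w => p (decStore K w)))
    (h₁ : Tame K k F₁) (h₂ : Tame K k F₂) : Tame K k (fun s => if p s then F₁ s else F₂ s) := by
  obtain ⟨p₁, hp₁⟩ := h₁.growth
  obtain ⟨p₂, hp₂⟩ := h₂.growth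
  refine ⟨PolyStore.ite hp h₁.toPolyStore h₂.toPolyStore, fun s => ?_, p₁ + p₂, fun s => ?_⟩
  · split_ifs
    · exact h₁.clock s
    · exact h₂.clock s
  · have a := hp₁ s
    have b := hp₂ s
    split_ifs <;> simp <;> omega

/-- The increment of each iteration depends on the clock alone, and the clock stays fixed, so the
increments add up instead of compounding. This allows loops to be nested. -/
theorem iterate (hk : k < K) (h : Tame K k F) : Tame K k (fun s => F^[(s k).length] s) := by
  obtain ⟨p, hp⟩ := h.growth
  have hclock : ∀ i s, F^[i] s k = s k := by
    intro i s
    induction i with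
    | zero => rfl
    | succ i ih => rw [Function.iterate_succ_apply', h.clock, ih]
  have hsize : ∀ i s, size K (F^[i] s) ≤ size K s + i * p.eval (s k).length := by
    intro i s
    induction i with
    | zero => simp
    | succ i ih =>
      rw [Function.iterate_succ_apply', add_one_mul]
      have := hp (F^[i] s)
      rw [hclock] at this
      omega
  refine ⟨h.toPolyStore.iterate (PolyExp.reg K k) (Polynomial.X + Polynomial.X * p) ?_,
    fun s => hclock _ s, Polynomial.X * p, fun s => by simpa using hsize _ s⟩
  intro s i hi
  refine (hsize i s).trans ?_
  have h1 := length_le_size hk s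
  have h2 := Nat.mul_le_mul (hi.trans h1) (eval_mono p h1)
  simpa using h2

end Tame

/-! ### Clocked simulation of oracle programs -/

/-- The function on stores that a program computes if queries are answered by `ans`, and every loop
is iterated as often as the length of stack `k` says. -/
def sim (k : ℕ) (ans : ℕ → ℕ → Store → Store) : Prog → Store → Store
  | .skip => fun s => s
  | .push r b => fun s => Function.update s r (b :: s r)
  | .pop r => fun s => Function.update s r (s r).tail
  | .seq c d => fun s => sim k ans d (sim k ans c s)
  | .branch r c d e => fun s =>
      if (s r).head? = some true then sim k ans c s
      else if s r = [] then sim k ans e s else sim k ans d s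
  | .loop r c => fun s =>
      (fun s => if s r = [] then s else sim k ans c s)^[(s k).length] s
  | .query q a => ans q a

/-- No assumption on the program beyond its width is needed: the clock cuts off every loop, and the
stacks from `N` on, among them the clock, are reached only through `ans`. -/
theorem tame_sim {K k N : ℕ} (hk : k < K) (hN : N ≤ k) {ans : ℕ → ℕ → Store → Store}
    (hans : ∀ q a, q < N → a < N → Tame K k (ans q a)) (c : Prog) (hc : width c ≤ N) :
    Tame K k (sim k ans c) := by
  induction c with
  | skip => exact Tame.id
  | push r b =>
    simp only [width] at hc
    exact Tame.update (by omega) (by omega) ((PolyExp.reg K r).cons b) 1 (by simp)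
  | pop r =>
    simp only [width] at hc
    exact Tame.update (by omega) (by omega) (PolyExp.reg K r).tail 0 (by simp)
  | seq c d ihc ihd =>
    simp only [width] at hc
    exact (ihd (by omega)).comp (ihc (by omega))
  | branch r c d e ihc ihd ihe =>
    simp only [width] at hc
    exact Tame.ite (PolyDec.head (PolyExp.reg K r)) (ihc (by omega))
      (Tame.ite (PolyDec.eq (PolyExp.reg K r) (PolyTime.const [])) (ihe (by omega))
        (ihd (by omega)))
  | loop r c ih =>
    simp only [width] at hc
    exact Tame.iterate hk (Tame.ite (PolyDec.eq (PolyExp.reg K r) (PolyTime.const []))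
      Tame.id (ih (by omega)))
  | query q a =>
    simp only [width] at hc
    exact hans q a (by omega) (by omega)

/-- The store with the first `N` stacks of `s` and the other stacks of `e`. -/
def overlay (N : ℕ) (s e : Store) : Store := fun r => if r < N then s r else e r

theorem update_overlay {N r : ℕ} (hr : r < N) (s e : Store) (v : Str) :
    Function.update (overlay N s e) r v = overlay N (Function.update s r v) e := by
  funext i
  by_cases hi : i = r
  · subst hi; simp [overlay, hr]
  · simp [overlay, hi]

theorem overlay_of_lt {N r : ℕ} (hr : r < N) (s e : Store) : overlay N s e r = s r := if_pos hr

theorem overlay_of_le {N r : ℕ} (hr : N ≤ r) (s e : Store) : overlay N s e r = e r :=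
  if_neg (by omega)

/-! ### Correctness of the simulation -/

/-- Let a list of queries act on a state, until the action fails. -/
def consume {Θ Φ : Type*} (step : Str → Θ → Θ ⊕ Φ) : List Str → Θ → Θ ⊕ Φ
  | [], θ => .inl θ
  | z :: Z, θ => (step z θ).elim (consume step Z) .inr

theorem consume_append {Θ Φ : Type*} (step : Str → Θ → Θ ⊕ Φ) (Z₁ Z₂ : List Str) (θ : Θ) :
    consume step (Z₁ ++ Z₂) θ = (consume step Z₁ θ).elim (consume step Z₂) .inr := by
  induction Z₁ generalizing θ with
  | nil => rfl
  | cons z Z ih =>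
    simp only [List.cons_append, consume]
    cases step z θ with
    | inl θ' => exact ih θ'
    | inr φ => rfl

/-- The simulation, with `m` iterations of the outermost loop. -/
def simUpTo (k : ℕ) (ans : ℕ → ℕ → Store → Store) (m : ℕ) : Prog → Store → Store
  | .loop r c => (fun s => if s r = [] then s else sim k ans c s)^[m]
  | c => sim k ans c

theorem simUpTo_clock (k : ℕ) (ans : ℕ → ℕ → Store → Store) (c : Prog) (s : Store) :
    simUpTo k ans (s k).length c s = sim k ans c s := by
  cases c <;> rfl

section Simulation

variable {f : Str → Str} {N k n₀ : ℕ} {ans : ℕ → ℕ → Store → Store} {Θ Φ : Type*}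
  {side : Θ → Store} {step : Str → Θ → Θ ⊕ Φ} {P : Φ → Store → Prop}

/-- Failure is absorbing: once `P φ` holds, whatever the rest of the program does on meaningless
data leaves it true. -/
theorem simUpTo_preserves
    (hP : ∀ φ c S, width c ≤ N → P φ S → P φ (sim k ans c S)) (φ : Φ) (c : Prog) (S : Store)
    (m : ℕ) (hc : width c ≤ N) (h : P φ S) : P φ (simUpTo k ans m c S) := by
  cases c with
  | loop r c =>
    simp only [width] at hc
    simp only [simUpTo]
    induction m generalizing S with
    | zero => exact h
    | succ m ih =>
      rw [Function.iterate_succ_apply]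
      refine ih _ ?_
      split_ifs
      · exact h
      · exact hP φ c S (by omega) h
  | _ => exact hP φ _ S hc h

/-- What the simulation of `c` does to the store `s` if the queries are `Z` and `s'` is the
result of the run with the oracle. -/
def Follows (N : ℕ) (side : Θ → Store)
    (step : Str → Θ → Θ ⊕ Φ) (P : Φ → Store → Prop) (F : Store → Store) (s s' : Store)
    (Z : List Str) : Prop :=
  ∀ θ, match consume step Z θ with
    | .inl θ' => F (overlay N s (side θ)) = overlay N s' (side θ')
    | .inr φ => P φ (F (overlay N s (side θ)))

theorem Follows.comp {F G : Store → Store} {s s₁ s₂ : Store} {Z₁ Z₂ : List Str}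
    (hF : Follows N side step P F s s₁ Z₁) (hG : Follows N side step P G s₁ s₂ Z₂)
    (hP : ∀ φ S, P φ S → P φ (G S)) :
    Follows N side step P (fun s => G (F s)) s s₂ (Z₁ ++ Z₂) := by
  intro θ
  rw [consume_append]
  have h1 := hF θ
  rcases h : consume step Z₁ θ with θ' | φ
  · rw [h] at h1
    have h2 := hG θ'
    simp only [Sum.elim_inl] at h1 ⊢
    simpa only [h1] using h2
  · rw [h] at h1
    exact hP φ _ h1

/-- A run of `t` steps passes through each of its loops at most `t` times, so the clock allows
enough iterations, and the spare ones idle on an empty stack. The outermost loop gets its own count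
`m`, since after one iteration the induction hypothesis for the remaining loop is needed with `m -
1`; inner loops always get the full clock. The list `Z` does not depend on `θ`, because it consists
of the queries of the true run. Its strings are short because a query costs its length. -/
theorem follows_of_runs (hk : N ≤ k) (hclock : ∀ θ, n₀ ≤ (side θ k).length)
    (hP : ∀ φ c S, width c ≤ N → P φ S → P φ (sim k ans c S))
    (hq : ∀ q a s, q < N → a < N → (s q).length < n₀ →
      Follows N side step P (ans q a) s (Function.update s a (f (s q))) [s q])
    {c : Prog} {s s' : Store} {t : ℕ} (h : Runs f c s s' t) (ht : t ≤ n₀) (hc : width c ≤ N) :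
    ∃ Z : List Str, Z.length ≤ t ∧ (∀ z ∈ Z, z.length < t) ∧
      ∀ m, t ≤ m → Follows N side step P (simUpTo k ans m c) s s' Z := by
  -- The clock is one of the admissible numbers of iterations, since it exceeds the running time.
  have hsim : ∀ {d : Prog} {s₁ s₂ : Store} {t₁ : ℕ} {Z : List Str}, t₁ ≤ n₀ →
      (∀ m, t₁ ≤ m → Follows N side step P (simUpTo k ans m d) s₁ s₂ Z) →
      Follows N side step P (sim k ans d) s₁ s₂ Z := by
    intro d s₁ s₂ t₁ Z ht₁ h θ
    have h1 := h _ (ht₁.trans (hclock θ)) θ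
    have h2 := simUpTo_clock k ans d (overlay N s₁ (side θ))
    rw [overlay_of_le hk] at h2
    rwa [h2] at h1
  induction h with
  | skip s => exact ⟨[], by simp, by simp, fun m _ θ => rfl⟩
  | push r b s =>
    simp only [width] at hc
    refine ⟨[], by simp, by simp, fun m _ θ => ?_⟩
    simp only [consume, simUpTo, sim]
    rw [overlay_of_lt (by omega), update_overlay (by omega)]
  | pop r s =>
    simp only [width] at hc
    refine ⟨[], by simp, by simp, fun m _ θ => ?_⟩
    simp only [consume, simUpTo, sim]
    rw [overlay_of_lt (by omega), update_overlay (by omega)]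
  | query q a s =>
    simp only [width] at hc
    exact ⟨[s q], by simp, by simp, fun m _ => hq q a s (by omega) (by omega) (by omega)⟩
  | seq h₁ h₂ ih₁ ih₂ =>
    simp only [width] at hc
    obtain ⟨Z₁, l₁, b₁, i₁⟩ := ih₁ (by omega) (by omega)
    obtain ⟨Z₂, l₂, b₂, i₂⟩ := ih₂ (by omega) (by omega)
    refine ⟨Z₁ ++ Z₂, by simp; omega, ?_, fun m _ => ?_⟩
    · intro z hz
      rcases List.mem_append.1 hz with hz | hz
      · have := b₁ z hz; omega
      · have := b₂ z hz; omega
    · exact (hsim (by omega) i₁).comp (hsim (by omega) i₂) fun φ S => hP φ _ S (by omega)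
  | @branchOne r c₁ c₂ c₃ s s₁ t hs h ih =>
    simp only [width] at hc
    obtain ⟨Z, l, b, i⟩ := ih (by omega) (by omega)
    refine ⟨Z, by omega, fun z hz => (b z hz).trans (by omega), fun m _ θ => ?_⟩
    have h1 := hsim (by omega) i θ
    simp only [simUpTo, sim]
    rwa [overlay_of_lt (by omega), if_pos hs]
  | @branchZero r c₁ c₂ c₃ s s₁ t hs h ih =>
    simp only [width] at hc
    obtain ⟨Z, l, b, i⟩ := ih (by omega) (by omega)
    refine ⟨Z, by omega, fun z hz => (b z hz).trans (by omega), fun m _ θ => ?_⟩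
    have h1 := hsim (by omega) i θ
    simp only [simUpTo, sim]
    rwa [overlay_of_lt (by omega), if_neg (by simp [hs]), if_neg (by rintro h; simp [h] at hs)]
  | @branchEmpty r c₁ c₂ c₃ s s₁ t hs h ih =>
    simp only [width] at hc
    obtain ⟨Z, l, b, i⟩ := ih (by omega) (by omega)
    refine ⟨Z, by omega, fun z hz => (b z hz).trans (by omega), fun m _ θ => ?_⟩
    have h1 := hsim (by omega) i θ
    simp only [simUpTo, sim]
    rwa [overlay_of_lt (by omega), if_neg (by simp [hs]), if_pos hs]
  | @loopDone r c s hs =>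
    simp only [width] at hc
    refine ⟨[], by simp, by simp, fun m _ θ => ?_⟩
    simp only [consume, simUpTo]
    refine Function.iterate_fixed (f := fun s => if s r = [] then s else sim k ans c s) ?_ m
    exact if_pos ((overlay_of_lt (by omega) _ _).trans hs)
  | @loopStep r c s s₁ s₂ t₁ t₂ hs h₁ h₂ ih₁ ih₂ =>
    have hc' := hc
    simp only [width] at hc
    obtain ⟨Z₁, l₁, b₁, i₁⟩ := ih₁ (by omega) (by omega)
    obtain ⟨Z₂, l₂, b₂, i₂⟩ := ih₂ (by omega) hc'
    refine ⟨Z₁ ++ Z₂, by simp; omega, ?_, fun m hm => ?_⟩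
    · intro z hz
      rcases List.mem_append.1 hz with hz | hz
      · have := b₁ z hz; omega
      · have := b₂ z hz; omega
    -- The loop step itself accounts for the unit of time that makes `m` positive and leaves `m - 1
    -- ≥ t₂`.
    · obtain ⟨m, rfl⟩ := Nat.exists_eq_succ_of_ne_zero (by omega : m ≠ 0)
      have h3 := (hsim (by omega) i₁).comp (i₂ m (by omega))
        fun φ S => simUpTo_preserves hP φ _ S m hc'
      intro θ
      have h4 := h3 θ
      simp only [simUpTo] at h4 ⊢
      rwa [Function.iterate_succ_apply, overlay_of_lt (by omega), if_neg hs]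

end Simulation

/-- An oracle that is computable in polynomial time can be dispensed with. -/
theorem PolyTimeIn.of_polyTime {f g : Str → Str} (hg : PolyTimeIn f g) (hf : PolyTime f) :
    PolyTime g := by
  obtain ⟨c, T, h⟩ := hg
  obtain ⟨p, hp⟩ := hf.exists_length_le
  let N := width c + 1
  -- The true answer is cut to the length of the clock, which makes the growth bound hold on all
  -- stores. The clock `n₀` includes `p.comp T`, so that nothing is lost in the actual run.
  let ans : ℕ → ℕ → Store → Store := fun q a s =>
    Function.update s a ((f (s q)).take (s N).length)
  let n₀ : Str → ℕ := fun x => (T + p.comp T).eval x.length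
  let side : ℕ → Store := fun n r => if r = N then List.replicate n true else []
  let G : Str → Store := fun x => overlay N (initStore x) (side (n₀ x))
  have htame : Tame (N + 1) N (sim N ans c) := by
    refine tame_sim (N := N) (by omega) le_rfl (fun q a hq ha => ?_) c (by omega)
    refine Tame.update (by omega) (by omega)
      ((hf.comp (PolyExp.reg _ q)).take (PolyExp.reg _ N)) Polynomial.X fun s => ?_
    simp
  have hG : ∀ r, PolyTime (fun x => G x r) := by
    intro r
    by_cases h0 : r = 0
    · subst h0
      simpa [G, overlay, N, initStore] using PolyTime.id
    · by_cases hr : r = N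
      · subst hr
        simpa [G, overlay, side, n₀] using PolyTime.id.replicate_eval (T + p.comp T)
      · have : (fun x => G x r) = fun _ => [] := by
          funext x
          simp [G, overlay, side, hr, initStore, h0]
        rw [this]
        exact PolyTime.const []
  have hsupp : ∀ x, Supp (N + 1) (G x) := by
    intro x r hr
    simp only [G]
    rw [overlay_of_le (by omega)]
    exact if_neg (by omega)
  convert htame.toPolyStore.apply hsupp hG 0 using 2 with x
  obtain ⟨s, t, hr, hs, ht⟩ := h x
  have hTn : T.eval x.length ≤ n₀ x := by simp [n₀]
  have hclock : T.eval x.length ≤ (side (n₀ x) N).length := by simp [side, n₀]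
  -- There is no state to track and no failure: `Θ` is `Unit` and `Φ` is `Empty`.
  obtain ⟨Z, -, -, hZ⟩ := follows_of_runs (N := N) (k := N) (n₀ := T.eval x.length)
    (ans := ans) (Θ := Unit) (Φ := Empty) (side := fun _ => side (n₀ x))
    (step := fun _ _ => .inl ()) (P := fun _ _ => True) le_rfl
    (fun _ => hclock) (by simp) (by
      intro q a s hq ha hlen θ
      simp only [consume, Sum.elim_inl, ans]
      rw [overlay_of_lt hq, update_overlay ha, overlay_of_le le_rfl, List.take_of_length_le]
      have h1 := hp (s q)
      have h2 := eval_mono p hlen.le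
      simp [side, n₀]
      omega) hr ht (by omega)
  have h1 := hZ _ (ht.trans hclock) ()
  have h2 := simUpTo_clock N ans c (G x)
  simp only [G] at h2
  rw [overlay_of_le le_rfl] at h2
  rw [h2] at h1
  have h3 : ∀ Z : List Str, consume (Θ := Unit) (Φ := Empty) (fun _ _ => .inl ()) Z () = .inl () := by
    intro Z
    induction Z with
    | nil => rfl
    | cons z Z ih => exact ih
  rw [h3] at h1
  simp only [G]
  rw [h1, overlay_of_lt (by omega), hs]

/-! ### Closure properties of expressions on stores -/

theorem PolyExp.const (K : ℕ) (w : Str) : PolyExp K (fun _ => w) := PolyTime.const w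

theorem PolyExp.hd {K : ℕ} {e : Store → Str} (h : PolyExp K e) : PolyExp K (fun s => hd (e s)) :=
  PolyTime.hd h

theorem PolyExp.tl {K : ℕ} {e : Store → Str} (h : PolyExp K e) : PolyExp K (fun s => tl (e s)) :=
  PolyTime.tl h

theorem PolyExp.drop {K : ℕ} {e₁ e₂ : Store → Str} (h₁ : PolyExp K e₁) (h₂ : PolyExp K e₂) :
    PolyExp K (fun s => (e₁ s).drop (e₂ s).length) :=
  PolyTime.drop h₁ h₂

theorem PolyStore.component {K : ℕ} {F : Store → Store} (h : PolyStore K F) (r : ℕ) :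
    PolyExp K (fun s => F s r) :=
  h.apply (supp_decStore K) (PolyExp.reg K) r

theorem PolyStore.updateOf {K r : ℕ} {F : Store → Store} (h : PolyStore K F) (hr : r < K)
    {e : Store → Str} (he : PolyExp K e) : PolyStore K (fun s => Function.update (F s) r (e s)) := by
  refine PolyStore.of_components (fun s hs => (h.supp s hs).update hr _) fun i _ => ?_
  by_cases hi : i = r
  · subst hi; simpa using he
  · simpa [Function.update_of_ne hi] using h.component i

/-! ### Simulation with claimed answers, up to a randomly selected query

Stack `N` is the clock, `N + 1` holds claimed answers `w₁, μ₁, w₂, μ₂, …` as a tuple, `N + 2` random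
bits, `N + 3` a flag, `N + 4` a ruler; the selected query and the strings claimed for it are put on
`N + 5`, `N + 6` and `N + 7`. -/

/-- Select the query on stack `q`. -/
def record (N q : ℕ) (s : Store) : Store :=
  Function.update (Function.update (Function.update (Function.update (Function.update
    (Function.update s (N + 5) (s q)) q []) (N + 6) (hd (s (N + 1))))
    (N + 7) (hd (tl (s (N + 1))))) (N + 1) []) (N + 3) [true]

/-- Answer the query with the next claimed answer. -/
def nextAnswer (N a : ℕ) (s : Store) : Store :=
  Function.update (Function.update (Function.update s a (hd (s (N + 1)))) (N + 1)
    (tl (tl (s (N + 1))))) (N + 2) ((s (N + 2)).drop (s (N + 4)).length)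

/-- Unless a query is already selected: select the query, if the next random bits differ from the
ruler, and answer it with the next claimed answer otherwise. -/
def selAns (N q a : ℕ) (s : Store) : Store :=
  if s (N + 3) = [] then
    if (s (N + 2)).take (s (N + 4)).length = s (N + 4) then nextAnswer N a s else record N q s
  else s

/-- The query is moved and not copied: stack `q` is emptied, and likewise the stack of claims after
its first two components are extracted. Only the flag can add to the total length, hence the bound
`1`. -/
theorem tame_record {N q : ℕ} (hq : q < N) : Tame (N + 8) N (record N q) := by
  have R := PolyExp.reg (N + 8)
  refine ⟨?_, fun s => ?_, 1, fun s => ?_⟩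
  · exact (((((PolyStore.id.updateOf (by omega) (R q)).updateOf (by omega)
      (.const _ [])).updateOf (by omega) (R (N + 1)).hd).updateOf (by omega)
      (R (N + 1)).tl.hd).updateOf (by omega) (.const _ [])).updateOf (by omega)
      (.const _ [true])
  · simp [record, show N ≠ q by omega]
  · have l1 := length_hd_add_tl (s (N + 1))
    have l2 := length_hd_add_tl (tl (s (N + 1)))
    set s₁ := Function.update s (N + 5) (s q) with hs₁
    set s₂ := Function.update s₁ q [] with hs₂
    set s₃ := Function.update s₂ (N + 6) (hd (s (N + 1))) with hs₃
    set s₄ := Function.update s₃ (N + 7) (hd (tl (s (N + 1)))) with hs₄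
    set s₅ := Function.update s₄ (N + 1) [] with hs₅
    have e1 := size_update (K := N + 8) (r := N + 5) (by omega) s (s q)
    have e2 := size_update (K := N + 8) (r := q) (by omega) s₁ []
    have e3 := size_update (K := N + 8) (r := N + 6) (by omega) s₂ (hd (s (N + 1)))
    have e4 := size_update (K := N + 8) (r := N + 7) (by omega) s₃ (hd (tl (s (N + 1))))
    have e5 := size_update (K := N + 8) (r := N + 1) (by omega) s₄ []
    have e6 := size_update (K := N + 8) (r := N + 3) (by omega) s₅ [true]
    have f1 : s₁ q = s q := Function.update_of_ne (by omega) _ _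
    have f2 : s₄ (N + 1) = s (N + 1) := by
      rw [hs₄, Function.update_of_ne (by omega), hs₃, Function.update_of_ne (by omega), hs₂,
        Function.update_of_ne (by omega), hs₁, Function.update_of_ne (by omega)]
    rw [← hs₁] at e1
    rw [f1, ← hs₂] at e2
    rw [← hs₃] at e3
    rw [← hs₄] at e4
    rw [f2, ← hs₅] at e5
    simp only [List.length_nil, List.length_singleton, Polynomial.eval_one] at *
    change size (N + 8) (Function.update s₅ (N + 3) [true]) ≤ _
    omega

theorem tame_nextAnswer {N a : ℕ} (ha : a < N) : Tame (N + 8) N (nextAnswer N a) := by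
  have R := PolyExp.reg (N + 8)
  refine ⟨?_, fun s => ?_, 0, fun s => ?_⟩
  · exact (((PolyStore.id.updateOf (by omega) (R (N + 1)).hd).updateOf (by omega)
      (R (N + 1)).tl.tl).updateOf (by omega) ((R (N + 2)).drop (R (N + 4))))
  · simp [nextAnswer, show N ≠ a by omega]
  · have l1 := length_hd_add_tl (s (N + 1))
    have l2 := length_hd_add_tl (tl (s (N + 1)))
    set s₁ := Function.update s a (hd (s (N + 1))) with hs₁
    set s₂ := Function.update s₁ (N + 1) (tl (tl (s (N + 1)))) with hs₂
    have e1 := size_update (K := N + 8) (r := a) (by omega) s (hd (s (N + 1)))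
    have e2 := size_update (K := N + 8) (r := N + 1) (by omega) s₁ (tl (tl (s (N + 1))))
    have e3 := size_update (K := N + 8) (r := N + 2) (by omega) s₂
      ((s (N + 2)).drop (s (N + 4)).length)
    have f1 : s₁ (N + 1) = s (N + 1) := Function.update_of_ne (by omega) _ _
    have f2 : s₂ (N + 2) = s (N + 2) := by
      rw [hs₂, Function.update_of_ne (by omega), hs₁, Function.update_of_ne (by omega)]
    rw [← hs₁] at e1
    rw [f1, ← hs₂] at e2
    rw [f2] at e3
    simp only [List.length_drop, Polynomial.eval_zero] at *
    change size (N + 8) (Function.update s₂ (N + 2) _) ≤ _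
    omega

theorem tame_selAns {N q a : ℕ} (hq : q < N) (ha : a < N) : Tame (N + 8) N (selAns N q a) := by
  have R := PolyExp.reg (N + 8)
  exact Tame.ite (PolyDec.eq (R (N + 3)) (PolyTime.const []))
    (Tame.ite (PolyDec.eq ((R (N + 2)).take (R (N + 4))) (R (N + 4))) (tame_nextAnswer ha)
      (tame_record hq)) Tame.id

/-- The side stacks of the simulation. -/
def selSide (N : ℕ) (clk h m c : Str) : Store := fun r =>
  if r = N then clk else if r = N + 1 then m else if r = N + 2 then c else
    if r = N + 4 then h else []

/-- The action of a query on the claimed answers and the random bits: it fails if the query is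
selected, or if the claimed answer is wrong. -/
def selStep (f : Str → Str) (h : Str) (z : Str) (θ : Str × Str) :
    (Str × Str) ⊕ Option (Str × Str × Str) :=
  if θ.2.take h.length = h then
    if hd θ.1 = f z then .inl (tl (tl θ.1), θ.2.drop h.length) else .inr none
  else .inr (some (z, hd θ.1, hd (tl θ.1)))

/-- The given query is selected in the store. -/
def Selected (N : ℕ) : Option (Str × Str × Str) → Store → Prop
  | none, _ => True
  | some p, s => s (N + 3) = [true] ∧ s (N + 5) = p.1 ∧ s (N + 6) = p.2.1 ∧ s (N + 7) = p.2.2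

/-- With the flag set, queries do nothing, and the program itself works below `N`. The recorded
query and the strings claimed for it thus survive the meaningless remainder of the simulation. -/
theorem sim_selAns_of_selected {N : ℕ} {c : Prog} (hc : width c ≤ N) {s : Store}
    (hs : s (N + 3) ≠ []) {r : ℕ} (hr : N ≤ r) : sim N (selAns N) c s r = s r := by
  induction c generalizing s r with
  | skip => rfl
  | push a b =>
    simp only [width] at hc
    exact Function.update_of_ne (by omega) _ _
  | pop a =>
    simp only [width] at hc
    exact Function.update_of_ne (by omega) _ _
  | seq c d ihc ihd =>
    simp only [width] at hc
    simp only [sim]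
    rw [ihd (by omega) (by rwa [ihc (by omega) hs (by omega)]) hr, ihc (by omega) hs hr]
  | branch a c d e ihc ihd ihe =>
    simp only [width] at hc
    simp only [sim]
    split_ifs
    · exact ihc (by omega) hs hr
    · exact ihe (by omega) hs hr
    · exact ihd (by omega) hs hr
  | loop a c ih =>
    simp only [width] at hc
    simp only [sim]
    generalize (s N).length = n
    induction n generalizing s with
    | zero => rfl
    | succ n ihn =>
      have h : ∀ r, N ≤ r → (if s a = [] then s else sim N (selAns N) c s) r = s r := by
        intro r hr
        split_ifs
        · rfl
        · exact ih (by omega) hs hr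
      rw [Function.iterate_succ_apply, ihn (by rwa [h _ (by omega)]), h r hr]
  | query q a => simp only [sim, selAns, if_neg hs]

theorem selected_sim {N : ℕ} (φ : Option (Str × Str × Str)) (c : Prog) (s : Store)
    (hc : width c ≤ N) (h : Selected N φ s) : Selected N φ (sim N (selAns N) c s) := by
  rcases φ with _ | p
  · trivial
  · have h3 : s (N + 3) ≠ [] := by rw [h.1]; simp
    have e : ∀ r, N ≤ r → sim N (selAns N) c s r = s r := fun r hr =>
      sim_selAns_of_selected hc h3 hr
    simpa [Selected, e] using h

/-- Of the two kinds of failure, a wrong answer leaves nothing to be shown: no statement about the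
later simulation is needed, since the reward is at most `1` anyway. -/
theorem follows_selAns {f : Str → Str} {N q a : ℕ} (clk h : Str) (s : Store) (hq : q < N)
    (ha : a < N) :
    Follows N (fun θ : Str × Str => selSide N clk h θ.1 θ.2) (selStep f h) (Selected N)
      (selAns N q a) s (Function.update s a (f (s q))) [s q] := by
  rintro ⟨m, c⟩
  have o : ∀ i, overlay N s (selSide N clk h m c) (N + i) = selSide N clk h m c (N + i) :=
    fun i => overlay_of_le (by omega) _ _
  simp only [consume, selStep]
  split_ifs with h1 h2
  · simp only [Sum.elim_inl, selAns, o, selSide]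
    simp [h1]
    funext r
    simp only [nextAnswer, o]
    by_cases r2 : r = N + 2
    · subst r2; simp [overlay, selSide]
    · by_cases r1 : r = N + 1
      · subst r1; simp [overlay, selSide]
      · by_cases ra : r = a
        · subst ra
          simp [overlay, selSide, r1, r2, ha, h2]
        · simp [overlay, selSide, r1, r2, ra]
  · trivial
  · simp only [Sum.elim_inr, selAns, o, selSide]
    simp [h1, Selected, record, show ¬ N + 5 = q by omega, overlay, selSide, hq]

/-- The final store of the simulation of `c` on input `v`. -/
def selSim (N : ℕ) (c : Prog) (v clk h m b : Str) : Store :=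
  sim N (selAns N) c (overlay N (initStore v) (selSide N clk h m b))

theorem polyTime_selSim {N : ℕ} {c : Prog} (hc : width c < N) {v clk h m b : Str → Str}
    (hv : PolyTime v) (hclk : PolyTime clk) (hh : PolyTime h) (hm : PolyTime m) (hb : PolyTime b)
    (r : ℕ) : PolyTime (fun x => selSim N c (v x) (clk x) (h x) (m x) (b x) r) := by
  have htame : Tame (N + 8) N (sim N (selAns N) c) :=
    tame_sim (N := N) (by omega) le_rfl (fun q a hq ha => tame_selAns hq ha) c (by omega)
  refine htame.toPolyStore.apply (G := fun x => overlay N (initStore (v x))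
    (selSide N (clk x) (h x) (m x) (b x))) (fun x r hr => ?_) (fun r => ?_) r
  · rw [overlay_of_le (by omega)]
    simp [selSide, show r ≠ N by omega, show r ≠ N + 1 by omega, show r ≠ N + 2 by omega,
      show r ≠ N + 4 by omega]
  · by_cases hr : r < N
    · by_cases h0 : r = 0
      · subst h0; simpa [overlay, hr, initStore] using hv
      · simpa [overlay, hr, initStore, h0] using PolyTime.const []
    · simp only [overlay, hr, selSide, if_false]
      split_ifs
      · exact hclk
      · exact hm
      · exact hb
      · exact hh
      · exact PolyTime.const []

/-- What the simulation does, in terms of the queries of the run with the oracle. -/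
theorem exists_queries {f : Str → Str} {N : ℕ} {c : Prog} (hc : width c < N) {v : Str} {s' : Store}
    {t n : ℕ} (hr : Runs f c (initStore v) s' t) (ht : t ≤ n) (h clk : Str) (hclk : n ≤ clk.length) :
    ∃ Z : List Str, Z.length ≤ n ∧ (∀ z ∈ Z, z.length < n) ∧ ∀ m b : Str,
      match consume (selStep f h) Z (m, b) with
      | .inl θ => selSim N c v clk h m b (N + 3) = [] ∧ selSim N c v clk h m b 0 = s' 0 ∧
          selSim N c v clk h m b (N + 2) = θ.2
      | .inr φ => Selected N φ (selSim N c v clk h m b) := by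
  obtain ⟨Z, h1, h2, h3⟩ := follows_of_runs (N := N) (k := N) (n₀ := clk.length)
    (ans := selAns N) (side := fun θ : Str × Str => selSide N clk h θ.1 θ.2)
    (step := selStep f h) (P := Selected N) le_rfl (fun _ => by simp [selSide])
    selected_sim (fun q a s hq ha _ => follows_selAns clk h s hq ha) hr (by omega) (by omega)
  refine ⟨Z, by omega, fun z hz => (h2 z hz).trans_le ht, fun m b => ?_⟩
  have h4 := h3 clk.length (by omega) (m, b)
  have h5 : simUpTo N (selAns N) clk.length c (overlay N (initStore v) (selSide N clk h m b)) =
      selSim N c v clk h m b := by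
    have := simUpTo_clock N (selAns N) c (overlay N (initStore v) (selSide N clk h m b))
    rw [overlay_of_le le_rfl] at this
    simpa [selSide, selSim] using this
  rw [h5] at h4
  rcases hθ : consume (selStep f h) Z (m, b) with θ | φ <;> rw [hθ] at h4
  · simp only at h4 ⊢
    rw [h4]
    refine ⟨?_, ?_, ?_⟩
    · rw [overlay_of_le (by omega)]; simp [selSide]
    · rw [overlay_of_lt (by omega)]
    · rw [overlay_of_le (by omega)]; simp [selSide]
  · exact h4

/-! ### Averages over fibers -/

/-- The tower property of conditional expectation; the weight of each fiber cancels against the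
normalisation of the inner average. -/
theorem expect_fiberwise {α β : Type*} [DecidableEq β] (S : Finset α) (h : α → β) (F : α → ℚ) :
    𝔼 r ∈ S, 𝔼 r' ∈ S.filter (fun r' => h r' = h r), F r' = 𝔼 r ∈ S, F r := by
  rw [Finset.expect_eq_sum_div_card, Finset.expect_eq_sum_div_card]
  congr 1
  rw [← Finset.sum_fiberwise_of_maps_to (s := S) (t := S.image h) (g := h)
    (fun x hx => Finset.mem_image_of_mem h hx),
    ← Finset.sum_fiberwise_of_maps_to (s := S) (t := S.image h) (g := h)
    (fun x hx => Finset.mem_image_of_mem h hx) F]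
  refine Finset.sum_congr rfl fun b hb => ?_
  have e : ∀ r ∈ S.filter (fun r => h r = b), 𝔼 r' ∈ S.filter (fun r' => h r' = h r), F r' =
      𝔼 r' ∈ S.filter (fun r' => h r' = b), F r' := by
    intro r hr
    rw [(Finset.mem_filter.1 hr).2]
  rw [Finset.sum_congr rfl e, Finset.sum_const, Finset.card_smul_expect]

/-! ### Strategies and rational play -/

namespace Protocol

variable {k : ℕ} (P : Protocol k)

/-- Arthur's message, if the random strings are `cs`. -/
def arthurOn (x : Str) (cs : List Str) (T : Transcript) (m : Str) : Str :=
  P.V (encodeTuple (x :: ((T.flatMap fun p => [p.1, p.2]) ++ m :: cs.take (T.length + 1))))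

/-- The reward, if the random strings are `cs`. -/
def rewardOn (x : Str) (cs : List Str) (T : Transcript) : ℚ :=
  P.R (encodeTuple (x :: ((T.map Prod.fst).zip cs).flatMap fun p => [p.1, p.2]))

/-- The transcript after `n` more rounds, if Merlin plays the strategy `σ`. -/
def play (x : Str) (σ : Transcript → Str) (cs : List Str) : ℕ → Transcript → Transcript
  | 0, T => T
  | n + 1, T => play x σ cs n (T ++ [(σ T, P.arthurOn x cs T (σ T))])

theorem play_succ (x : Str) (σ : Transcript → Str) (cs : List Str) (n : ℕ) (T : Transcript) :
    P.play x σ cs (n + 1) T = P.play x σ cs n T ++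
      [(σ (P.play x σ cs n T), P.arthurOn x cs (P.play x σ cs n T) (σ (P.play x σ cs n T)))] := by
  induction n generalizing T with
  | zero => rfl
  | succ n ih => rw [play, ih]; rfl

theorem length_play (x : Str) (σ : Transcript → Str) (cs : List Str) (n : ℕ) (T : Transcript) :
    (P.play x σ cs n T).length = T.length + n := by
  induction n generalizing T with
  | zero => rfl
  | succ n ih => rw [play, ih]; simp; omega

/-- The expected reward of the strategy `σ` after the transcript `T`, for `n` more rounds. -/
noncomputable def stratReward (x : Str) (σ : Transcript → Str) (n : ℕ) (T : Transcript) : ℚ :=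
  𝔼 r ∈ P.consistent x T,
    P.rewardOn x (P.coinStrings x r) (P.play x σ (P.coinStrings x r) n T)

theorem consistent_append (x : Str) (T : Transcript) (m a : Str) :
    P.consistent x (T ++ [(m, a)]) =
      (P.consistent x T).filter (fun r => P.arthur x r T m = a) := by
  classical
  ext r
  simp only [consistent, Finset.mem_filter, Finset.mem_univ, true_and]
  constructor
  · intro h
    constructor
    · intro i hi
      have := h i (by simp; omega)
      rwa [List.getElem_append_left hi, List.take_append_of_le_length hi.le] at this
    · have := h T.length (by simp)
      simpa using this.symm
  · rintro ⟨h1, h2⟩ i hi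
    rcases Nat.lt_or_ge i T.length with h | h
    · rw [List.getElem_append_left h, List.take_append_of_le_length h.le]
      exact h1 i h
    · obtain rfl : i = T.length := by simp at hi; omega
      simp [h2]

theorem consistent_nil (x : Str) : P.consistent x [] = Finset.univ := by
  simp [consistent]

/-- The tower property, applied to the partition of the consistent random strings by Arthur's next
message. -/
theorem stratReward_succ (x : Str) (σ : Transcript → Str) (n : ℕ) (T : Transcript) :
    P.stratReward x σ (n + 1) T = 𝔼 r ∈ P.consistent x T,
      P.stratReward x σ n (T ++ [(σ T, P.arthur x r T (σ T))]) := by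
  classical
  rw [stratReward, ← expect_fiberwise _ (fun r => P.arthur x r T (σ T))]
  refine Finset.expect_congr rfl fun r _ => ?_
  rw [stratReward, consistent_append]
  refine Finset.expect_congr rfl fun r' hr' => ?_
  rw [← (Finset.mem_filter.1 hr').2]
  rfl

theorem optReward_succ (x : Str) (T : Transcript) (n : ℕ) (hn : T.length + (n + 1) = k) :
    P.optReward x (n + 1) T =
      (P.messages x).sup' (P.messages_nonempty x) fun m => P.msgReward x T m := by
  have : k - (T.length + 1) = n := by omega
  simp only [optReward, msgReward, this]

/-- A fixed strategy uses one admissible message where the recursion for `optReward` takes the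
maximum. -/
theorem stratReward_le (x : Str) {σ : Transcript → Str} (hσ : ∀ T, σ T ∈ P.messages x) (n : ℕ)
    (T : Transcript) : P.stratReward x σ n T ≤ P.optReward x n T := by
  induction n generalizing T with
  | zero => exact le_rfl
  | succ n ih =>
    rw [stratReward_succ, optReward]
    exact (Finset.expect_le_expect fun r _ => ih _).trans
      (Finset.le_sup' (fun m => 𝔼 r ∈ P.consistent x T,
        P.optReward x n (T ++ [(m, P.arthur x r T m)])) (hσ T))

theorem stratReward_le_msgReward (x : Str) {σ : Transcript → Str}
    (hσ : ∀ T, σ T ∈ P.messages x) (n : ℕ) (T : Transcript) (hn : T.length + (n + 1) = k) :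
    P.stratReward x σ (n + 1) T ≤ P.msgReward x T (σ T) := by
  have : k - (T.length + 1) = n := by omega
  rw [stratReward_succ, msgReward, this]
  exact Finset.expect_le_expect fun r _ => P.stratReward_le x hσ n _

theorem optReward_eq_msgReward (x : Str) (T : Transcript) (n : ℕ) (hn : T.length + (n + 1) = k)
    {m : Str} (hm : P.IsRational x T m) : P.optReward x (n + 1) T = P.msgReward x T m := by
  rw [P.optReward_succ x T n hn]
  exact le_antisymm (Finset.sup'_le _ _ hm.2) (Finset.le_sup' (P.msgReward x T) hm.1)

theorem stratReward_eq (x : Str) {σ : Transcript → Str} (n : ℕ) (T : Transcript)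
    (hn : T.length + n = k) (hσ : ∀ T', T.length ≤ T'.length → P.IsRational x T' (σ T')) :
    P.stratReward x σ n T = P.optReward x n T := by
  induction n generalizing T with
  | zero => rfl
  | succ n ih =>
    have h : k - (T.length + 1) = n := by omega
    rw [stratReward_succ, P.optReward_eq_msgReward x T n hn (hσ T le_rfl), msgReward, h]
    refine Finset.expect_congr rfl fun r _ => ih _ (by simp; omega) fun T' hT' => hσ T' ?_
    simp at hT'
    omega

/-- The converse of `stratReward_eq`, along all plays that can occur: an optimal total leaves no
room for a loss anywhere. `msgReward` is squeezed between the reward of the strategy and the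
optimum, and equality of two averages of comparable terms forces equality for every consistent
outcome, each of which has positive weight. -/
theorem isRational_of_stratReward_eq (x : Str) {σ : Transcript → Str}
    (hσ : ∀ T, σ T ∈ P.messages x) (n : ℕ) (T : Transcript) (hn : T.length + n = k)
    (h : P.stratReward x σ n T = P.optReward x n T) (r : P.Coins x) (hr : r ∈ P.consistent x T)
    (i : ℕ) (hi : i < n) :
    P.IsRational x (P.play x σ (P.coinStrings x r) i T) (σ (P.play x σ (P.coinStrings x r) i T)) := by
  induction n generalizing T i with
  | zero => omega
  | succ n ih =>
    have hk : k - (T.length + 1) = n := by omega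
    have h1 := P.stratReward_le_msgReward x hσ n T hn
    have h2 : P.msgReward x T (σ T) ≤ P.optReward x (n + 1) T := by
      rw [P.optReward_succ x T n hn]
      exact Finset.le_sup' (P.msgReward x T) (hσ T)
    have h3 : P.msgReward x T (σ T) = P.optReward x (n + 1) T := le_antisymm h2 (h ▸ h1)
    cases i with
    | zero =>
      refine ⟨hσ T, fun m' hm' => ?_⟩
      rw [play, h3, P.optReward_succ x T n hn]
      exact Finset.le_sup' (P.msgReward x T) hm'
    | succ i =>
      have h4 : P.stratReward x σ (n + 1) T = P.msgReward x T (σ T) := h.trans h3.symm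
      rw [stratReward_succ, msgReward, hk, Finset.expect_eq_sum_div_card,
        Finset.expect_eq_sum_div_card] at h4
      have hc : ((P.consistent x T).card : ℚ) ≠ 0 := by
        rw [Nat.cast_ne_zero]
        exact Finset.card_ne_zero_of_mem hr
      rw [div_left_inj' hc] at h4
      -- The continuation is optimal after every answer of Arthur that is possible, so the induction
      -- can descend along `r`.
      have h5 := (Finset.sum_eq_sum_iff_of_le fun r _ => P.stratReward_le x hσ n _).1 h4 r hr
      exact ih (T ++ [(σ T, P.arthur x r T (σ T))]) (by simp; omega) h5
        (by rw [consistent_append]; exact Finset.mem_filter.2 ⟨hr, rfl⟩) i (by omega)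

theorem exists_isRational (x : Str) (T : Transcript) : ∃ m, P.IsRational x T m :=
  Finset.exists_max_image _ _ (P.messages_nonempty x)

theorem transcript_append (x : Str) (r : P.Coins x) (ms : List Str) (m : Str) :
    P.transcript x r (ms ++ [m]) = P.transcript x r ms ++
      [(m, P.arthur x r (P.transcript x r ms) m)] := by
  simp [transcript]

theorem transcript_play (x : Str) (r : P.Coins x) (σ : Transcript → Str) (n : ℕ) :
    P.transcript x r ((P.play x σ (P.coinStrings x r) n []).map Prod.fst) =
      P.play x σ (P.coinStrings x r) n [] := by
  induction n with
  | zero => rfl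
  | succ n ih =>
    rw [play_succ, List.map_append, List.map_singleton, transcript_append, ih]
    rfl

theorem take_play (x : Str) (cs : List Str) (σ : Transcript → Str) {i n : ℕ} (h : i ≤ n) :
    (P.play x σ cs n []).take i = P.play x σ cs i [] := by
  induction n with
  | zero => obtain rfl : i = 0 := by omega
            rfl
  | succ n ih =>
    rcases Nat.lt_or_ge n i with h' | h'
    · obtain rfl : i = n + 1 := by omega
      rw [List.take_of_length_le]
      rw [length_play]; simp
    · rw [play_succ, List.take_append_of_le_length (by rw [length_play]; simpa using h'), ih h']

/-- Translates the definition of a computed function from lists of messages to strategies;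
rationality is required only at the transcripts of the play. -/
theorem Computes.value_play {f : Str → Str} (hf : P.Computes f) (x : Str) (σ : Transcript → Str)
    (r : P.Coins x) (h : ∀ i < k, P.IsRational x (P.play x σ (P.coinStrings x r) i [])
      (σ (P.play x σ (P.coinStrings x r) i []))) :
    P.value x (P.play x σ (P.coinStrings x r) k []) = f x := by
  rw [← P.transcript_play x r σ k]
  refine hf x r _ ⟨by rw [List.length_map, length_play]; simp, fun i hi => ?_⟩
  rw [List.length_map, length_play, List.length_nil, zero_add] at hi
  have h1 := h i hi
  have h2 : ((P.play x σ (P.coinStrings x r) k []).map Prod.fst).take (i + 1) =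
      (P.play x σ (P.coinStrings x r) (i + 1) []).map Prod.fst := by
    rw [← List.map_take, take_play _ _ _ _ hi]
  rw [← List.map_take, take_play _ _ _ _ hi.le, transcript_play]
  convert h1
  have h3 : ((P.play x σ (P.coinStrings x r) k []).map Prod.fst)[i]? =
      some (σ (P.play x σ (P.coinStrings x r) i [])) := by
    rw [← List.getElem?_take_of_lt (Nat.lt_succ_self i), h2, play_succ]
    simp [length_play]
  exact Option.some.inj ((List.getElem?_eq_getElem _).symm.trans h3)

/-- There is an optimal strategy, and it leads to the computed value. -/
theorem Computes.exists_strategy {f : Str → Str} (hf : P.Computes f) (x : Str) :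
    ∃ σ : Transcript → Str, (∀ T, σ T ∈ P.messages x) ∧
      P.stratReward x σ k [] = P.optReward x k [] ∧
      ∀ r, P.value x (P.play x σ (P.coinStrings x r) k []) = f x := by
  choose σ hσ using P.exists_isRational x
  exact ⟨σ, fun T => (hσ T).1, P.stratReward_eq x k [] (by simp) fun T _ => hσ T,
    fun r => hf.value_play P x σ r fun i _ => hσ _⟩

theorem Computes.value_of_stratReward_eq {f : Str → Str} (hf : P.Computes f) (x : Str)
    {σ : Transcript → Str} (hσ : ∀ T, σ T ∈ P.messages x)
    (h : P.stratReward x σ k [] = P.optReward x k []) (r : P.Coins x) :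
    P.value x (P.play x σ (P.coinStrings x r) k []) = f x :=
  hf.value_play P x σ r (P.isRational_of_stratReward_eq x hσ k [] (by simp) h r
    (by simp [consistent_nil]))

/-- The reward of the first message is the reward of some strategy that starts with it. -/
theorem exists_strategy_msgReward {P : Protocol (k + 1)} {x m : Str} (hm : m ∈ P.messages x) :
    ∃ σ : Transcript → Str, (∀ T, σ T ∈ P.messages x) ∧ σ [] = m ∧
      P.stratReward x σ (k + 1) [] = P.msgReward x [] m := by
  classical
  choose τ hτ using P.exists_isRational x
  refine ⟨Function.update τ [] m, fun T => ?_, by simp, ?_⟩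
  · by_cases hT : T = []
    · subst hT; simpa using hm
    · rw [Function.update_of_ne hT]; exact (hτ T).1
  · have : k + 1 - (List.length (α := Str × Str) [] + 1) = k := by simp
    rw [stratReward_succ, msgReward, this]
    refine Finset.expect_congr rfl fun r _ => ?_
    rw [Function.update_self]
    refine P.stratReward_eq x k _ (by simp; omega) fun T hT => ?_
    rw [Function.update_of_ne (by rintro rfl; simp at hT)]
    exact hτ T

end Protocol

/-! ### Averages over random strings -/

/-- The average over the strings of length `n`. -/
def avg : ℕ → (Str → ℚ) → ℚ
  | 0, F => F []
  | n + 1, F => (avg n (fun c => F (true :: c)) + avg n (fun c => F (false :: c))) / 2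

/-- The average over `k` strings of length `l`. -/
def avgs (l : ℕ) : ℕ → (List Str → ℚ) → ℚ
  | 0, F => F []
  | k + 1, F => avg l fun c => avgs l k fun cs => F (c :: cs)

theorem avg_mono {n : ℕ} {F G : Str → ℚ} (h : ∀ c, c.length = n → F c ≤ G c) :
    avg n F ≤ avg n G := by
  induction n generalizing F G with
  | zero => exact h [] rfl
  | succ n ih =>
    have h1 := ih (F := fun c => F (true :: c)) (G := fun c => G (true :: c))
      fun c hc => h _ (by simp [hc])
    have h2 := ih (F := fun c => F (false :: c)) (G := fun c => G (false :: c))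
      fun c hc => h _ (by simp [hc])
    simp only [avg]
    linarith

theorem avg_congr {n : ℕ} {F G : Str → ℚ} (h : ∀ c, c.length = n → F c = G c) :
    avg n F = avg n G :=
  le_antisymm (avg_mono fun c hc => (h c hc).le) (avg_mono fun c hc => (h c hc).ge)

theorem avg_const (n : ℕ) (a : ℚ) : avg n (fun _ => a) = a := by
  induction n with
  | zero => rfl
  | succ n ih => simp [avg, ih]

theorem avg_add_mul (n : ℕ) (F G : Str → ℚ) (b : ℚ) :
    avg n (fun c => F c + b * G c) = avg n F + b * avg n G := by
  induction n generalizing F G with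
  | zero => rfl
  | succ n ih =>
    simp only [avg, ih]
    ring

theorem avg_append (m n : ℕ) (F : Str → ℚ) :
    avg (m + n) F = avg m fun u => avg n fun v => F (u ++ v) := by
  induction m generalizing F with
  | zero => simp [avg]
  | succ m ih =>
    rw [Nat.succ_add]
    simp only [avg, ih]
    rfl

theorem avg_take {m n : ℕ} (h : m ≤ n) (F : Str → ℚ) : avg n (fun c => F (c.take m)) = avg m F := by
  obtain ⟨d, rfl⟩ := Nat.exists_eq_add_of_le h
  rw [avg_append]
  refine avg_congr fun u hu => ?_
  rw [← avg_const d (F u)]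
  refine avg_congr fun v _ => ?_
  rw [List.take_append_of_le_length hu.ge, List.take_of_length_le hu.le]

/-- The law of a selection: a block of `n` random bits equals a given string `u` with probability
`2⁻ⁿ`. -/
theorem avg_ite_eq (n : ℕ) (u : Str) (hu : u.length = n) (A B : ℚ) :
    avg n (fun c => if c = u then A else B) = (1 - 1 / 2 ^ n) * B + 1 / 2 ^ n * A := by
  induction n generalizing u with
  | zero => simp [avg, List.length_eq_zero_iff.1 hu]
  | succ n ih =>
    rcases u with _ | ⟨b, u⟩
    · simp at hu
    · have h1 := ih u (by simpa using hu)
      cases b <;> simp [avg, avg_const, h1, pow_succ] <;> ring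

theorem avgs_mono {l k : ℕ} {F G : List Str → ℚ}
    (h : ∀ cs : List Str, cs.length = k → F cs ≤ G cs) : avgs l k F ≤ avgs l k G := by
  induction k generalizing F G with
  | zero => exact h [] rfl
  | succ k ih => exact avg_mono fun c _ => ih fun cs hcs => h _ (by simp [hcs])

theorem avgs_congr {l k : ℕ} {F G : List Str → ℚ}
    (h : ∀ cs : List Str, cs.length = k → F cs = G cs) : avgs l k F = avgs l k G :=
  le_antisymm (avgs_mono fun c hc => (h c hc).le) (avgs_mono fun c hc => (h c hc).ge)

theorem avgs_const (l k : ℕ) (a : ℚ) : avgs l k (fun _ => a) = a := by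
  induction k with
  | zero => rfl
  | succ k ih => simp only [avgs, ih, avg_const]

/-- Prefixes of uniform strings are uniform. Random strings longer than a protocol needs can thus be
used for it. -/
theorem avgs_map_take {m n : ℕ} (h : m ≤ n) (k : ℕ) (F : List Str → ℚ) :
    avgs n k (fun cs => F (cs.map (List.take m))) = avgs m k F := by
  induction k generalizing F with
  | zero => rfl
  | succ k ih =>
    simp only [avgs, List.map_cons]
    rw [← avg_take h]
    exact avg_congr fun c _ => ih fun cs => F (c.take m :: cs)

theorem expect_cons {α : Type*} [Fintype α] (n : ℕ) (G : (Fin (n + 1) → α) → ℚ) :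
    𝔼 v, G v = 𝔼 a : α, 𝔼 v : Fin n → α, G (Fin.cons a v) := by
  rw [← Fintype.expect_equiv (Fin.consEquiv fun _ => α) (fun p => G (Fin.cons p.1 p.2)) G
    fun p => rfl, ← Finset.univ_product_univ, Finset.expect_product]

theorem expect_ofFn (n : ℕ) (F : Str → ℚ) : 𝔼 v : Fin n → Bool, F (List.ofFn v) = avg n F := by
  induction n generalizing F with
  | zero =>
    rw [Fintype.expect_eq_sum_div_card]
    simp [avg]
  | succ n ih =>
    rw [expect_cons, Fintype.expect_eq_sum_div_card]
    simp [avg, List.ofFn_succ, ← ih]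

theorem expect_ofFn_ofFn (l k : ℕ) (F : List Str → ℚ) :
    𝔼 r : Fin k → Fin l → Bool, F (List.ofFn fun i => List.ofFn (r i)) = avgs l k F := by
  induction k generalizing F with
  | zero =>
    rw [Fintype.expect_eq_sum_div_card]
    simp [avgs]
  | succ k ih =>
    rw [expect_cons, avgs, ← expect_ofFn]
    simp [List.ofFn_succ, ← ih]

/-! ### Dyadic fractions -/

theorem binFrac_dyadic (w : Str) {n : ℕ} (h : w.length ≤ n) : ∃ a : ℤ, binFrac w = a / 2 ^ n := by
  induction w generalizing n with
  | nil => exact ⟨0, by simp [binFrac]⟩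
  | cons b w ih =>
    obtain ⟨n, rfl⟩ := Nat.exists_eq_succ_of_ne_zero (n := n) (by rintro rfl; simp at h)
    obtain ⟨a, ha⟩ := ih (n := n) (by simpa using h)
    refine ⟨(if b then 2 ^ (n + 1) else 0) + a, ?_⟩
    rw [binFrac, ha]
    cases b
    · simp [pow_succ]; field_simp
    · simp [pow_succ]; field_simp

theorem sum_dyadic {α : Type*} (S : Finset α) (F : α → ℚ) (n : ℕ)
    (h : ∀ i, ∃ a : ℤ, F i = a / 2 ^ n) : ∃ a : ℤ, ∑ i ∈ S, F i = a / 2 ^ n := by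
  choose a ha using h
  exact ⟨∑ i ∈ S, a i, by simp [ha, Finset.sum_div]⟩

/-- The numerators are integers, so they differ by at least `1`. -/
theorem dyadic_gap {p q : ℚ} {n : ℕ} (hp : ∃ a : ℤ, p = a / 2 ^ n) (hq : ∃ a : ℤ, q = a / 2 ^ n)
    (h : p < q) : p ≤ q - 1 / 2 ^ n := by
  obtain ⟨a, rfl⟩ := hp
  obtain ⟨b, rfl⟩ := hq
  have h2 : (0 : ℚ) < 2 ^ n := by positivity
  rw [div_lt_div_iff_of_pos_right h2] at h
  have h3 : a + 1 ≤ b := by exact_mod_cast h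
  have h4 : (a : ℚ) + 1 ≤ b := by exact_mod_cast h3
  rw [← sub_div, div_le_div_iff_of_pos_right h2]
  linarith

/-! ### Bounds for the strings of a protocol -/

theorem length_encodeTuple_le {l : List Str} {B : ℕ} (h : ∀ w ∈ l, w.length ≤ B) :
    (encodeTuple l).length ≤ l.length * (2 * B + 1) := by
  induction l with
  | nil => simp
  | cons w l ih =>
    have h1 := h w (by simp)
    have h2 := ih fun w hw => h w (by simp [hw])
    simp only [encodeTuple_cons, List.length_append, length_encodeItem, List.length_cons,
      add_one_mul]
    omega

namespace Protocol

variable {k : ℕ} (P : Protocol k)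

theorem mem_messages {x m : Str} : m ∈ P.messages x ↔ m.length ≤ P.msgLen.eval x.length := by
  simp [messages]

theorem length_of_mem_coinStrings {x : Str} {r : P.Coins x} {c : Str}
    (h : c ∈ P.coinStrings x r) : c.length = P.coinLen.eval x.length := by
  obtain ⟨i, rfl⟩ := (List.mem_ofFn' _ _).1 h
  simp

theorem length_coinStrings (x : Str) (r : P.Coins x) : (P.coinStrings x r).length = k := by
  simp [coinStrings]

/-- Messages in a play have polynomially bounded length. -/
theorem exists_length_play_le (j : ℕ) : ∃ b : Polynomial ℕ, ∀ (x : Str) (r : P.Coins x)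
    (σ : Transcript → Str), (∀ T, σ T ∈ P.messages x) →
    ∀ q ∈ P.play x σ (P.coinStrings x r) j [],
      q.1.length ≤ b.eval x.length ∧ q.2.length ≤ b.eval x.length := by
  obtain ⟨v, hv⟩ := P.V_polyTime.exists_length_le
  induction j with
  | zero => exact ⟨0, fun x r σ hσ q hq => by simp [play] at hq⟩
  | succ j ih =>
    obtain ⟨b, hb⟩ := ih
    -- The argument of `V` has at most `2 * j + 2 + k` components: the input, `j` full rounds, the
    -- new message and at most `k` random strings.
    refine ⟨b + P.msgLen + v.comp (Polynomial.C (2 * j + 2 + k) *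
      (2 * (Polynomial.X + b + P.msgLen + P.coinLen) + 1)), fun x r σ hσ q hq => ?_⟩
    rw [play_succ] at hq
    have hb' := hb x r σ hσ
    set T := P.play x σ (P.coinStrings x r) j [] with hT
    have hm := P.mem_messages.1 (hσ T)
    simp only [Polynomial.eval_add, Polynomial.eval_comp, Polynomial.eval_mul, Polynomial.eval_C,
      Polynomial.eval_X, Polynomial.eval_one, Polynomial.eval_ofNat]
    rcases List.mem_append.1 hq with hq | hq
    · have := hb' q hq
      omega
    · obtain rfl := List.mem_singleton.1 hq
      refine ⟨by dsimp only; omega, ?_⟩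
      dsimp only [arthurOn]
      refine (hv _).trans ((eval_mono v ?_).trans (Nat.le_add_left _ _))
      refine (length_encodeTuple_le (B := x.length + b.eval x.length + P.msgLen.eval x.length +
        P.coinLen.eval x.length) ?_).trans (Nat.mul_le_mul_right _ ?_)
      · intro w hw
        simp only [List.mem_cons, List.mem_append, List.mem_flatMap] at hw
        rcases hw with rfl | ⟨q, hq, hw⟩ | rfl | hw
        · omega
        · have := hb' q hq
          simp at hw
          rcases hw with rfl | rfl <;> omega
        · omega
        · have := P.length_of_mem_coinStrings (List.mem_of_mem_take hw)
          omega
      · have h1 : (T.flatMap fun p => [p.1, p.2]).length = 2 * j := by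
          have : T.length = j := by rw [hT, length_play]; simp
          rw [← this]
          clear_value T
          clear hT hb' hm hq this
          induction T with
          | nil => rfl
          | cons p T ih => simp [ih]; omega
        simp only [List.length_cons, List.length_append, h1, List.length_take, length_coinStrings]
        omega

/-- Functions computed by protocols have polynomially bounded values. -/
theorem Computes.exists_length_le {P : Protocol k} {f : Str → Str} (hf : P.Computes f) :
    ∃ p : Polynomial ℕ, ∀ x, (f x).length ≤ p.eval x.length := by
  obtain ⟨v, hv⟩ := P.φ_polyTime.exists_length_le
  obtain ⟨b, hb⟩ := P.exists_length_play_le k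
  refine ⟨v.comp (Polynomial.C (2 * k + 1) * (2 * (Polynomial.X + b) + 1)), fun x => ?_⟩
  obtain ⟨σ, hσ, -, h⟩ := hf.exists_strategy P x
  let r : P.Coins x := fun _ _ => false
  rw [← h r, value, Polynomial.eval_comp]
  refine (hv _).trans (eval_mono v ?_)
  have hb' := hb x r σ hσ
  simp only [Polynomial.eval_add, Polynomial.eval_mul, Polynomial.eval_C,
      Polynomial.eval_X, Polynomial.eval_one, Polynomial.eval_ofNat]
  refine (length_encodeTuple_le (B := x.length + b.eval x.length) ?_).trans
    (Nat.mul_le_mul_right _ ?_)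
  · intro w hw
    rcases List.mem_cons.1 hw with rfl | hw
    · omega
    · obtain ⟨q, hq, hw⟩ := List.mem_flatMap.1 (List.mem_of_mem_dropLast hw)
      have := hb' q hq
      simp at hw
      rcases hw with rfl | rfl <;> omega
  · have : ∀ T : Transcript, (T.flatMap fun p => [p.1, p.2]).length = 2 * T.length := by
      intro T
      induction T with
      | nil => rfl
      | cons p T ih => simp [ih]; omega
    simp only [List.length_cons, List.length_dropLast, this, length_play, List.length_nil]
    omega

/-- The rewards in a play are dyadic fractions with polynomially many digits. -/
theorem exists_rewardOn_dyadic : ∃ h : Polynomial ℕ, ∀ (x : Str) (r : P.Coins x)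
    (σ : Transcript → Str), (∀ T, σ T ∈ P.messages x) →
    ∃ a : ℤ, P.rewardOn x (P.coinStrings x r) (P.play x σ (P.coinStrings x r) k []) =
      a / 2 ^ h.eval x.length := by
  obtain ⟨ρ, hρ, hR⟩ := P.R_polyTime
  obtain ⟨v, hv⟩ := hρ.exists_length_le
  obtain ⟨b, hb⟩ := P.exists_length_play_le k
  refine ⟨v.comp (Polynomial.C (2 * k + 1) * (2 * (Polynomial.X + b + P.coinLen) + 1)),
    fun x r σ hσ => ?_⟩
  rw [rewardOn, hR, Polynomial.eval_comp]
  refine binFrac_dyadic _ ((hv _).trans (eval_mono v ?_))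
  have hb' := hb x r σ hσ
  simp only [Polynomial.eval_add, Polynomial.eval_mul, Polynomial.eval_C,
      Polynomial.eval_X, Polynomial.eval_one, Polynomial.eval_ofNat]
  refine (length_encodeTuple_le (B := x.length + b.eval x.length + P.coinLen.eval x.length) ?_).trans
    (Nat.mul_le_mul_right _ ?_)
  · intro w hw
    rcases List.mem_cons.1 hw with rfl | hw
    · omega
    · obtain ⟨q, hq, hw⟩ := List.mem_flatMap.1 hw
      have h1 := List.of_mem_zip hq
      obtain ⟨q', hq', h2⟩ := List.mem_map.1 h1.1
      have h3 := hb' q' hq'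
      have h4 := P.length_of_mem_coinStrings h1.2
      rw [h2] at h3
      simp at hw
      rcases hw with rfl | rfl <;> omega
  · have : ∀ T : List (Str × Str), (T.flatMap fun p => [p.1, p.2]).length = 2 * T.length := by
      intro T
      induction T with
      | nil => rfl
      | cons p T ih => simp [ih]; omega
    simp only [List.length_cons, this, length_play, List.length_nil, List.length_zip,
      List.length_map, length_coinStrings]
    omega

theorem stratReward_nil (x : Str) (σ : Transcript → Str) (n : ℕ) :
    P.stratReward x σ n [] = avgs (P.coinLen.eval x.length) k
      fun cs => P.rewardOn x cs (P.play x σ cs n []) := by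
  rw [stratReward, consistent_nil, ← expect_ofFn_ofFn]
  rfl

theorem exists_stratReward_dyadic : ∃ h : Polynomial ℕ, ∀ (x : Str) (σ : Transcript → Str),
    (∀ T, σ T ∈ P.messages x) → ∃ a : ℤ, P.stratReward x σ k [] = a / 2 ^ h.eval x.length := by
  obtain ⟨h, hh⟩ := P.exists_rewardOn_dyadic
  -- Averaging over `2 ^ (coinLen * k)` outcomes adds that many binary digits.
  refine ⟨h + P.coinLen * Polynomial.C k, fun x σ hσ => ?_⟩
  obtain ⟨a, ha⟩ := sum_dyadic Finset.univ _ _ fun r => hh x r σ hσ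
  refine ⟨a, ?_⟩
  rw [stratReward, consistent_nil, Fintype.expect_eq_sum_div_card, ha]
  simp [pow_add, pow_mul, div_div]

/-- The reward, shifted to be at least `1/2`, if the value is the claimed one. -/
def checkedReward (x w : Str) (cs : List Str) (T : Transcript) : ℚ :=
  if P.value x T = w then 1 / 2 + P.rewardOn x cs T / 4 else 0

/-- The best expected checked reward is achieved for the right claim, and for a wrong claim it is
smaller by a certain amount. -/
theorem Computes.exists_checkedReward {P : Protocol k} {f : Str → Str} (hf : P.Computes f) :
    ∃ h : Polynomial ℕ, ∀ x, ∃ D : ℚ, 0 ≤ D ∧ D ≤ 1 ∧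
      (∃ σ : Transcript → Str, (∀ T, σ T ∈ P.messages x) ∧
        avgs (P.coinLen.eval x.length) k
          (fun cs => P.checkedReward x (f x) cs (P.play x σ cs k [])) = D) ∧
      ∀ (σ : Transcript → Str) (w : Str), (∀ T, σ T ∈ P.messages x) →
        avgs (P.coinLen.eval x.length) k
          (fun cs => P.checkedReward x w cs (P.play x σ cs k [])) ≤
            D - if w = f x then 0 else 1 / 2 ^ h.eval x.length := by
  obtain ⟨h, hh⟩ := P.exists_stratReward_dyadic
  -- Two more digits, because the reward of the protocol enters with the factor `1/4`.
  refine ⟨h + 2, fun x => ?_⟩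
  obtain ⟨σ₀, hσ₀, hopt, hval⟩ := hf.exists_strategy P x
  have e1 : ∀ σ : Transcript → Str, 𝔼 r : P.Coins x, (1 / 2 +
      P.rewardOn x (P.coinStrings x r) (P.play x σ (P.coinStrings x r) k []) / 4) =
      1 / 2 + P.stratReward x σ k [] / 4 := by
    intro σ
    rw [Finset.expect_add_distrib, Finset.expect_const Finset.univ_nonempty, ← Finset.expect_div,
      stratReward, consistent_nil]
  have R0 : ∀ (cs : List Str) T, 0 ≤ P.rewardOn x cs T := fun cs T => (P.R_mem _).1
  -- The shifted reward is nonnegative, so omitting the check can only raise it.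
  have hle : ∀ σ : Transcript → Str, ∀ w, avgs (P.coinLen.eval x.length) k
      (fun cs => P.checkedReward x w cs (P.play x σ cs k [])) ≤
      1 / 2 + P.stratReward x σ k [] / 4 := by
    intro σ w
    rw [← e1, ← expect_ofFn_ofFn]
    refine Finset.expect_le_expect fun r _ => ?_
    unfold checkedReward
    split_ifs
    · exact le_rfl
    · have := R0 (P.coinStrings x r) (P.play x σ (P.coinStrings x r) k [])
      positivity
  have hs0 : 0 ≤ P.stratReward x σ₀ k [] := Finset.expect_nonneg fun r _ => R0 _ _
  have hs1 : P.stratReward x σ₀ k [] ≤ 1 := by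
    rw [stratReward, consistent_nil]
    exact Finset.expect_le Finset.univ_nonempty fun r _ => (P.R_mem _).2
  refine ⟨1 / 2 + P.stratReward x σ₀ k [] / 4, by linarith, by linarith, ⟨σ₀, hσ₀, ?_⟩, ?_⟩
  · rw [← e1, ← expect_ofFn_ofFn]
    exact Finset.expect_congr rfl fun r _ => if_pos (hval r)
  · intro σ w hσ
    have h1 := P.stratReward_le x hσ k []
    rw [← hopt] at h1
    have h2 := hle σ w
    split_ifs with hw
    · linarith
    -- Either the strategy is optimal, so that the value is always `f x`, the wrong claim never
    -- passes the check and at least `1/2` is lost; or it is suboptimal and loses the dyadic gap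
    -- whatever the claim.
    · rcases h1.eq_or_lt with h3 | h3
      · have h4 : avgs (P.coinLen.eval x.length) k
            (fun cs => P.checkedReward x w cs (P.play x σ cs k [])) = 0 := by
          rw [← expect_ofFn_ofFn]
          refine Finset.expect_eq_zero fun r _ => if_neg ?_
          intro h5
          have := hf.value_of_stratReward_eq P x hσ (h3.trans hopt) r
          exact hw (h5.symm.trans this)
        have h5 : (1 : ℚ) / 2 ^ (h + 2).eval x.length ≤ 1 / 2 := by
          apply one_div_le_one_div_of_le (by norm_num)
          calc (2 : ℚ) = 2 ^ 1 := by norm_num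
            _ ≤ _ := pow_le_pow_right₀ (by norm_num) (by simp)
        rw [h4]
        linarith
      · have h4 := dyadic_gap (hh x σ hσ) (hh x σ₀ hσ₀) h3
        have h5 : (1 : ℚ) / 2 ^ (h + 2).eval x.length = 1 / 2 ^ h.eval x.length / 4 := by
          simp [pow_add]
          ring
        rw [h5]
        linarith

end Protocol

/-! ### Transcripts as functions of messages and random strings -/

namespace Protocol

variable {k : ℕ} (Q : Protocol k)

/-- The transcript if Merlin sends `ms` and Arthur's random strings are `cs`. -/
def transcriptOn (x : Str) (cs : List Str) (ms : List Str) : Transcript :=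
  ms.foldl (fun T m => T ++ [(m, Q.arthurOn x cs T m)]) []

theorem transcriptOn_append (x : Str) (cs ms : List Str) (m : Str) :
    Q.transcriptOn x cs (ms ++ [m]) = Q.transcriptOn x cs ms ++
      [(m, Q.arthurOn x cs (Q.transcriptOn x cs ms) m)] := by
  simp [transcriptOn]

theorem map_fst_transcriptOn (x : Str) (cs ms : List Str) :
    (Q.transcriptOn x cs ms).map Prod.fst = ms := by
  induction ms using List.reverseRecOn with
  | nil => rfl
  | append_singleton ms m ih => rw [transcriptOn_append, List.map_append, ih]; rfl

theorem length_transcriptOn (x : Str) (cs ms : List Str) :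
    (Q.transcriptOn x cs ms).length = ms.length := by
  rw [← List.length_map (f := Prod.fst), map_fst_transcriptOn]

/-- Arthur's answers use the random strings only up to the current round. Later, unplayed rounds do
not affect a partial transcript. -/
theorem transcriptOn_take (x : Str) (cs ms : List Str) {n : ℕ} (h : ms.length ≤ n) :
    Q.transcriptOn x (cs.take n) ms = Q.transcriptOn x cs ms := by
  induction ms using List.reverseRecOn with
  | nil => rfl
  | append_singleton ms m ih =>
    rw [List.length_append, List.length_singleton] at h
    rw [transcriptOn_append, transcriptOn_append, ih (by omega), arthurOn, arthurOn,
      List.take_take, length_transcriptOn, min_eq_left h]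

theorem transcriptOn_play (x : Str) (cs : List Str) (σ : Transcript → Str) (n : ℕ) :
    Q.transcriptOn x cs ((Q.play x σ cs n []).map Prod.fst) = Q.play x σ cs n [] := by
  induction n with
  | zero => rfl
  | succ n ih =>
    rw [play_succ, List.map_append, List.map_singleton, transcriptOn_append, ih]

end Protocol

/-- The list of the strings in a list of pairs. -/
abbrev flatten (T : List (Str × Str)) : List Str := T.flatMap fun p => [p.1, p.2]

theorem flatten_append (T U : List (Str × Str)) : flatten (T ++ U) = flatten T ++ flatten U := by
  simp [flatten]

/-! ### One round of a protocol on a coded state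

The components of the state are: the input, the transcript, the transcript without the last answer,
the last answer, the random strings, the messages of Merlin with the random strings, and the
messages and random strings that have not been used yet. -/

/-- Play one more round. -/
def nextRound {k : ℕ} (Q : Protocol k) (s : Store) : Store :=
  if s 6 = [] then s else
    let m := (hd (s 6)).take (Q.msgLen.eval (s 0).length)
    let c := (hd (tl (s 6))).take (Q.coinLen.eval (s 0).length)
    let cs := s 4 ++ encodeItem c
    let a := Q.V (encodeItem (s 0) ++ (s 1 ++ (encodeItem m ++ cs)))
    fun
      | 0 => s 0
      | 1 => s 1 ++ (encodeItem m ++ encodeItem a)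
      | 2 => s 1 ++ encodeItem m
      | 3 => a
      | 4 => cs
      | 5 => s 5 ++ (encodeItem m ++ encodeItem c)
      | 6 => tl (tl (s 6))
      | _ => []

theorem polyTime_nextRound {k : ℕ} (Q : Protocol k) {G : Str → Store}
    (hG : ∀ r, PolyTime (fun w => G w r)) (r : ℕ) : PolyTime (fun w => nextRound Q (G w) r) := by
  have hm : PolyTime fun w => (hd (G w 6)).take (Q.msgLen.eval (G w 0).length) :=
    (hG 6).hd.take_eval _ (hG 0)
  have hc : PolyTime fun w => (hd (tl (G w 6))).take (Q.coinLen.eval (G w 0).length) :=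
    (hG 6).tl.hd.take_eval _ (hG 0)
  have hcs := (hG 4).append hc.encodeItem
  have ha := Q.V_polyTime.comp ((hG 0).encodeItem.append
    ((hG 1).append (hm.encodeItem.append hcs)))
  have key : PolyTime (fun w => if G w 6 = [] then G w r else
      (match r with
      | 0 => G w 0
      | 1 => G w 1 ++ (encodeItem ((hd (G w 6)).take (Q.msgLen.eval (G w 0).length)) ++
          encodeItem (Q.V (encodeItem (G w 0) ++ (G w 1 ++
            (encodeItem ((hd (G w 6)).take (Q.msgLen.eval (G w 0).length)) ++
              (G w 4 ++ encodeItem ((hd (tl (G w 6))).take (Q.coinLen.eval (G w 0).length))))))))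
      | 2 => G w 1 ++ encodeItem ((hd (G w 6)).take (Q.msgLen.eval (G w 0).length))
      | 3 => Q.V (encodeItem (G w 0) ++ (G w 1 ++
            (encodeItem ((hd (G w 6)).take (Q.msgLen.eval (G w 0).length)) ++
              (G w 4 ++ encodeItem ((hd (tl (G w 6))).take (Q.coinLen.eval (G w 0).length))))))
      | 4 => G w 4 ++ encodeItem ((hd (tl (G w 6))).take (Q.coinLen.eval (G w 0).length))
      | 5 => G w 5 ++ (encodeItem ((hd (G w 6)).take (Q.msgLen.eval (G w 0).length)) ++
          encodeItem ((hd (tl (G w 6))).take (Q.coinLen.eval (G w 0).length)))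
      | 6 => tl (tl (G w 6))
      | _ => [])) := by
    refine PolyTime.ite (PolyDec.eq (hG 6) (PolyTime.const [])) (hG r) ?_
    match r with
    | 0 => exact hG 0
    | 1 => exact (hG 1).append (hm.encodeItem.append ha.encodeItem)
    | 2 => exact (hG 1).append hm.encodeItem
    | 3 => exact ha
    | 4 => exact hcs
    | 5 => exact (hG 5).append (hm.encodeItem.append hc.encodeItem)
    | 6 => exact (hG 6).tl.tl
    | _ + 7 => exact PolyTime.const []
  convert key using 2 with w
  unfold nextRound
  split_ifs
  · rfl
  · match r with
    | 0 | 1 | 2 | 3 | 4 | 5 | 6 | _ + 7 => rfl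

theorem polyTime_iterate_nextRound {k : ℕ} (Q : Protocol k) {G : Str → Store}
    (hG : ∀ r, PolyTime (fun w => G w r)) (n r : ℕ) :
    PolyTime (fun w => (nextRound Q)^[n] (G w) r) := by
  induction n generalizing r with
  | zero => exact hG r
  | succ n ih =>
    simp only [Function.iterate_succ_apply']
    exact polyTime_nextRound Q ih r

/-- The coded state on input `z` after the transcript `T` with the random strings `cs`. -/
def roundState (z : Str) (T : Transcript) (cs : List Str) (rest : Str) : Store
  | 0 => z
  | 1 => encodeTuple (flatten T)
  | 2 => encodeTuple (flatten T).dropLast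
  | 3 => (T.getLast?.map Prod.snd).getD []
  | 4 => encodeTuple cs
  | 5 => encodeTuple (flatten ((T.map Prod.fst).zip cs))
  | 6 => rest
  | _ => []

theorem nextRound_roundState {k : ℕ} (Q : Protocol k) (z : Str) (T : Transcript) (cs : List Str)
    (hcs : cs.length = T.length) (m c rest : Str) :
    nextRound Q (roundState z T cs (encodeItem m ++ (encodeItem c ++ rest))) =
      roundState z (T ++ [(m.take (Q.msgLen.eval z.length),
        Q.arthurOn z (cs ++ [c.take (Q.coinLen.eval z.length)]) T (m.take (Q.msgLen.eval z.length)))])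
        (cs ++ [c.take (Q.coinLen.eval z.length)]) rest := by
  have h : roundState z T cs (encodeItem m ++ (encodeItem c ++ rest)) 6 ≠ [] := by
    simp [roundState, encodeItem_ne_nil]
  have ha : ∀ m' c' : Str, Q.V (encodeItem z ++ (encodeTuple (flatten T) ++
      (encodeItem m' ++ (encodeTuple cs ++ encodeItem c')))) = Q.arthurOn z (cs ++ [c']) T m' := by
    intro m' c'
    rw [Protocol.arthurOn, List.take_of_length_le (by simp [hcs])]
    simp
  have hzip : ∀ m' a' c' : Str, ((T ++ [(m', a')]).map Prod.fst).zip (cs ++ [c']) =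
      (T.map Prod.fst).zip cs ++ [(m', c')] := by
    intro m' a' c'
    rw [List.map_append, List.zip_append (by simp [hcs])]
    rfl
  have hdrop : ∀ m' a' : Str, (flatten (T ++ [(m', a')])).dropLast = flatten T ++ [m'] := by
    intro m' a'
    rw [flatten_append, List.dropLast_append_of_ne_nil (by simp [flatten])]
    rfl
  funext r
  rw [nextRound, if_neg h]
  match r with
  | 0 => rfl
  | 1 => simp [roundState, ha]
  | 2 => simp only [roundState]; rw [hdrop]; simp
  | 3 => simp [roundState, ha]
  | 4 => simp [roundState]
  | 5 => simp only [roundState]; rw [hzip, flatten_append]; simp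
  | 6 => simp [roundState]
  | _ + 7 => rfl

/-- Surplus iterations idle, since the stack of unused strings is empty. The number `n` can
therefore be fixed as the number of rounds of the protocol, while the played part is shorter. -/
theorem iterate_nextRound {k : ℕ} (Q : Protocol k) (z : Str) (us ss : List Str)
    (h : us.length = ss.length) (n : ℕ) (hn : us.length ≤ n) :
    (nextRound Q)^[n] (roundState z [] [] (encodeTuple (flatten (us.zip ss)))) =
      roundState z (Q.transcriptOn z (ss.map (List.take (Q.coinLen.eval z.length)))
        (us.map (List.take (Q.msgLen.eval z.length))))
        (ss.map (List.take (Q.coinLen.eval z.length))) [] := by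
  have key : ∀ j ≤ us.length,
      (nextRound Q)^[j] (roundState z [] [] (encodeTuple (flatten (us.zip ss)))) =
      roundState z (Q.transcriptOn z (ss.map (List.take (Q.coinLen.eval z.length)))
        ((us.take j).map (List.take (Q.msgLen.eval z.length))))
        ((ss.take j).map (List.take (Q.coinLen.eval z.length)))
        (encodeTuple (flatten ((us.drop j).zip (ss.drop j)))) := by
    intro j hj
    induction j with
    | zero => rfl
    | succ j ih =>
      rw [Function.iterate_succ_apply', ih (by omega)]
      rw [List.drop_eq_getElem_cons (show j < us.length by omega),
        List.drop_eq_getElem_cons (show j < ss.length by omega)]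
      have e : encodeTuple (flatten ((us[j] :: us.drop (j + 1)).zip (ss[j] :: ss.drop (j + 1)))) =
          encodeItem us[j] ++ (encodeItem ss[j] ++
            encodeTuple (flatten ((us.drop (j + 1)).zip (ss.drop (j + 1))))) := by
        simp only [List.zip_cons_cons, flatten, List.flatMap_cons, List.cons_append,
          List.nil_append, encodeTuple_cons]
      rw [e, nextRound_roundState _ _ _ _ (by
        rw [Protocol.length_transcriptOn]; simp; omega)]
      have t1 : us.take (j + 1) = us.take j ++ [us[j]] := by simp
      have t2 : ss.take (j + 1) = ss.take j ++ [ss[j]] := by simp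
      rw [t1, t2, List.map_append, List.map_append, List.map_singleton, List.map_singleton,
        Protocol.transcriptOn_append]
      congr 4
      -- One side knows only the random strings used so far, the other knows all of them; both are
      -- cut to the first `j + 1`.
      unfold Protocol.arthurOn
      congr 5
      rw [Protocol.length_transcriptOn, List.length_map, List.length_take, min_eq_left (by omega),
        ← List.map_singleton, ← List.map_append, ← t2, List.map_take, List.take_take, min_self]
  have h1 := key us.length le_rfl
  obtain ⟨d, rfl⟩ := Nat.exists_eq_add_of_le' hn
  rw [Function.iterate_add_apply, h1]
  have e1 : us.take us.length = us := List.take_length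
  have e2 : ss.take us.length = ss := by rw [h, List.take_length]
  have e3 : us.drop us.length = [] := List.drop_length
  rw [e1, e2, e3]
  refine Function.iterate_fixed (f := nextRound Q) ?_ d
  exact if_pos rfl

/-! ### Rearranging the input of Arthur's message function -/

/-- From the code of `x, m₁, a₁, …, mᵢ, aᵢ, m, r₁, …, r_{i+1}` make the code of
`x, m₁, r₁, …, m, r_{i+1}`. -/
def interleave (i : ℕ) (w : Str) : Str :=
  encodeTuple (item 0 w ::
    (List.range (i + 1)).flatMap fun j => [item (2 * j + 1) w, item (2 * i + 2 + j) w])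

/-- Apply `interleave i`, where `i ≤ n` is found from the number of components. -/
def interleaveUpTo : ℕ → Str → Str
  | 0 => interleave 0
  | n + 1 => fun w => if tl^[3 * n + 3] w = [] then interleaveUpTo n w else interleave (n + 1) w

theorem polyTime_interleave (i : ℕ) : PolyTime (interleave i) := by
  have h := PolyTime.encodeTuple ((fun w => item 0 w) ::
    (List.range (i + 1)).flatMap fun j => [fun w => item (2 * j + 1) w,
      fun w => item (2 * i + 2 + j) w]) (by
    intro g hg
    rcases List.mem_cons.1 hg with rfl | hg
    · exact PolyTime.id.item 0
    · obtain ⟨j, -, hg⟩ := List.mem_flatMap.1 hg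
      simp at hg
      rcases hg with rfl | rfl <;> exact PolyTime.id.item _)
  simp only [List.map_cons, List.map_flatMap, List.map_nil] at h
  exact h

theorem polyTime_interleaveUpTo (n : ℕ) : PolyTime (interleaveUpTo n) := by
  induction n with
  | zero => exact polyTime_interleave 0
  | succ n ih =>
    exact PolyTime.ite (PolyDec.eq (PolyTime.id.iterate_tl _) (PolyTime.const [])) ih
      (polyTime_interleave _)

theorem length_flatten (T : List (Str × Str)) : (flatten T).length = 2 * T.length := by
  induction T with
  | nil => rfl
  | cons p T ih => simp only [flatten, List.flatMap_cons, List.length_append] at ih ⊢; simp [ih]; omega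

theorem getElem?_flatten (T : List (Str × Str)) (j : ℕ) :
    (flatten T)[2 * j]? = (T.map Prod.fst)[j]? := by
  induction T generalizing j with
  | nil => rfl
  | cons p T ih =>
    cases j with
    | zero => rfl
    | succ j => simpa [flatten, mul_add] using ih j

theorem flatten_zip (A B : List Str) (n : ℕ) (hA : A.length = n) (hB : B.length = n) :
    flatten (A.zip B) = (List.range n).flatMap fun j => [A.getD j [], B.getD j []] := by
  have : A.zip B = (List.range n).map fun j => (A.getD j [], B.getD j []) := by
    apply List.ext_getElem
    · simp [hA, hB]
    · intro j h1 h2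
      simp at h1
      simp [h1]
  rw [this, flatten, List.flatMap_map]

/-- Brings Arthur's input into the format of the reward's input. A single decoder then serves both;
Arthur's earlier answers are dropped, as they can be recomputed. -/
theorem interleave_encodeTuple (x m : Str) (T : List (Str × Str)) (cs : List Str)
    (hcs : cs.length = T.length + 1) :
    interleave T.length (encodeTuple (x :: (flatten T ++ m :: cs))) =
      encodeTuple (x :: flatten ((T.map Prod.fst ++ [m]).zip cs)) := by
  rw [interleave, flatten_zip _ _ (T.length + 1) (by simp) hcs]
  congr 2
  · rw [item_encodeTuple]; rfl
  · have e : ∀ j < T.length + 1, (flatten T ++ m :: cs)[2 * j]? =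
        (T.map Prod.fst ++ [m])[j]? := by
      intro j hj
      rcases Nat.lt_or_ge j T.length with h | h
      · rw [List.getElem?_append_left (by rw [length_flatten]; omega), getElem?_flatten,
          List.getElem?_append_left (by simpa using h)]
      · obtain rfl : j = T.length := by omega
        rw [List.getElem?_append_right (by rw [length_flatten]),
          List.getElem?_append_right (by simp), length_flatten]
        simp
    have e' : ∀ j, (flatten T ++ m :: cs)[2 * T.length + 1 + j]? = cs[j]? := by
      intro j
      rw [List.getElem?_append_right (by rw [length_flatten]; omega), length_flatten,
        show 2 * T.length + 1 + j - 2 * T.length = j + 1 by omega, List.getElem?_cons_succ]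
    rw [List.flatMap_def, List.flatMap_def]
    congr 1
    refine List.map_congr_left fun j hj => ?_
    rw [item_encodeTuple, item_encodeTuple, List.getD_eq_getElem?_getD, List.getD_eq_getElem?_getD,
      List.getD_eq_getElem?_getD, List.getD_eq_getElem?_getD, List.getElem?_cons_succ,
      e j (List.mem_range.1 hj), show 2 * T.length + 2 + j = (2 * T.length + 1 + j) + 1 by omega,
      List.getElem?_cons_succ, e']

/-- The round can be read off from the number of components: `1 + 2 * i` for the input and the
transcript, `1` for the message and `i + 1` for the random strings. -/
theorem interleaveUpTo_encodeTuple {n i : ℕ} (h : i ≤ n) {L : List Str}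
    (hL : L.length = 3 * i + 3) :
    interleaveUpTo n (encodeTuple L) = interleave i (encodeTuple L) := by
  induction n with
  | zero => obtain rfl : i = 0 := by omega
            rfl
  | succ n ih =>
    simp only [interleaveUpTo, iterate_tl_encodeTuple, encodeTuple_eq_nil, List.drop_eq_nil_iff]
    split_ifs with h1
    · exact ih (by omega)
    · obtain rfl : i = n + 1 := by omega
      rfl

/-! ### The protocol -/

section Composite

variable {k : ℕ} (Q : Protocol k) (c : Prog) (q clk H : Polynomial ℕ)

/-- The simulation of the oracle machine on input `(x, y)`, where `y` is a part of Arthur's first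
random string `r` and `m` are the answers claimed by Merlin. -/
def oracleSim (x r m : Str) : Store :=
  selSim (width c + 1) c (encodeTuple [x, r.take (q.eval x.length)])
    (List.replicate (clk.eval x.length) true) (List.replicate (H.eval x.length) true) m
    (r.drop (q.eval x.length))

/-- The simulation, from the code of `x, m₁, r₁, m₂, r₂, …`. -/
def simOf (w : Str) : Store := oracleSim c q clk H (item 0 w) (item 2 w) (item 3 w)

/-- The state of the protocol `Q` for the selected query, from the code of `x, m₁, r₁, m₂, r₂, …`. -/
def roundsOf (w : Str) : Store :=
  (nextRound Q)^[k] (roundState (simOf c q clk H w (width c + 1 + 5)) [] []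
    (encodeItem (simOf c q clk H w (width c + 1 + 7)) ++ tl^[4] w))

/-- Arthur's message, from the code of `x, m₁, r₁, m₂, r₂, …`: after the first round the string `y`,
and later the selected query and his message in the protocol for it. -/
def answerOf (w : Str) : Str :=
  if tl^[3] w = [] then (item 2 w).take (q.eval (item 0 w).length)
  else encodeTuple [simOf c q clk H w (width c + 1 + 5), roundsOf Q c q clk H w 3]

/-- The reward for the claim `b` if the machine answers `a`. -/
def scoreDigits (b a r : Str) : Str :=
  if b.head? = some true then
    if a = [true] then [true] else List.replicate r.length false ++ [true]
  else if a = [true] then [] else [true]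

/-- The digits of the reward, from the code of `x, m₁, r₁, m₂, r₂, …`. -/
def rewardDigits (ρ : Str → Str) (w : Str) : Str :=
  if simOf c q clk H w (width c + 1 + 3) = [] then
    if simOf c q clk H w (width c + 1 + 2) =
        List.replicate (simOf c q clk H w (width c + 1 + 2)).length true then
      scoreDigits (item 1 w) (simOf c q clk H w 0) (item 2 w)
    else []
  else if Q.φ (encodeItem (roundsOf Q c q clk H w 0) ++ roundsOf Q c q clk H w 2) =
      simOf c q clk H w (width c + 1 + 6) then
    false :: true :: ρ (encodeItem (roundsOf Q c q clk H w 0) ++ roundsOf Q c q clk H w 5)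
  else []

theorem polyTime_simOf (r : ℕ) : PolyTime (fun w => simOf c q clk H w r) :=
  have h0 := PolyTime.id.item 0
  have h2 := PolyTime.id.item 2
  polyTime_selSim (by omega)
    (PolyTime.encodeTuple [fun w => item 0 w, fun w => (item 2 w).take (q.eval (item 0 w).length)]
      (by simp only [List.mem_cons, List.not_mem_nil, or_false]
          rintro g (rfl | rfl)
          · exact h0
          · exact h2.take_eval q h0))
    (h0.replicate_eval clk) (h0.replicate_eval H) (PolyTime.id.item 3) (h2.drop_eval q h0) r

theorem polyTime_roundsOf (r : ℕ) : PolyTime (fun w => roundsOf Q c q clk H w r) := by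
  refine polyTime_iterate_nextRound Q (fun r => ?_) k r
  match r with
  | 0 => exact polyTime_simOf c q clk H _
  | 6 => exact (polyTime_simOf c q clk H _).encodeItem.append (PolyTime.id.iterate_tl 4)
  | 1 | 2 | 3 | 4 | 5 | _ + 7 => exact PolyTime.const []

theorem polyTime_answerOf : PolyTime (answerOf Q c q clk H) := by
  refine PolyTime.ite (PolyDec.eq (PolyTime.id.iterate_tl 3) (PolyTime.const []))
    ((PolyTime.id.item 2).take_eval q (PolyTime.id.item 0)) ?_
  exact PolyTime.encodeTuple [fun w => simOf c q clk H w (width c + 1 + 5),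
    fun w => roundsOf Q c q clk H w 3] (by
      simp only [List.mem_cons, List.not_mem_nil, or_false]
      rintro g (rfl | rfl)
      · exact polyTime_simOf c q clk H _
      · exact polyTime_roundsOf Q c q clk H _)

theorem polyTime_rewardDigits {ρ : Str → Str} (hρ : PolyTime ρ) :
    PolyTime (rewardDigits Q c q clk H ρ) := by
  have S := polyTime_simOf c q clk H
  have U := polyTime_roundsOf Q c q clk H
  have nil := PolyTime.const []
  have one := PolyTime.const [true]
  have zeros : PolyTime fun w => List.replicate (item 2 w).length false := by
    convert (PolyTime.id.item 2).flatMap (fun _ => [false]) using 2 with w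
    induction item 2 w with
    | nil => rfl
    | cons b w ih => simp [List.replicate_succ, ih]
  refine PolyTime.ite (PolyDec.eq (S _) nil)
    (PolyTime.ite (PolyDec.eq (S _) (S _).ones) ?_ nil)
    (PolyTime.ite (PolyDec.eq (Q.φ_polyTime.comp ((U 0).encodeItem.append (U 2))) (S _))
      (PolyTime.cons _ (PolyTime.cons _ (hρ.comp ((U 0).encodeItem.append (U 5))))) nil)
  exact PolyTime.ite (PolyDec.head (PolyTime.id.item 1))
    (PolyTime.ite (PolyDec.eq (S 0) one) one (zeros.append one))
    (PolyTime.ite (PolyDec.eq (S 0) one) nil one)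

theorem binFrac_scoreDigits (b a r : Str) : binFrac (scoreDigits b a r) =
    if b.head? = some true then if a = [true] then 1 else 1 / 2 ^ r.length
    else if a = [true] then 0 else 1 := by
  have h : ∀ n, binFrac (List.replicate n false ++ [true]) = 1 / 2 ^ n := by
    intro n
    induction n with
    | zero => simp [binFrac]
    | succ n ih => simp [List.replicate_succ, binFrac, ih, pow_succ, div_eq_mul_inv, mul_comm]
  unfold scoreDigits
  split_ifs <;> simp [binFrac, h]

theorem binFrac_rewardDigits_mem {ρ : Str → Str} (hρ : ∀ w, Q.R w = binFrac (ρ w)) (w : Str) :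
    binFrac (rewardDigits Q c q clk H ρ w) ∈ Set.Icc (0 : ℚ) 1 := by
  unfold rewardDigits
  split_ifs
  · rw [binFrac_scoreDigits]
    split_ifs
    · simp
    · refine ⟨by positivity, ?_⟩
      rw [div_le_one (by positivity)]
      exact one_le_pow₀ (by norm_num)
    · simp
    · simp
  · simp [binFrac]
  · have := Q.R_mem (encodeItem (roundsOf Q c q clk H w 0) ++ roundsOf Q c q clk H w 5)
    rw [hρ] at this
    obtain ⟨h0, h1⟩ := this
    simp only [binFrac, Set.mem_Icc, if_true]
    constructor <;> norm_num <;> linarith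
  · simp [binFrac]

/-- The protocol for a language in `PP^f`, where `f` is computed by `Q`: Merlin claims whether `x` is
in the language, Arthur sends a random `y`, Merlin claims the answers to all queries of the machine
on input `(x, y)`, and one of the queries is selected and `Q` is played for it. -/
noncomputable def composite (p L : Polynomial ℕ) : Protocol (k + 1) where
  V := fun w => answerOf Q c q clk H (interleaveUpTo k w)
  R := fun w => binFrac (rewardDigits Q c q clk H Q.R_polyTime.choose w)
  φ := fun w => if (item 1 w).head? = some true then [true] else [false]
  msgLen := p
  coinLen := L
  V_polyTime := (polyTime_answerOf Q c q clk H).comp (polyTime_interleaveUpTo k)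
  φ_polyTime := PolyTime.ite (PolyDec.head (PolyTime.id.item 1)) (PolyTime.const _)
    (PolyTime.const _)
  R_polyTime := ⟨_, polyTime_rewardDigits Q c q clk H Q.R_polyTime.choose_spec.1, fun _ => rfl⟩
  R_mem := binFrac_rewardDigits_mem Q c q clk H Q.R_polyTime.choose_spec.2

/-- The messages in the protocol for the selected query: the first of them was sent for every
query, together with the claimed answer. -/
def subMessages (μ : Str) : List Str → List Str
  | [] => []
  | _ :: ms => μ :: ms

theorem length_subMessages (μ : Str) (ms : List Str) : (subMessages μ ms).length = ms.length := by
  cases ms <;> rfl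

theorem simOf_encodeTuple (x m₁ r₁ : Str) (ms rs : List Str) (h : ms.length = rs.length) :
    simOf c q clk H (encodeTuple (x :: flatten ((m₁ :: ms).zip (r₁ :: rs)))) =
      oracleSim c q clk H x r₁ (ms.headD []) := by
  unfold simOf
  simp only [item_encodeTuple]
  rcases ms with _ | ⟨m, ms⟩
  · simp [flatten]
  · rcases rs with _ | ⟨r, rs⟩
    · simp at h
    · simp [flatten]

/-- After the input, the first round and the second message are removed from the code, the list
starts with the second random string. The recorded first message for the selected query is put
before it, and what results is an ordinary sequence of messages and random strings for `Q`. -/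
theorem roundsOf_encodeTuple (x m₁ r₁ : Str) (ms rs : List Str) (h : ms.length = rs.length)
    (hk : ms.length ≤ k) (hms : ms ≠ []) {S : Store}
    (hS : oracleSim c q clk H x r₁ (ms.headD []) = S) {z : Str} (hz : S (width c + 1 + 5) = z) :
    roundsOf Q c q clk H (encodeTuple (x :: flatten ((m₁ :: ms).zip (r₁ :: rs)))) =
      roundState z (Q.transcriptOn z (rs.map (List.take (Q.coinLen.eval z.length)))
        ((subMessages (S (width c + 1 + 7)) ms).map (List.take (Q.msgLen.eval z.length))))
        (rs.map (List.take (Q.coinLen.eval z.length))) [] := by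
  rw [roundsOf, simOf_encodeTuple c q clk H x m₁ r₁ ms rs h, hS, hz, iterate_tl_encodeTuple]
  rcases ms with _ | ⟨m, ms⟩
  · exact absurd rfl hms
  · rcases rs with _ | ⟨r, rs⟩
    · simp at h
    · have := iterate_nextRound Q z (S (width c + 1 + 7) :: ms) (r :: rs) (by simpa using h) k
        (by simpa using hk)
      rw [subMessages, ← this]
      congr 2

variable (p L : Polynomial ℕ)

theorem arthurOn_composite_nil (x r : Str) (rs : List Str) (m : Str) :
    (composite Q c q clk H p L).arthurOn x (r :: rs) [] m = r.take (q.eval x.length) := by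
  have h := interleave_encodeTuple x m [] [r] rfl
  have h1 : interleaveUpTo k (encodeTuple [x, m, r]) = encodeTuple [x, m, r] := by
    rw [interleaveUpTo_encodeTuple (Nat.zero_le k) rfl]
    exact h
  have h2 : (composite Q c q clk H p L).arthurOn x (r :: rs) [] m =
      answerOf Q c q clk H (interleaveUpTo k (encodeTuple [x, m, r])) := rfl
  rw [h2, h1, answerOf, if_pos (by rw [iterate_tl_encodeTuple]; rfl), item_encodeTuple,
    item_encodeTuple]
  rfl

/-- The simulation depends only on `x`, the first random string and the second message. It can hence
be repeated in every later round with the same result `S`. -/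
theorem arthurOn_composite (x r : Str) (rs : List Str) (T : Transcript) (m m₁ : Str)
    (ms : List Str) (hT : T.map Prod.fst ++ [m] = m₁ :: ms) (hms : ms ≠ [])
    (hk : ms.length ≤ rs.length) (hk' : ms.length ≤ k) {S : Store}
    (hS : oracleSim c q clk H x r (ms.headD []) = S) {z : Str} (hz : S (width c + 1 + 5) = z) :
    (composite Q c q clk H p L).arthurOn x (r :: rs) T m = encodeTuple [z,
      ((Q.transcriptOn z (rs.map (List.take (Q.coinLen.eval z.length)))
        ((subMessages (S (width c + 1 + 7)) ms).map
          (List.take (Q.msgLen.eval z.length)))).getLast?.map Prod.snd).getD []] := by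
  have hlen : T.length = ms.length := by
    have := congrArg List.length hT
    simpa using this
  have hcs : ((r :: rs).take (T.length + 1)).length = T.length + 1 := by simp; omega
  have h1 : (composite Q c q clk H p L).arthurOn x (r :: rs) T m =
      answerOf Q c q clk H (interleaveUpTo k (encodeTuple (x :: (flatten T ++ m ::
        (r :: rs).take (T.length + 1))))) := rfl
  rw [h1, interleaveUpTo_encodeTuple (i := T.length) (by omega)
    (by simp only [List.length_cons, List.length_append, length_flatten, hcs]; omega),
    interleave_encodeTuple x m T _ hcs, hT, List.take_succ_cons]
  have hl : ms.length = (rs.take T.length).length := by simp; omega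
  rw [answerOf, if_neg, simOf_encodeTuple c q clk H x m₁ r ms _ hl,
    roundsOf_encodeTuple Q c q clk H x m₁ r ms _ hl hk' hms hS hz, hS, hz]
  · rw [List.map_take, Q.transcriptOn_take z _ _ (by simp [length_subMessages, hlen])]
    rfl
  · rw [iterate_tl_encodeTuple, encodeTuple_eq_nil]
    rcases ms with _ | ⟨m, ms⟩
    · exact absurd rfl hms
    · rw [List.drop_eq_nil_iff]
      simp only [List.length_cons, length_flatten, List.length_zip] at hl ⊢
      omega

theorem rewardOn_composite (x r : Str) (rs : List Str) (T : Transcript) (m₁ : Str)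
    (ms : List Str) (hT : T.map Prod.fst = m₁ :: ms) (hk : ms.length = rs.length)
    (hk' : ms.length = k) {S : Store} (hS : oracleSim c q clk H x r (ms.headD []) = S) {z : Str}
    (hz : S (width c + 1 + 5) = z) :
    (composite Q c q clk H p L).rewardOn x (r :: rs) T =
      if S (width c + 1 + 3) = [] then
        if S (width c + 1 + 2) = List.replicate (S (width c + 1 + 2)).length true then
          binFrac (scoreDigits m₁ (S 0) r) else 0
      else Q.checkedReward z (S (width c + 1 + 6)) (rs.map (List.take (Q.coinLen.eval z.length)))
        (Q.transcriptOn z (rs.map (List.take (Q.coinLen.eval z.length)))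
          ((subMessages (S (width c + 1 + 7)) ms).map (List.take (Q.msgLen.eval z.length)))) := by
  have hρ := Q.R_polyTime.choose_spec.2
  have h1 : (composite Q c q clk H p L).rewardOn x (r :: rs) T = binFrac
      (rewardDigits Q c q clk H Q.R_polyTime.choose
        (encodeTuple (x :: flatten ((T.map Prod.fst).zip (r :: rs))))) := rfl
  rw [h1, hT, rewardDigits, simOf_encodeTuple c q clk H x m₁ r ms rs hk, hS, item_encodeTuple,
    item_encodeTuple]
  set ss := rs.map (List.take (Q.coinLen.eval z.length)) with hss
  set us := (subMessages (S (width c + 1 + 7)) ms).map (List.take (Q.msgLen.eval z.length)) with hus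
  obtain ⟨h0, h2, h5⟩ : roundsOf Q c q clk H
        (encodeTuple (x :: flatten ((m₁ :: ms).zip (r :: rs)))) 0 = z ∧
      roundsOf Q c q clk H (encodeTuple (x :: flatten ((m₁ :: ms).zip (r :: rs)))) 2 =
        encodeTuple (flatten (Q.transcriptOn z ss us)).dropLast ∧
      roundsOf Q c q clk H (encodeTuple (x :: flatten ((m₁ :: ms).zip (r :: rs)))) 5 =
        encodeTuple (flatten (((Q.transcriptOn z ss us).map Prod.fst).zip ss)) := by
    -- Without a second message the protocol `Q` has no rounds, and its state is still the initial
    -- one.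
    by_cases hms : ms = []
    · subst hms
      obtain rfl : k = 0 := hk'.symm
      simp only [roundsOf, simOf_encodeTuple c q clk H x m₁ r [] rs hk, hS, hz]
      exact ⟨rfl, rfl, rfl⟩
    · rw [roundsOf_encodeTuple Q c q clk H x m₁ r ms rs hk hk'.le hms hS hz]
      exact ⟨rfl, rfl, rfl⟩
  rw [h0, h2, h5]
  have e1 : encodeItem z ++ encodeTuple (flatten (Q.transcriptOn z ss us)).dropLast =
      encodeTuple (z :: (flatten (Q.transcriptOn z ss us)).dropLast) := rfl
  have e2 : encodeItem z ++ encodeTuple (flatten (((Q.transcriptOn z ss us).map Prod.fst).zip ss)) =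
      encodeTuple (z :: flatten (((Q.transcriptOn z ss us).map Prod.fst).zip ss)) := rfl
  rw [e1, e2, Protocol.checkedReward, Protocol.value, Protocol.rewardOn, hρ]
  split_ifs
  · rfl
  · rfl
  · simp only [binFrac]
    norm_num
    ring
  · rfl

end Composite

/-! ### Plays of the composite protocol -/

/-- The transcript of the composite protocol with Arthur's answers `as` in the protocol for the
query `z`, if Merlin plays `σ`. -/
def liftAnswers (σ : Transcript → Str) (z : Str) (T₁ : Transcript) (as : List Str) : Transcript :=
  as.foldl (fun T a => T ++ [(σ T, encodeTuple [z, a])]) T₁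

theorem liftAnswers_append (σ : Transcript → Str) (z : Str) (T₁ : Transcript) (as : List Str)
    (a : Str) : liftAnswers σ z T₁ (as ++ [a]) = liftAnswers σ z T₁ as ++
      [(σ (liftAnswers σ z T₁ as), encodeTuple [z, a])] := by
  simp [liftAnswers]

section Composite

variable {k : ℕ} (Q : Protocol k) (c : Prog) (q clk H p L : Polynomial ℕ)

/-- Merlin's second message, if there is one. -/
def secondMessage (k : ℕ) (σ : Transcript → Str) (y : Str) : Str :=
  if k = 0 then [] else σ [(σ [], y)]

/-- The strategy for the query `z` that is part of a strategy in the composite protocol. -/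
def subStrategy (σ : Transcript → Str) (z μ : Str) (T₁ T : Transcript) : Str :=
  (if T = [] then μ else σ (liftAnswers σ z T₁ (T.map Prod.snd))).take (Q.msgLen.eval z.length)

theorem subStrategy_mem (σ : Transcript → Str) (z μ : Str) (T₁ T : Transcript) :
    subStrategy Q σ z μ T₁ T ∈ Q.messages z := by
  rw [Protocol.mem_messages, subStrategy]
  exact List.length_take_le _ _

theorem subMessages_append (μ : Str) {ms : List Str} (h : ms ≠ []) (m : Str) :
    subMessages μ (ms ++ [m]) = subMessages μ ms ++ [m] := by
  cases ms
  · exact absurd rfl h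
  · rfl

variable {c q clk H}

/-- From the second round on, Arthur's answers consist of the fixed `z` and his answer in `Q`. The
composite transcript is therefore determined by `σ`, `z` and the transcript in `Q`, and this makes
Merlin's further messages a genuine strategy for `Q`. The induction carries the messages and the
transcripts along together. -/
theorem play_composite (x r : Str) (rs : List Str) (hrs : rs.length = k) (σ : Transcript → Str)
    {S : Store}
    (hS : oracleSim c q clk H x r (secondMessage k σ (r.take (q.eval x.length))) = S) {z μ : Str}
    (hz : S (width c + 1 + 5) = z) (hμ : S (width c + 1 + 7) = μ) (n : ℕ) (hn : n ≤ k) :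
    ∃ ms : List Str, ms.length = n ∧
      (n ≠ 0 → ms.headD [] = secondMessage k σ (r.take (q.eval x.length))) ∧
      ((composite Q c q clk H p L).play x σ (r :: rs) (n + 1) []).map Prod.fst = σ [] :: ms ∧
      (subMessages μ ms).map (List.take (Q.msgLen.eval z.length)) =
        (Q.play z (subStrategy Q σ z μ [(σ [], r.take (q.eval x.length))])
          (rs.map (List.take (Q.coinLen.eval z.length))) n []).map Prod.fst ∧
      (composite Q c q clk H p L).play x σ (r :: rs) (n + 1) [] =
        liftAnswers σ z [(σ [], r.take (q.eval x.length))]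
          ((Q.play z (subStrategy Q σ z μ [(σ [], r.take (q.eval x.length))])
            (rs.map (List.take (Q.coinLen.eval z.length))) n []).map Prod.snd) := by
  set C := composite Q c q clk H p L with hC
  set T₁ : Transcript := [(σ [], r.take (q.eval x.length))] with hT₁
  set τ := subStrategy Q σ z μ T₁ with hτ
  set ss := rs.map (List.take (Q.coinLen.eval z.length)) with hss
  have h1 : C.play x σ (r :: rs) 1 [] = T₁ := by
    rw [Protocol.play, hC, arthurOn_composite_nil]
    rfl
  induction n with
  | zero => exact ⟨[], rfl, by simp, by rw [h1]; rfl, rfl, h1⟩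
  | succ n ih =>
    obtain ⟨ms, hlen, hhead, hfst, hsub, hlift⟩ := ih (by omega)
    set T := C.play x σ (r :: rs) (n + 1) [] with hT
    set U := Q.play z τ ss n [] with hU
    have hUlen : U.length = n := by rw [hU, Protocol.length_play]; simp
    have hhead' : (ms ++ [σ T]).headD [] = secondMessage k σ (r.take (q.eval x.length)) := by
      rcases Nat.eq_zero_or_pos n with rfl | hpos
      · obtain rfl := List.length_eq_zero_iff.1 hlen
        rw [hT, h1, secondMessage, if_neg (by omega)]
        rfl
      · have hne : ms ≠ [] := by rintro rfl; simp at hlen; omega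
        rw [← hhead hpos.ne']
        cases ms
        · exact absurd rfl hne
        · rfl
    have hsub' : (subMessages μ (ms ++ [σ T])).map (List.take (Q.msgLen.eval z.length)) =
        (Q.play z τ ss (n + 1) []).map Prod.fst := by
      rw [Protocol.play_succ, List.map_append, ← hU]
      rcases Nat.eq_zero_or_pos n with rfl | hpos
      · obtain rfl := List.length_eq_zero_iff.1 hlen
        obtain hU0 := List.length_eq_zero_iff.1 hUlen
        rw [hU0]
        simp [subMessages, hτ, subStrategy]
      · have hne : ms ≠ [] := by rintro rfl; simp at hlen; omega
        have hUne : U ≠ [] := by rintro h; rw [h] at hUlen; simp at hUlen; omega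
        rw [subMessages_append μ hne, List.map_append, hsub, hlift]
        simp [hτ, subStrategy, hUne]
    refine ⟨ms ++ [σ T], by simp [hlen], fun _ => hhead', ?_, hsub', ?_⟩
    · rw [Protocol.play_succ, ← hT, List.map_append, hfst]
      rfl
    · rw [Protocol.play_succ, ← hT]
      have ha := arthurOn_composite Q c q clk H p L x r rs T (σ T) (σ []) (ms ++ [σ T])
        (by rw [hfst]; rfl) (by simp) (by simp [hlen, hrs]; omega) (by simp [hlen]; omega)
        (by rw [hhead']; exact hS) hz
      -- Arthur recomputes the transcript in `Q` from the messages alone; by `hsub'` these are the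
      -- messages of the substrategy.
      rw [← hC] at ha
      rw [ha, hμ, hsub', Protocol.transcriptOn_play, Protocol.play_succ, ← hU]
      rw [List.map_append, List.map_singleton, liftAnswers_append, ← hlift]
      simp

/-- The reward of a strategy in the composite protocol, in terms of the simulation and of a strategy
in the protocol for the selected query. -/
theorem rewardOn_play_composite (x r : Str) (rs : List Str) (hrs : rs.length = k)
    (σ : Transcript → Str) {S : Store}
    (hS : oracleSim c q clk H x r (secondMessage k σ (r.take (q.eval x.length))) = S) {z μ : Str}
    (hz : S (width c + 1 + 5) = z) (hμ : S (width c + 1 + 7) = μ) :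
    (composite Q c q clk H p L).rewardOn x (r :: rs)
        ((composite Q c q clk H p L).play x σ (r :: rs) (k + 1) []) =
      if S (width c + 1 + 3) = [] then
        if S (width c + 1 + 2) = List.replicate (S (width c + 1 + 2)).length true then
          binFrac (scoreDigits (σ []) (S 0) r) else 0
      else Q.checkedReward z (S (width c + 1 + 6)) (rs.map (List.take (Q.coinLen.eval z.length)))
        (Q.play z (subStrategy Q σ z μ [(σ [], r.take (q.eval x.length))])
          (rs.map (List.take (Q.coinLen.eval z.length))) k []) := by
  obtain ⟨ms, hlen, hhead, hfst, hsub, -⟩ := play_composite Q p L x r rs hrs σ hS hz hμ k le_rfl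
  have hhead' : ms.headD [] = secondMessage k σ (r.take (q.eval x.length)) := by
    by_cases hk : k = 0
    · rw [secondMessage, if_pos hk, List.length_eq_zero_iff.1 (hlen.trans hk)]
      rfl
    · exact hhead hk
  rw [rewardOn_composite Q c q clk H p L x r rs _ (σ []) ms hfst (hlen.trans hrs.symm) hlen
    (by rw [hhead']; exact hS) hz, hμ, hsub, Protocol.transcriptOn_play]

end Composite

/-! ### The expected reward over the selection of a query -/

/-- The part of the optimal expected reward that comes from the queries: each of them is selected
with probability `1 - 2⁻ʰ`, if none of the former ones is. -/
def queryReward (D : Str → ℚ) (h : ℕ) : List Str → ℚ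
  | [] => 0
  | z :: Z => (1 - 1 / 2 ^ h) * D z + 1 / 2 ^ h * queryReward D h Z

theorem queryReward_nonneg {D : Str → ℚ} (hD : ∀ z, 0 ≤ D z) (h : ℕ) (Z : List Str) :
    0 ≤ queryReward D h Z := by
  induction Z with
  | nil => exact le_rfl
  | cons z Z ih =>
    have h1 : (1 : ℚ) / 2 ^ h ≤ 1 := by
      rw [div_le_one (by positivity)]
      exact one_le_pow₀ (by norm_num)
    have h2 := mul_nonneg (sub_nonneg.2 h1) (hD z)
    have h3 : 0 ≤ 1 / 2 ^ h * queryReward D h Z := by positivity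
    simp only [queryReward]
    linarith

theorem div_pow_add (a : ℚ) (m n : ℕ) : a / 2 ^ (m + n) = 1 / 2 ^ m * (a / 2 ^ n) := by
  rw [pow_add]
  field_simp

section Consume

variable {f : Str → Str} {D : Str → ℚ} {h : ℕ}

theorem consume_selStep_of_ne {u : Str} (hu : u.length = h) (hne : u ≠ List.replicate h true)
    (z : Str) (Z : List Str) (m v : Str) :
    consume (selStep f (List.replicate h true)) (z :: Z) (m, u ++ v) =
      .inr (some (z, hd m, hd (tl m))) := by
  have e : (u ++ v).take (List.replicate h true).length = u := by
    rw [List.length_replicate, ← hu, List.take_left]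
  simp only [consume, selStep]
  rw [if_neg (by rw [e]; exact hne)]
  rfl

theorem consume_selStep_replicate (z : Str) (Z : List Str) (m v : Str) :
    consume (selStep f (List.replicate h true)) (z :: Z) (m, List.replicate h true ++ v) =
      if hd m = f z then consume (selStep f (List.replicate h true)) Z (tl (tl m), v)
      else .inr none := by
  simp only [consume, selStep, List.take_left, List.drop_left, if_true]
  split_ifs <;> rfl

/-- Induction on the queries. A right answer reproduces the recursion for `queryReward`. At the
first wrong answer the bound becomes `(1 - 2⁻ʰ)(D z - g z) + 2⁻ʰ`, and `g z` is at least `2 · 2⁻ʰ`,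
so the loss outweighs all that may follow. Requiring the leftover bits to be ones gives the score
the weight `2⁻ⁿ` regardless of the number of queries. -/
theorem avg_le_queryReward (hD : ∀ z, 0 ≤ D z) {g : Str → ℚ} {sc : ℚ} (hsc : 0 ≤ sc)
    (h1 : 1 ≤ h) (Z : List Str) (hg : ∀ z ∈ Z, 1 / 2 ^ h ≤ g z / 2) (m : Str) (n : ℕ)
    (hn : Z.length * h ≤ n) (X : Str → ℚ)
    (hX : ∀ b : Str, b.length = n →
      match consume (selStep f (List.replicate h true)) Z (m, b) with
      | .inl θ => X b = if θ.2 = List.replicate θ.2.length true then sc else 0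
      | .inr (some (z, w, _)) => z ∈ Z → X b ≤ D z - if w = f z then 0 else g z
      | .inr none => X b ≤ 1) :
    avg n X ≤ queryReward D h Z + sc / 2 ^ n := by
  induction Z generalizing m n X with
  | nil =>
    rw [queryReward, zero_add]
    refine le_of_eq ?_
    calc avg n X = avg n (fun b => if b = List.replicate n true then sc else 0) :=
          avg_congr fun b hb => by rw [← hb]; exact hX b hb
      _ = sc / 2 ^ n := by rw [avg_ite_eq _ _ (by simp)]; ring
  | cons z Z ih =>
    rw [List.length_cons, add_one_mul] at hn
    obtain ⟨n, rfl⟩ := Nat.exists_eq_add_of_le (show h ≤ n by omega)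
    have e1 : (1 : ℚ) / 2 ^ h ≤ 1 / 2 := by
      apply one_div_le_one_div_of_le (by norm_num)
      calc (2 : ℚ) = 2 ^ 1 := by norm_num
        _ ≤ _ := pow_le_pow_right₀ (by norm_num) h1
    have e2 : (0 : ℚ) < 1 / 2 ^ h := by positivity
    have hone : avg n (fun v => X (List.replicate h true ++ v)) ≤
        if hd m = f z then queryReward D h Z + sc / 2 ^ n else 1 := by
      split_ifs with hw
      · refine ih (fun z hz => hg z (by simp [hz])) (tl (tl m)) n (by omega) _ fun b hb => ?_
        have := hX (List.replicate h true ++ b) (by simp [hb])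
        rw [consume_selStep_replicate, if_pos hw] at this
        split at this
        · exact this
        · exact fun hz => this (by simp [hz])
        · exact this
      · rw [← avg_const n 1]
        refine avg_mono fun b hb => ?_
        have := hX (List.replicate h true ++ b) (by simp [hb])
        rwa [consume_selStep_replicate, if_neg hw] at this
    have hall : avg (h + n) X ≤ (1 - 1 / 2 ^ h) * (D z - if hd m = f z then 0 else g z) +
        1 / 2 ^ h * if hd m = f z then queryReward D h Z + sc / 2 ^ n else 1 := by
      rw [avg_append, ← avg_ite_eq h (List.replicate h true) (by simp)]
      refine avg_mono fun u hu => ?_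
      by_cases hne : u = List.replicate h true
      · rw [if_pos hne, hne]
        exact hone
      · rw [if_neg hne, ← avg_const n (D z - _)]
        refine avg_mono fun v hv => ?_
        have := hX (u ++ v) (by simp [hu, hv])
        rw [consume_selStep_of_ne hu hne] at this
        exact this (by simp)
    refine hall.trans ?_
    rw [queryReward, div_pow_add]
    split_ifs with hw
    · rw [sub_zero]
      linarith
    · have h2 := hg z (by simp)
      have h3 := queryReward_nonneg hD h Z
      have h4 : 0 ≤ sc / 2 ^ n := by positivity
      have h5 : 0 ≤ 1 / 2 ^ h * (queryReward D h Z + sc / 2 ^ n) := by positivity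
      -- A query is selected with probability at least `1/2`, since `h ≥ 1`.
      have h6 : 1 / 2 * g z ≤ (1 - 1 / 2 ^ h) * g z :=
        mul_le_mul_of_nonneg_right (by linarith) (by linarith)
      linarith

/-- The message `m` consists of the right answers to the queries `Z`, each of them together with
a string that has the property `G`. -/
def Answers (f : Str → Str) (G : Str → Str → Prop) : List Str → Str → Prop
  | [], _ => True
  | z :: Z, m => hd m = f z ∧ G z (hd (tl m)) ∧ Answers f G Z (tl (tl m))

theorem answers_encodeTuple {G : Str → Str → Prop} {μ : Str → Str} (Z : List Str)
    (h : ∀ z ∈ Z, G z (μ z)) : Answers f G Z (encodeTuple (Z.flatMap fun z => [f z, μ z])) := by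
  induction Z with
  | nil => trivial
  | cons z Z ih =>
    have := ih fun z hz => h z (by simp [hz])
    have h1 := h z (by simp)
    simp only [List.flatMap_cons, List.cons_append, List.nil_append, encodeTuple_cons]
    exact ⟨by simp, by simpa using h1, by simpa using this⟩

/-- Missing components decode as the empty string. If there is no second message, the absent answers
are thus right for the trivial oracle. -/
theorem answers_nil {G : Str → Str → Prop} (Z : List Str) (hf : ∀ z, f z = [])
    (hG : ∀ z, G z []) : Answers f G Z [] := by
  induction Z with
  | nil => trivial
  | cons z Z ih => exact ⟨by simp [hf], by simpa using hG z, by simpa using ih⟩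

/-- With right answers the recursion for `queryReward` is met exactly, selection by selection; a
wrong answer never occurs. -/
theorem queryReward_le_avg {G : Str → Str → Prop} {sc : ℚ} (Z : List Str) (m : Str)
    (hm : Answers f G Z m) (n : ℕ) (hn : Z.length * h ≤ n) (X : Str → ℚ)
    (hX : ∀ b : Str, b.length = n →
      match consume (selStep f (List.replicate h true)) Z (m, b) with
      | .inl θ => X b = if θ.2 = List.replicate θ.2.length true then sc else 0
      | .inr (some (z, w, μ)) => z ∈ Z → w = f z → G z μ → D z ≤ X b
      | .inr none => True) :
    queryReward D h Z + sc / 2 ^ n ≤ avg n X := by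
  induction Z generalizing m n X with
  | nil =>
    rw [queryReward, zero_add]
    refine ge_of_eq ?_
    calc avg n X = avg n (fun b => if b = List.replicate n true then sc else 0) :=
          avg_congr fun b hb => by rw [← hb]; exact hX b hb
      _ = sc / 2 ^ n := by rw [avg_ite_eq _ _ (by simp)]; ring
  | cons z Z ih =>
    obtain ⟨hw, hG, hm⟩ := hm
    rw [List.length_cons, add_one_mul] at hn
    obtain ⟨n, rfl⟩ := Nat.exists_eq_add_of_le (show h ≤ n by omega)
    have hone : queryReward D h Z + sc / 2 ^ n ≤
        avg n (fun v => X (List.replicate h true ++ v)) := by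
      refine ih (tl (tl m)) hm n (by omega) _ fun b hb => ?_
      have := hX (List.replicate h true ++ b) (by simp [hb])
      rw [consume_selStep_replicate, if_pos hw] at this
      split at this
      · exact this
      · exact fun hz => this (by simp [hz])
      · exact this
    rw [queryReward, div_pow_add, add_assoc, ← mul_add, avg_append,
      ← avg_ite_eq h (List.replicate h true) (by simp)]
    refine avg_mono fun u hu => ?_
    by_cases hne : u = List.replicate h true
    · rw [if_pos hne, hne]
      exact hone
    · rw [if_neg hne, ← avg_const n (D z)]
      refine avg_mono fun v hv => ?_
      have := hX (u ++ v) (by simp [hu, hv])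
      rw [consume_selStep_of_ne hu hne] at this
      exact this (by simp) hw hG

end Consume

/-! ### Merlin's strategies in the composite protocol -/

/-- The transcript in which Merlin plays `τ` and Arthur answers `as`. -/
def rebuild (τ : Transcript → Str) (as : List Str) : Transcript :=
  as.foldl (fun U a => U ++ [(τ U, a)]) []

theorem rebuild_append (τ : Transcript → Str) (as : List Str) (a : Str) :
    rebuild τ (as ++ [a]) = rebuild τ as ++ [(τ (rebuild τ as), a)] := by
  simp [rebuild]

theorem Protocol.rebuild_play {k : ℕ} (Q : Protocol k) (z : Str) (τ : Transcript → Str)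
    (cs : List Str) (n : ℕ) :
    rebuild τ ((Q.play z τ cs n []).map Prod.snd) = Q.play z τ cs n [] := by
  induction n with
  | zero => rfl
  | succ n ih => rw [Protocol.play_succ, List.map_append, List.map_singleton, rebuild_append, ih]

theorem map_snd_liftAnswers (σ : Transcript → Str) (z : Str) (T₁ : Transcript) (as : List Str) :
    (liftAnswers σ z T₁ as).map Prod.snd =
      T₁.map Prod.snd ++ as.map fun a => encodeTuple [z, a] := by
  induction as using List.reverseRecOn with
  | nil => simp [liftAnswers]
  | append_singleton as a ih => rw [liftAnswers_append]; simp [ih]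

/-- Merlin claims `b`, then he gives the right answers to the queries `Z y`, and then he plays `τ z`
for the selected query `z`.  His message depends on the answers of Arthur. -/
def honestMessage (f : Str → Str) (Z : Str → List Str) (τ : Str → Transcript → Str) (b : Bool) :
    List Str → Str
  | [] => [b]
  | [y] => encodeTuple ((Z y).flatMap fun z => [f z, τ z []])
  | _ :: a :: as => τ (hd a) (rebuild (τ (hd a)) ((a :: as).map fun a => hd (tl a)))

/-- The honest strategy, with messages of length at most `p`. -/
def honest (f : Str → Str) (Z : Str → List Str) (τ : Str → Transcript → Str) (b : Bool) (p : ℕ)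
    (T : Transcript) : Str :=
  (honestMessage f Z τ b (T.map Prod.snd)).take p

section Composite

variable {k : ℕ} (Q : Protocol k) {f : Str → Str} {c : Prog} {q clk H : Polynomial ℕ}
  (p L : Polynomial ℕ)

/-- Since `τ z` is a function, Arthur's answers determine the whole transcript in `Q`, and the
honest Merlin can rebuild it. All cuts are harmless because admissible messages are short enough. -/
theorem play_subStrategy_honest {Z : Str → List Str} {τ : Str → Transcript → Str} {b : Bool} {N : ℕ}
    {z μ : Str} (hτ : ∀ T, τ z T ∈ Q.messages z) (hN : Q.msgLen.eval z.length ≤ N)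
    (hμ : k = 0 ∨ μ = τ z []) (m y : Str) (cs : List Str) (n : ℕ) (hn : n ≤ k) :
    Q.play z (subStrategy Q (honest f Z τ b N) z μ [(m, y)]) cs n [] = Q.play z (τ z) cs n [] := by
  induction n with
  | zero => rfl
  | succ n ih =>
    rw [Protocol.play_succ, Protocol.play_succ, ih (by omega)]
    have hlen : ∀ T, (τ z T).length ≤ Q.msgLen.eval z.length := fun T =>
      Q.mem_messages.1 (hτ T)
    have h1 : subStrategy Q (honest f Z τ b N) z μ [(m, y)] (Q.play z (τ z) cs n []) =
        τ z (Q.play z (τ z) cs n []) := by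
      rw [subStrategy]
      split_ifs with h
      · rw [h, hμ.resolve_left (by omega), List.take_of_length_le (hlen _)]
      · have h2 := Q.rebuild_play z (τ z) cs n
        set U := Q.play z (τ z) cs n [] with hU
        rw [honest, map_snd_liftAnswers]
        have h3 : honestMessage f Z τ b ([(m, y)].map Prod.snd ++
            (U.map Prod.snd).map fun a => encodeTuple [z, a]) = τ z U := by
          have h4 : ((U.map Prod.snd).map fun a => encodeTuple [z, a]).map (fun a => hd (tl a)) =
              U.map Prod.snd := by simp
          obtain ⟨u, U', hU'⟩ := List.exists_cons_of_ne_nil h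
          rw [hU'] at h4 h2 ⊢
          simp only [List.map_cons, List.map_nil, List.cons_append, List.nil_append,
            honestMessage] at h4 h2 ⊢
          rw [h4]
          simp [h2]
        rw [h3, List.take_of_length_le ((hlen _).trans hN), List.take_of_length_le (hlen _)]
    rw [h1]

variable (c q clk H)

/-- The expected reward for the string `y` and the secret bits `b`. -/
noncomputable def fiberReward (x : Str) (σ : Transcript → Str) (y b : Str) : ℚ :=
  avgs (L.eval x.length) k fun rs => (composite Q c q clk H p L).rewardOn x ((y ++ b) :: rs)
    ((composite Q c q clk H p L).play x σ ((y ++ b) :: rs) (k + 1) [])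

variable {c q clk H p L}

/-- The first random string splits into the public `y` and the secret bits. Merlin's second message
may depend on `y` but not on the secret bits, and this is what makes the selection unpredictable. -/
theorem stratReward_composite {x : Str} {n : ℕ} (hL : L.eval x.length = q.eval x.length + n)
    (σ : Transcript → Str) : (composite Q c q clk H p L).stratReward x σ (k + 1) [] =
      avg (q.eval x.length) fun y => avg n fun b => fiberReward Q c q clk H p L x σ y b := by
  rw [Protocol.stratReward_nil, avgs]
  have h : (composite Q c q clk H p L).coinLen = L := rfl
  rw [h, hL, avg_append, ← hL]
  rfl

theorem fiberReward_le_one (x : Str) (σ : Transcript → Str) (y b : Str) :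
    fiberReward Q c q clk H p L x σ y b ≤ 1 := by
  rw [← avgs_const (L.eval x.length) k 1]
  exact avgs_mono fun cs _ => ((composite Q c q clk H p L).R_mem _).2

variable {x y b : Str} {σ : Transcript → Str}

theorem fiberReward_of_answered (hy : y.length = q.eval x.length) {a b' : Str} {S : Store}
    (hS : selSim (width c + 1) c (encodeTuple [x, y]) (List.replicate (clk.eval x.length) true)
      (List.replicate (H.eval x.length) true) (secondMessage k σ y) b = S)
    (h3 : S (width c + 1 + 3) = []) (h0 : S 0 = a) (h2 : S (width c + 1 + 2) = b') :
    fiberReward Q c q clk H p L x σ y b = if b' = List.replicate b'.length true then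
      binFrac (scoreDigits (σ []) a (y ++ b)) else 0 := by
  refine Eq.trans ?_ (avgs_const (L.eval x.length) k _)
  refine avgs_congr fun rs hrs => ?_
  have e1 : (y ++ b).take (q.eval x.length) = y := by rw [← hy, List.take_left]
  have e2 : (y ++ b).drop (q.eval x.length) = b := by rw [← hy, List.drop_left]
  rw [rewardOn_play_composite Q p L x (y ++ b) rs hrs σ (S := S)
    (by rw [oracleSim, e1, e2]; exact hS) rfl rfl, if_pos h3, h0, h2]

/-- Once `y` and the secret bits are fixed, so is the selected query, and the remaining randomness
is exactly that of `Q`, up to unused bits. -/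
theorem fiberReward_of_selected (hy : y.length = q.eval x.length) {z w μ : Str} {S : Store}
    (hS : selSim (width c + 1) c (encodeTuple [x, y]) (List.replicate (clk.eval x.length) true)
      (List.replicate (H.eval x.length) true) (secondMessage k σ y) b = S)
    (hsel : Selected (width c + 1) (some (z, w, μ)) S)
    (hz : Q.coinLen.eval z.length ≤ L.eval x.length) :
    fiberReward Q c q clk H p L x σ y b = avgs (Q.coinLen.eval z.length) k fun cs =>
      Q.checkedReward z w cs (Q.play z (subStrategy Q σ z μ [(σ [], y)]) cs k []) := by
  rw [fiberReward, ← avgs_map_take hz]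
  refine avgs_congr fun rs hrs => ?_
  have e1 : (y ++ b).take (q.eval x.length) = y := by rw [← hy, List.take_left]
  have e2 : (y ++ b).drop (q.eval x.length) = b := by rw [← hy, List.drop_left]
  obtain ⟨h3, h5, h6, h7⟩ := hsel
  rw [rewardOn_play_composite Q p L x (y ++ b) rs hrs σ (S := S)
    (by rw [oracleSim, e1, e2]; exact hS) h5 h7, if_neg (by rw [h3]; simp), h6, e1]

/-- The optimal expected reward for a first message is, up to a term that does not depend on it, the
average score. -/
theorem exists_stratReward_composite {P : Protocol k} {B : Set Str} (hk : k = 0 → ∀ z, f z = [])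
    {T hP pf : Polynomial ℕ}
    (hc : ∀ v, ∃ (s : Store) (t : ℕ), Runs f c (initStore v) s t ∧ s 0 = charFn B v ∧
      t ≤ T.eval v.length)
    {D : Str → ℚ} (hD : ∀ z, 0 ≤ D z) {τ : Str → Transcript → Str}
    (hτ : ∀ z T, τ z T ∈ P.messages z)
    (hτD : ∀ z, avgs (P.coinLen.eval z.length) k
      (fun cs => P.checkedReward z (f z) cs (P.play z (τ z) cs k [])) = D z)
    (hle : ∀ (z : Str) (σ : Transcript → Str) (w : Str), (∀ T, σ T ∈ P.messages z) →
        avgs (P.coinLen.eval z.length) k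
          (fun cs => P.checkedReward z w cs (P.play z σ cs k [])) ≤
            D z - if w = f z then 0 else 1 / 2 ^ hP.eval z.length)
    (hpf : ∀ z, (f z).length ≤ pf.eval z.length)
    (x : Str) {n : ℕ} (hL : L.eval x.length = q.eval x.length + n)
    (hn : clk.eval x.length * H.eval x.length ≤ n)
    (hclk : ∀ y : Str, y.length = q.eval x.length →
      T.eval (encodeTuple [x, y]).length ≤ clk.eval x.length)
    (hcoin : P.coinLen.eval (clk.eval x.length) ≤ L.eval x.length)
    (hH : hP.eval (clk.eval x.length) + 1 ≤ H.eval x.length)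
    (hp1 : 1 + P.msgLen.eval (clk.eval x.length) ≤ p.eval x.length)
    (hp2 : 2 * clk.eval x.length * (2 * (pf.eval (clk.eval x.length) +
      P.msgLen.eval (clk.eval x.length)) + 1) ≤ p.eval x.length) :
    ∃ C : ℚ, ∀ (b : Str) (sc : Str → ℚ), (∀ y, 0 ≤ sc y) → (∀ y b', (y ++ b').length = L.eval x.length →
        binFrac (scoreDigits b (charFn B (encodeTuple [x, y])) (y ++ b')) = sc y) →
      (∀ σ : Transcript → Str, σ [] = b →
        (composite P c q clk H p L).stratReward x σ (k + 1) [] ≤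
          C + 1 / 2 ^ n * avg (q.eval x.length) sc) ∧
      ∀ b₀, b = [b₀] → ∃ σ : Transcript → Str,
        (∀ T, σ T ∈ (composite P c q clk H p L).messages x) ∧ σ [] = b ∧
        C + 1 / 2 ^ n * avg (q.eval x.length) sc ≤
          (composite P c q clk H p L).stratReward x σ (k + 1) [] := by
  -- The queries of the true run on `(x, y)`; for strings `y` of another length the list is a dummy.
  have hZ : ∀ y : Str, ∃ Z : List Str, y.length = q.eval x.length →
      Z.length ≤ clk.eval x.length ∧ (∀ z ∈ Z, z.length < clk.eval x.length) ∧ ∀ m b : Str,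
      match consume (selStep f (List.replicate (H.eval x.length) true)) Z (m, b) with
      | .inl θ =>
        selSim (width c + 1) c (encodeTuple [x, y]) (List.replicate (clk.eval x.length) true)
          (List.replicate (H.eval x.length) true) m b (width c + 1 + 3) = [] ∧
        selSim (width c + 1) c (encodeTuple [x, y]) (List.replicate (clk.eval x.length) true)
          (List.replicate (H.eval x.length) true) m b 0 = charFn B (encodeTuple [x, y]) ∧
        selSim (width c + 1) c (encodeTuple [x, y]) (List.replicate (clk.eval x.length) true)
          (List.replicate (H.eval x.length) true) m b (width c + 1 + 2) = θ.2
      | .inr φ => Selected (width c + 1) φ (selSim (width c + 1) c (encodeTuple [x, y])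
          (List.replicate (clk.eval x.length) true)
          (List.replicate (H.eval x.length) true) m b) := by
    intro y
    by_cases hy : y.length = q.eval x.length
    · obtain ⟨s, t, hr, h0, ht⟩ := hc (encodeTuple [x, y])
      obtain ⟨Z, h1, h2, h3⟩ := exists_queries (Nat.lt_succ_self (width c)) hr
        (ht.trans (hclk y hy)) (List.replicate (H.eval x.length) true)
        (List.replicate (clk.eval x.length) true) (by simp)
      rw [h0] at h3
      exact ⟨Z, fun _ => ⟨h1, h2, h3⟩⟩
    · exact ⟨[], fun h => absurd h hy⟩
  choose Z hZ using hZ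
  -- The constant is chosen before the claim: the queries depend on `x` and `y` only.
  refine ⟨avg (q.eval x.length) fun y => queryReward D (H.eval x.length) (Z y),
    fun b sc hsc hb => ⟨fun σ hσ => ?_, fun b₀ hb₀ => ?_⟩⟩
  · rw [stratReward_composite P hL, ← avg_add_mul]
    refine avg_mono fun y hy => ?_
    obtain ⟨h1, h2, h3⟩ := hZ y hy
    rw [one_div_mul_eq_div]
    refine avg_le_queryReward (f := f) (g := fun z => 1 / 2 ^ hP.eval z.length) hD (hsc y)
      (by omega) (Z y) (fun z hz => ?_) (secondMessage k σ y) n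
      ((Nat.mul_le_mul_right _ h1).trans hn) _ fun b' hb' => ?_
    · have h4 := eval_mono hP (h2 z hz).le
      rw [div_div, ← pow_succ]
      exact one_div_le_one_div_of_le (by positivity)
        (pow_le_pow_right₀ (by norm_num) (by omega))
    · have h4 := h3 (secondMessage k σ y) b'
      split at h4
      · rename_i θ heq
        rw [heq]
        rw [fiberReward_of_answered P hy rfl h4.1 h4.2.1 h4.2.2, hσ,
          hb y b' (by rw [List.length_append, hy, hb', hL])]
      · rename_i φ heq
        rw [heq]
        rcases φ with _ | ⟨z, w, μ⟩
        · exact fiberReward_le_one P x σ y b'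
        · intro hz
          rw [fiberReward_of_selected P hy rfl h4
            ((eval_mono _ (h2 z hz).le).trans hcoin)]
          -- The substrategy is admissible for every `σ`, since its messages are cut to the length
          -- allowed in the protocol for `z`.
          exact hle z _ w fun T => subStrategy_mem P σ z μ _ T
  · set σ := honest f Z τ b₀ (p.eval x.length) with hσ
    have hσ0 : σ [] = b := by
      rw [hσ, hb₀, honest]
      exact List.take_of_length_le (by simp [honestMessage]; omega)
    refine ⟨σ, fun T => ?_, hσ0, ?_⟩
    · rw [Protocol.mem_messages]
      exact List.length_take_le _ _
    rw [stratReward_composite P hL, ← avg_add_mul]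
    refine avg_mono fun y hy => ?_
    obtain ⟨h1, h2, h3⟩ := hZ y hy
    -- If there are rounds to be played, the string sent with an answer is the first message of the
    -- optimal strategy; without rounds nothing is required of it.
    have hm : Answers f (fun z μ => k = 0 ∨ μ = τ z []) (Z y) (secondMessage k σ y) := by
      rw [secondMessage]
      split_ifs with h0
      · exact answers_nil (Z y) (hk h0) fun _ => .inl h0
      · have h4 : σ [(σ [], y)] = encodeTuple ((Z y).flatMap fun z => [f z, τ z []]) := by
          rw [hσ, honest]
          refine List.take_of_length_le ((length_encodeTuple_le
            (B := pf.eval (clk.eval x.length) + P.msgLen.eval (clk.eval x.length)) ?_).trans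
            ((Nat.mul_le_mul_right _ ?_).trans hp2))
          · intro w hw
            obtain ⟨z, hz, hw⟩ := List.mem_flatMap.1 hw
            have e := (h2 z hz).le
            have e1 := (hpf z).trans (eval_mono pf e)
            have e2 := (P.mem_messages.1 (hτ z [])).trans (eval_mono P.msgLen e)
            simp only [List.mem_cons, List.not_mem_nil, or_false] at hw
            rcases hw with rfl | rfl <;> omega
          · simp only [List.length_flatMap, List.length_cons, List.length_nil, List.map_const',
              List.sum_replicate, smul_eq_mul]
            omega
        rw [h4]
        exact answers_encodeTuple (Z y) fun _ _ => .inr rfl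
    rw [one_div_mul_eq_div]
    refine queryReward_le_avg (f := f) (Z y) _ hm n
      ((Nat.mul_le_mul_right _ h1).trans hn) _ fun b' hb' => ?_
    have h4 := h3 (secondMessage k σ y) b'
    split at h4
    · rename_i θ heq
      rw [heq]
      rw [fiberReward_of_answered P hy rfl h4.1 h4.2.1 h4.2.2, hσ0,
        hb y b' (by rw [List.length_append, hy, hb', hL])]
    · rename_i φ heq
      rw [heq]
      rcases φ with _ | ⟨z, w, μ⟩
      · trivial
      · intro hz hw hμ
        have e := (h2 z hz).le
        rw [fiberReward_of_selected P hy rfl h4 ((eval_mono _ e).trans hcoin), hw, ← hτD z]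
        refine avgs_mono fun cs _ => ?_
        rw [hσ, play_subStrategy_honest P (hτ z)
          (by have := eval_mono P.msgLen e; omega) hμ _ y cs k le_rfl]

end Composite

/-! ### The inclusion -/

theorem Protocol.map_fst_transcript {k : ℕ} (P : Protocol k) (x : Str) (r : P.Coins x)
    (ms : List Str) : (P.transcript x r ms).map Prod.fst = ms := by
  induction ms using List.reverseRecOn with
  | nil => rfl
  | append_singleton ms m ih => rw [P.transcript_append]; simp [ih]

/-- The value is the claim in the first message. -/
theorem value_composite {k : ℕ} (Q : Protocol k) (c : Prog) (q clk H p L : Polynomial ℕ) (x : Str)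
    (r : (composite Q c q clk H p L).Coins x) (m : Str) (ms : List Str) :
    (composite Q c q clk H p L).value x ((composite Q c q clk H p L).transcript x r (m :: ms)) =
      if m.head? = some true then [true] else [false] := by
  have h := (composite Q c q clk H p L).map_fst_transcript x r (m :: ms)
  rcases hT : (composite Q c q clk H p L).transcript x r (m :: ms) with _ | ⟨⟨m', a⟩, T⟩
  · rw [hT] at h
    simp at h
  · rw [hT, List.map_cons, List.cons.injEq] at h
    obtain rfl : m' = m := h.1
    have e : item 1 (encodeTuple
        (x :: (((m', a) :: T).flatMap fun p => [p.1, p.2]).dropLast)) = m' := by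
      rw [item_encodeTuple]
      rcases T with _ | ⟨p, T⟩ <;> simp
    have h1 : (composite Q c q clk H p L).φ = fun w =>
        if (item 1 w).head? = some true then [true] else [false] := rfl
    rw [Protocol.value, h1]
    simp only [e]

/-- Without messages the empty play is rational vacuously, and the computed value depends on the
input alone. -/
theorem exists_polyTime_of_mem_FRMA_zero {f : Str → Str} (hf : f ∈ FRMA 0) : PolyTime f := by
  obtain ⟨P, hP⟩ := hf
  have h : f = fun z => P.φ (encodeTuple [z]) := by
    funext z
    exact (hP z (fun i => i.elim0) [] ⟨rfl, fun i hi => absurd hi (Nat.not_lt_zero i)⟩).symm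
  rw [h]
  exact P.φ_polyTime.comp (PolyTime.encodeTuple [fun z => z] (by simpa using PolyTime.id))

theorem const_nil_mem_FRMA_zero : (fun _ : Str => ([] : Str)) ∈ FRMA 0 := by
  refine ⟨⟨fun _ => [], fun _ => 0, fun _ => [], 0, 0, PolyTime.const [], PolyTime.const [],
    ⟨fun _ => [], PolyTime.const [], fun _ => rfl⟩, fun _ => by simp⟩, fun x r ms _ => rfl⟩

/-- The oracle may be taken to be trivial, if there are no rounds. -/
theorem exists_oracle {k : ℕ} {f : Str → Str} (hf : f ∈ FRMA k) {B : Set Str} (hB : B ∈ POracle f) :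
    ∃ g ∈ FRMA k, B ∈ POracle g ∧ (k = 0 → ∀ z, g z = []) := by
  rcases Nat.eq_zero_or_pos k with rfl | hk
  · exact ⟨_, const_nil_mem_FRMA_zero,
      PolyTimeIn.of_polyTime hB (exists_polyTime_of_mem_FRMA_zero hf), fun _ _ => rfl⟩
  · exact ⟨f, hf, hB, fun h => absurd h hk.ne'⟩

open scoped Classical in
theorem avg_indicator (n : ℕ) (S : Set Str) : avg n (fun y => if y ∈ S then 1 else 0) =
    (Nat.card {y : Fin n → Bool // List.ofFn y ∈ S} : ℚ) / 2 ^ n := by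
  rw [← expect_ofFn, Fintype.expect_eq_sum_div_card, Finset.sum_boole, Nat.card_eq_fintype_card,
    Fintype.card_subtype]
  simp

/-- If the reward of the first message is, up to a term that does not depend on it, proportional to
the score of the claim, then a rational first message makes a claim with the greater score. -/
theorem head_of_isRational {k : ℕ} {P : Protocol (k + 1)} {x m : Str} {C ε α δ : ℚ} (hε : 0 < ε)
    (h1 : 1 ≤ P.msgLen.eval x.length)
    (hup : ∀ σ : Transcript → Str, P.stratReward x σ (k + 1) [] ≤ C + ε *
      if (σ []).head? = some true then δ + (1 - δ) * α else 1 - α)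
    (hlow : ∀ b₀ : Bool, ∃ σ : Transcript → Str, (∀ T, σ T ∈ P.messages x) ∧ σ [] = [b₀] ∧
      (C + ε * if b₀ = true then δ + (1 - δ) * α else 1 - α) ≤ P.stratReward x σ (k + 1) [])
    (hm : P.IsRational x [] m) :
    if m.head? = some true then 1 - α ≤ δ + (1 - δ) * α else δ + (1 - δ) * α ≤ 1 - α := by
  obtain ⟨σ, -, hσ0, hσ⟩ := Protocol.exists_strategy_msgReward hm.1
  have hu := hup σ
  rw [hσ, hσ0] at hu
  have key : ∀ b₀ : Bool, (C + ε * if b₀ = true then δ + (1 - δ) * α else 1 - α) ≤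
      C + ε * if m.head? = some true then δ + (1 - δ) * α else 1 - α := by
    intro b₀
    obtain ⟨σ', hσ', hσ0', hl⟩ := hlow b₀
    have h2 := P.stratReward_le_msgReward x hσ' k [] (by simp)
    rw [hσ0'] at h2
    -- The honest reward for the claim `b₀` is at most the reward of its first message, hence at
    -- most that of the rational one, which is at most the upper bound.
    exact hl.trans (h2.trans ((hm.2 _ (P.mem_messages.2 (by simpa using h1))).trans hu))
  split_ifs with h
  · have := key false
    simp only [h, if_true, Bool.false_eq_true, if_false] at this
    exact le_of_mul_le_mul_left (by linarith) hε
  · have := key true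
    simp only [h, if_true, if_false] at this
    exact le_of_mul_le_mul_left (by linarith) hε

theorem PPOracle_FRMA_subset (k : ℕ) : PPOracle (FRMA k) ⊆ DRMA (k + 1) := by
  classical
  rintro A ⟨f₀, hf₀, B, hB₀, q, hA⟩
  obtain ⟨f, ⟨Q, hQ⟩, ⟨c, T, hc⟩, hk⟩ := exists_oracle hf₀ hB₀
  obtain ⟨hP, hhP⟩ := hQ.exists_checkedReward
  choose D hD0 hD1 hτ hle using hhP
  choose τ hτ hτD using hτ
  obtain ⟨pf, hpf⟩ := hQ.exists_length_le
  -- The code of `(x, y)` has length `2|x| + 2|y| + 2`; `clk` bounds the running time on it, and so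
  -- also the number and the lengths of the queries.
  obtain ⟨clk, hclk⟩ : ∃ clk : Polynomial ℕ, clk = T.comp (2 * Polynomial.X + 2 * q + 2) :=
    ⟨_, rfl⟩
  -- The additional bit gives `2⁻ᴴ ≤ g/2`, where `g` is the smallest loss possible for a query of
  -- length at most `clk`.
  obtain ⟨H, hH⟩ : ∃ H : Polynomial ℕ, H = hP.comp clk + 1 := ⟨_, rfl⟩
  -- Enough secret bits for one block per query and, as all random strings have the length `q + n`,
  -- for the coins of `Q`. The summand `1` makes `δ` smaller than `2^(-q)`.
  obtain ⟨n, hn⟩ : ∃ n : Polynomial ℕ, n = clk * H + Q.coinLen.comp clk + 1 := ⟨_, rfl⟩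
  -- Room for the claimed bit, for a message in `Q`, and for the list of at most `clk` answers, each
  -- with a first message.
  obtain ⟨p, hp⟩ : ∃ p : Polynomial ℕ, p = 1 + Q.msgLen.comp clk +
    2 * clk * (2 * (pf.comp clk + Q.msgLen.comp clk) + 1) := ⟨_, rfl⟩
  refine ⟨composite Q c q clk H p (q + n), fun x r ms hms => ?_⟩
  obtain ⟨hlen, hrat⟩ := hms
  obtain ⟨m, ms, rfl⟩ := List.exists_cons_of_length_eq_add_one hlen
  have hm : (composite Q c q clk H p (q + n)).IsRational x [] m := hrat 0 (by simp)
  rw [value_composite]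
  have hnx : n.eval x.length = clk.eval x.length * H.eval x.length +
      Q.coinLen.eval (clk.eval x.length) + 1 := by simp [hn]
  have hpx : p.eval x.length = 1 + Q.msgLen.eval (clk.eval x.length) +
      2 * clk.eval x.length * (2 * (pf.eval (clk.eval x.length) +
        Q.msgLen.eval (clk.eval x.length)) + 1) := by simp [hp]
  obtain ⟨C, hC⟩ := exists_stratReward_composite (P := Q) (B := B) (L := q + n) (p := p) (q := q)
    (clk := clk) (H := H) (n := n.eval x.length) hk hc hD0 hτ hτD hle hpf x (by simp)
    (by omega) (fun y hy => by simp [hclk, hy]; refine eval_mono T ?_; omega)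
    (by simp; omega) (by simp [hH]) (by omega) (by omega)
  set L := (q + n).eval x.length with hL
  set α : ℚ := avg (q.eval x.length) fun y => if encodeTuple [x, y] ∈ B then 1 else 0 with hα
  set δ : ℚ := 1 / 2 ^ L with hδ
  have hsc : ∀ b y b' : Str, (y ++ b').length = L →
      binFrac (scoreDigits b (charFn B (encodeTuple [x, y])) (y ++ b')) =
        if b.head? = some true then δ + (1 - δ) * (if encodeTuple [x, y] ∈ B then 1 else 0)
        else 1 + (-1) * (if encodeTuple [x, y] ∈ B then 1 else 0) := by
    intro b y b' h
    rw [binFrac_scoreDigits, h, charFn]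
    generalize encodeTuple [x, y] = v
    by_cases h1 : b.head? = some true <;> by_cases h2 : v ∈ B <;> simp [h1, h2, hδ]
  have hδ0 : 0 < δ := by positivity
  have hδ1 : δ ≤ 1 := by
    rw [hδ, div_le_one (by positivity)]
    exact one_le_pow₀ (by norm_num)
  have hsc0 : ∀ b y : Str, (0 : ℚ) ≤
      if b.head? = some true then δ + (1 - δ) * (if encodeTuple [x, y] ∈ B then 1 else 0)
        else 1 + (-1) * (if encodeTuple [x, y] ∈ B then 1 else 0) := by
    intro b y
    split_ifs <;> linarith
  have hav : ∀ b : Str, (avg (q.eval x.length) fun y =>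
      if b.head? = some true then δ + (1 - δ) * (if encodeTuple [x, y] ∈ B then 1 else 0)
        else 1 + (-1) * (if encodeTuple [x, y] ∈ B then 1 else 0)) =
      if b.head? = some true then δ + (1 - δ) * α else 1 - α := by
    intro b
    split_ifs
    · rw [avg_add_mul, avg_const]
    · rw [avg_add_mul, avg_const, ← hα]
      ring
  have hhead := head_of_isRational (C := C) (ε := 1 / 2 ^ n.eval x.length) (α := α) (δ := δ)
    (by positivity) (by have : 1 ≤ p.eval x.length := by omega
                        exact this)
    (fun σ => by
      rw [← hav]
      exact (hC (σ []) _ (hsc0 _) (hsc _)).1 σ rfl)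
    (fun b₀ => by
      obtain ⟨σ, h1, h2, h3⟩ := (hC [b₀] _ (hsc0 _) (hsc _)).2 b₀ rfl
      rw [hav] at h3
      exact ⟨σ, h1, h2, by simpa using h3⟩) hm
  have hαA : x ∈ A ↔ 1 / 2 ≤ α := by
    rw [hA x, hα]
    exact iff_of_eq (congrArg _ (avg_indicator _ {y | encodeTuple [x, y] ∈ B}).symm)
  have hα0 : 0 ≤ α := by
    rw [← avg_const (q.eval x.length) 0]
    exact avg_mono fun y _ => by split_ifs <;> norm_num
  have hα1 : α ≤ 1 := by
    rw [← avg_const (q.eval x.length) 1]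
    exact avg_mono fun y _ => by split_ifs <;> norm_num
  by_cases hx : x ∈ A
  · have h1 := hαA.1 hx
    rw [charFn, if_pos hx, if_pos]
    by_contra h
    rw [if_neg h] at hhead
    have h2 : 0 ≤ δ * (1 - α) := mul_nonneg hδ0.le (by linarith)
    -- At `α = 1/2` only the bonus `δ(1 - α) > 0` makes the claim `1` strictly better.
    obtain h3 | h3 := h1.eq_or_lt
    · rw [← h3] at hhead
      linarith
    · linarith
  · have h1 : α < 1 / 2 := not_le.1 fun h => hx (hαA.2 h)
    rw [charFn, if_neg hx, if_neg]
    intro h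
    rw [if_pos h] at hhead
    have h2 : 0 ≤ δ * α := mul_nonneg hδ0.le hα0
    have h3 : δ < 1 / 2 ^ q.eval x.length := by
      rw [hδ]
      refine one_div_lt_one_div_of_lt (by positivity) (pow_lt_pow_right₀ (by norm_num) ?_)
      rw [hL, Polynomial.eval_add]
      omega
    -- Acceptance is counted by an integer: if fewer than half of the `2^q` strings are accepted,
    -- the deficit `2^q - 2N` is at least `1`.
    have h4 : 1 / 2 ^ q.eval x.length ≤ 1 - 2 * α := by
      have h5 : α = _ := avg_indicator (q.eval x.length) {y | encodeTuple [x, y] ∈ B}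
      have h6 : (0 : ℚ) < 2 ^ q.eval x.length := by positivity
      rw [h5, div_lt_div_iff₀ h6 two_pos, one_mul] at h1
      rw [h5, div_le_iff₀ h6, sub_mul, one_mul, ← mul_div_assoc, div_mul_cancel₀ _ h6.ne']
      have h7 : ∀ N : ℕ, (N : ℚ) * 2 < 2 ^ q.eval x.length →
          1 ≤ (2 : ℚ) ^ q.eval x.length - 2 * N := by
        intro N hN
        have h8 : N * 2 + 1 ≤ 2 ^ q.eval x.length := by exact_mod_cast hN
        have h9 : (N : ℚ) * 2 + 1 ≤ 2 ^ q.eval x.length := by exact_mod_cast h8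
        linarith
      exact h7 _ h1
    linarith

end RationalProofs

theorem mainTheorem3 (k : ℕ) :
    RationalProofs.PPOracle (RationalProofs.FRMA k) ⊆ RationalProofs.DRMA (k + 1) :=
  RationalProofs.PPOracle_FRMA_subset k
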